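/- Let $N\in\mathbb N$. For $k=1,\dots,N$ let $\mathfrak K_k$ be a complex Hilbert space, $h_{0,k}$ a positive (possibly unbounded) self-adjoint operator on $\mathfrak K_k$, and $g_k\in\mathfrak K_k$. Let $\Omega>0$ and $\lambda>0$. Put $\mathfrak K=\bigoplus_{k=1}^N\mathfrak K_k$, $g=(g_1,\dots,g_N)$, $h_{0,0}=\bigoplus_{k=1}^N h_{0,k}$, with spectral measure $E_0$ and spectrum $\sigma_0$. Inner products are antilinear in the first argument. On $\mathbb C\oplus\mathfrak K$ let $h$ be the self-adjoint operator $$h\,(c,\psi)=\bigl(\Omega c+\lambda\langle g,\psi\rangle,\; h_{0,0}\psi+\lambda c\,g\bigr),\qquad c\in\mathbb C,\ \psi\in D(h_{0,0}).$$ A pair $(\psi,\xi)$ of vectors of $\mathfrak K$ satisfies (Abs) if $\sup_{\nu\in\mathbb R,\,\varepsilon>0}|\langle\psi_k,(\nu-h_{0,k}\pm i\varepsilon)^{-1}\xi_k\rangle|<\infty$ for every $k$ and both signs. Let $\mathfrak h(g)$ be the set of all $\psi\in\mathfrak K$ such that $(\psi,g)$ satisfies (Abs). Put $$\eta(z)=z-\Omega-\lambda^2\int_{\sigma_0}\frac{1}{z-\nu}\,d\langle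 g,E_0(\nu)g\rangle,\qquad \eta_\pm(x)=\lim_{\varepsilon\searrow0}\eta(x\pm i\varepsilon).$$ Assume (A): $(g,g)$ satisfies (Abs); and (B): $1/\eta_+\in L^\infty(\mathbb R)$. Let $c,d\in\mathbb C$ and $\psi,\xi\in\mathfrak h(g)$ be such that $(\psi,\xi)$ satisfies (Abs), let $t\in\mathbb R$, and put $f=(c,\psi)$, $$F(\nu;f)=c+\lambda\lim_{\varepsilon\searrow0}\langle g,(\nu-h_{0,0}-i\varepsilon)^{-1}\psi\rangle,\qquad \varphi(f)=\psi+\lambda\,\frac{F(h_{0,0};f)}{\eta_-(h_{0,0})}\,g,$$ $$\langle\xi,(h_{0,0}-\nu-i0)^{-1}g\rangle=\lim_{\varepsilon\searrow0}\langle\xi,(h_{0,0}-\nu-i\varepsilon)^{-1}g\rangle.$$ Then the limits defining $\eta_\pm(\nu)$, $F(\nu;f)$ and $\langle\xi,(h_{0,0}-\nu-i0)^{-1}g\rangle$ exist for Lebesgue-almost every $\nu\in\mathbb R$; the measures $d\langle g,E_0(\nu)g\rangle$ and $d\langle g,E_0(\nu)\varphi(f)\rangle$ are absolutely continuous with respect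 to Lebesgue measure; $g$ lies in the domain of $F(h_{0,0};f)/\eta_-(h_{0,0})$; the two integrals below converge absolutely; and $$\langle(d,\xi),\,e^{ith}(c,\psi)\rangle=\overline d\,c(t)+\langle\xi,\psi(t)\rangle,$$ where $$c(t)=\lambda\Bigl\langle g,\frac{e^{ith_{0,0}}}{\eta_+(h_{0,0})}\varphi(f)\Bigr\rangle:=\lambda\int_{\mathbb R}\frac{e^{it\nu}}{\eta_+(\nu)}\,d\langle g,E_0(\nu)\varphi(f)\rangle,$$ $$\langle\xi,\psi(t)\rangle:=\langle\xi,e^{ith_{0,0}}\varphi(f)\rangle-\lambda^2\int_{\sigma_0}\frac{e^{it\nu}}{\eta_+(\nu)}\,\langle\xi,(h_{0,0}-\nu-i0)^{-1}g\rangle\,d\langle g,E_0(\nu)\varphi(f)\rangle.$$ -/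

import Mathlib

open MeasureTheory Filter Topology ComplexConjugate
open scoped InnerProductSpace ENNReal

noncomputable section

namespace CoupledReservoirs

section Operators

variable {H : Type*} [NormedAddCommGroup H] [InnerProductSpace ℂ H]

/-! ### Resolvents and spectrum of unbounded operators -/

/-- `R` is a bounded two-sided inverse of `z - A`. -/
def IsResolventAt (A : H →ₗ.[ℂ] H) (z : ℂ) (R : H →L[ℂ] H) : Prop :=
  (∀ x : H, ∃ hx : R x ∈ A.domain, z • R x - A ⟨R x, hx⟩ = x) ∧
    ∀ y : A.domain, R (z • (y : H) - A y) = y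

open Classical in
/-- The resolvent `(z - A)⁻¹`; the value is `0` when `z` is not in the resolvent set. -/
def res (A : H →ₗ.[ℂ] H) (z : ℂ) : H →L[ℂ] H :=
  if h : ∃ R, IsResolventAt A z R then h.choose else 0

/-- The real part `σ(A) ∩ ℝ` of the spectrum, which is all of `σ(A)` for self-adjoint `A`. -/
def realSpectrum (A : H →ₗ.[ℂ] H) : Set ℝ :=
  {x | ¬ ∃ R, IsResolventAt A (x : ℂ) R}

/-! ### Projection-valued measures -/

/-- A projection-valued measure on the Borel sets of `ℝ`: orthogonal projections, multiplicative,
normalized, and countably additive in the strong operator topology. The value on a set which is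
not measurable is `0`. -/
structure PVM (H : Type*) [NormedAddCommGroup H] [InnerProductSpace ℂ H] [CompleteSpace H] where
  proj : Set ℝ → H →L[ℂ] H
  isStarProjection : ∀ S, IsStarProjection (proj S)
  proj_not_measurable : ∀ S, ¬ MeasurableSet S → proj S = 0
  proj_univ : proj Set.univ = 1
  proj_inter : ∀ S T, MeasurableSet S → MeasurableSet T → proj (S ∩ T) = proj S * proj T
  hasSum_proj : ∀ S : ℕ → Set ℝ, (∀ n, MeasurableSet (S n)) →
    Pairwise (Function.onFun Disjoint S) →
      ∀ x, HasSum (fun n => proj (S n) x) (proj (⋃ n, S n) x)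

variable [CompleteSpace H]

lemma PVM.proj_empty_apply (E : PVM H) (x : H) : E.proj ∅ x = 0 := by
  have h := E.hasSum_proj (fun _ => ∅) (fun _ => MeasurableSet.empty)
    (fun _ _ _ => disjoint_bot_left) x
  simp only [Set.iUnion_empty] at h
  have h2 := h.summable.tendsto_atTop_zero
  exact tendsto_nhds_unique tendsto_const_nhds h2

lemma PVM.inner_proj_self (E : PVM H) (S : Set ℝ) (x : H) :
    ⟪x, E.proj S x⟫_ℂ = ((‖E.proj S x‖ ^ 2 : ℝ) : ℂ) := by
  have hsa : ContinuousLinearMap.adjoint (E.proj S) = E.proj S :=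
    (E.isStarProjection S).isSelfAdjoint
  have hid : E.proj S (E.proj S x) = E.proj S x :=
    congrArg (fun T : H →L[ℂ] H => T x) (E.isStarProjection S).isIdempotentElem
  have h : ⟪E.proj S x, E.proj S x⟫_ℂ = ⟪x, E.proj S x⟫_ℂ := by
    conv_lhs => rw [← hsa, ContinuousLinearMap.adjoint_inner_left, hsa, hid]
  rw [← h, inner_self_eq_norm_sq_to_K]
  norm_cast

/-- The complex measure `S ↦ ⟨x, E(S) y⟩`. -/
def PVM.complexMeasure (E : PVM H) (x y : H) : ComplexMeasure ℝ where
  measureOf' S := ⟪x, E.proj S y⟫_ℂ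
  empty' := by rw [E.proj_empty_apply, inner_zero_right]
  not_measurable' S hS := by simp [E.proj_not_measurable S hS]
  m_iUnion' S hS hd := (E.hasSum_proj S hS hd y).mapL (innerSL ℂ x)

/-- The finite positive measure `S ↦ ⟨x, E(S) x⟩ = ‖E(S) x‖²`. -/
def PVM.measure (E : PVM H) (x : H) : Measure ℝ :=
  Measure.ofMeasurable (fun S _ => ENNReal.ofReal (‖E.proj S x‖ ^ 2))
    (by simp [E.proj_empty_apply])
    (by
      intro S hS hd
      have h1 := (E.hasSum_proj S hS hd x).mapL (innerSL ℂ x)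
      have h2 : HasSum (fun n => ‖E.proj (S n) x‖ ^ 2) (‖E.proj (⋃ n, S n) x‖ ^ 2) := by
        have h3 := h1.mapL Complex.reCLM
        simpa [E.inner_proj_self, ← Complex.ofReal_pow] using h3
      rw [← h2.tsum_eq]
      exact ENNReal.ofReal_tsum_of_nonneg (fun n => by positivity) h2.summable)

/-- `⟨x, (∫ f dE) y⟩ = ∫_{ℝ} f(ν) d⟨x, E(ν) y⟩`. -/
def PVM.form (E : PVM H) (f : ℝ → ℂ) (x y : H) : ℂ :=
  (E.complexMeasure x y).integral f (ContinuousLinearMap.mul ℝ ℂ)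

open Classical in
/-- The vector `(∫ f dE) y`, that is, the vector `v` with `⟨x, v⟩ = ∫ f(ν) d⟨x, E(ν) y⟩` for all
`x`. The domain of `∫ f dE` consists of the `y` with `∫ |f(ν)|² d⟨y, E(ν) y⟩ < ∞`; the value is `0`
outside of it. -/
def PVM.apply (E : PVM H) (f : ℝ → ℂ) (y : H) : H :=
  if h : MemLp f 2 (E.measure y) ∧ ∃ v : H, ∀ x : H, ⟪x, v⟫_ℂ = E.form f x y
    then h.2.choose else 0

/-- `E` is the spectral measure of `A`, that is, `A = ∫ ν dE(ν)` with equality of domains. -/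
def IsSpectralMeasure (A : H →ₗ.[ℂ] H) (E : PVM H) : Prop :=
  (∀ y : H, y ∈ A.domain ↔ Integrable (fun ν : ℝ => ν ^ 2) (E.measure y)) ∧
    ∀ (y : A.domain) (x : H), ⟪x, A y⟫_ℂ = E.form (fun ν => (ν : ℂ)) x y

open Classical in
/-- The projection-valued measure concentrated at `0`, used only as a default value. -/
def PVM.atZero : PVM H where
  proj S := if MeasurableSet S ∧ (0 : ℝ) ∈ S then 1 else 0
  isStarProjection S := by
    split_ifs
    · exact IsStarProjection.one _
    · exact IsStarProjection.zero _
  proj_not_measurable S hS := by simp [hS]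
  proj_univ := by simp
  proj_inter S T hS hT := by
    by_cases h1 : (0 : ℝ) ∈ S <;> by_cases h2 : (0 : ℝ) ∈ T <;> simp [hS, hT, h1, h2]
  hasSum_proj S hS hd x := by
    have h := (VectorMeasure.dirac (0 : ℝ) x).m_iUnion hS hd
    have key : ∀ T : Set ℝ, MeasurableSet T →
        (if MeasurableSet T ∧ (0 : ℝ) ∈ T then (1 : H →L[ℂ] H) else 0) x
          = VectorMeasure.dirac (0 : ℝ) x T := by
      intro T hT
      by_cases h0 : (0 : ℝ) ∈ T <;> simp [hT, h0]
    simpa only [key _ (hS _), key _ (MeasurableSet.iUnion hS)] using h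

open Classical in
/-- The spectral measure of `A`. By the spectral theorem it exists and is unique for self-adjoint
`A`. -/
def spectralMeasure (A : H →ₗ.[ℂ] H) : PVM H :=
  if h : ∃ E, IsSpectralMeasure A E then h.choose else PVM.atZero

/-- `e^{itA} x` for self-adjoint `A`. -/
def expI (A : H →ₗ.[ℂ] H) (t : ℝ) (x : H) : H :=
  (spectralMeasure A).apply (fun ν => Complex.exp (Complex.I * t * ν)) x

end Operators

/-! ### The one-particle Hamiltonians -/

section Sum

variable {N : ℕ} {K : Fin N → Type*} [∀ k, NormedAddCommGroup (K k)]
  [∀ k, InnerProductSpace ℂ (K k)]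

/-- The orthogonal direct sum `⨁ₖ hₖ` on the Hilbert space `⨁ₖ 𝔎ₖ`. -/
def directSum (h : ∀ k, K k →ₗ.[ℂ] K k) : PiLp 2 K →ₗ.[ℂ] PiLp 2 K where
  domain :=
    { carrier := {ψ | ∀ k, ψ k ∈ (h k).domain}
      add_mem' := fun ha hb k => (h k).domain.add_mem (ha k) (hb k)
      zero_mem' := fun k => (h k).domain.zero_mem
      smul_mem' := fun c _ ha k => (h k).domain.smul_mem c (ha k) }
  toFun :=
    { toFun := fun ψ => WithLp.toLp 2 fun k => h k ⟨(ψ : PiLp 2 K) k, ψ.2 k⟩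
      map_add' := fun a b => by
        ext k
        exact (h k).map_add ⟨_, a.2 k⟩ ⟨_, b.2 k⟩
      map_smul' := fun c a => by
        ext k
        exact (h k).map_smul c ⟨_, a.2 k⟩ }

/-- Condition (Abs) for a pair of vectors, with respect to the operator `A`: the matrix elements
`⟨ψ, (ν - A ± iε)⁻¹ ξ⟩` are bounded uniformly in `ν ∈ ℝ` and `ε > 0`. -/
def Abs {H : Type*} [NormedAddCommGroup H] [InnerProductSpace ℂ H] (A : H →ₗ.[ℂ] H)
    (ψ ξ : H) : Prop :=
  ∃ C : ℝ, ∀ ν ε : ℝ, 0 < ε →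
    ‖⟪ψ, res A (ν + Complex.I * ε) ξ⟫_ℂ‖ ≤ C ∧ ‖⟪ψ, res A (ν - Complex.I * ε) ξ⟫_ℂ‖ ≤ C

/-- Condition (Abs) for vectors of the direct sum: it holds in every component. -/
def AbsSum (h : ∀ k, K k →ₗ.[ℂ] K k) (ψ ξ : PiLp 2 K) : Prop :=
  ∀ k, Abs (h k) (ψ k) (ξ k)

/-- The set `𝔥(g)` of the vectors `ψ` for which `(ψ, g)` satisfies (Abs). -/
def absSet (h : ∀ k, K k →ₗ.[ℂ] K k) (g : PiLp 2 K) : Set (PiLp 2 K) :=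
  {ψ | AbsSum h ψ g}

end Sum

section Model

variable {H : Type*} [NormedAddCommGroup H] [InnerProductSpace ℂ H]

/-- The coupled Hamiltonian `(c, ψ) ↦ (Ω c + lam ⟨g, ψ⟩, A ψ + lam c g)` on `ℂ ⊕ H`, with domain
`ℂ ⊕ D(A)`. -/
def coupled (A : H →ₗ.[ℂ] H) (g : H) (Ω lam : ℝ) :
    WithLp 2 (ℂ × H) →ₗ.[ℂ] WithLp 2 (ℂ × H) where
  domain :=
    { carrier := {x | x.snd ∈ A.domain}
      add_mem' := fun ha hb => A.domain.add_mem ha hb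
      zero_mem' := A.domain.zero_mem
      smul_mem' := fun c _ ha => A.domain.smul_mem c ha }
  toFun :=
    { toFun := fun x => WithLp.toLp 2
        ((Ω : ℂ) * (x : WithLp 2 (ℂ × H)).fst + (lam : ℂ) * ⟪g, (x : WithLp 2 (ℂ × H)).snd⟫_ℂ,
          A ⟨(x : WithLp 2 (ℂ × H)).snd, x.2⟩ + ((lam : ℂ) * (x : WithLp 2 (ℂ × H)).fst) • g)
      map_add' := fun a b => by
        have h := A.map_add ⟨_, a.2⟩ ⟨_, b.2⟩
        have h' : A ⟨((a + b : _) : WithLp 2 (ℂ × H)).snd, (a + b).2⟩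
          = A ⟨_, a.2⟩ + A ⟨_, b.2⟩ := h
        apply WithLp.ofLp_injective
        refine Prod.ext ?_ ?_
        · simp
          ring
        · simp only [h', WithLp.ofLp_add, Prod.snd_add]
          simp [mul_add, add_smul]
          abel
      map_smul' := fun c a => by
        have h := A.map_smul c ⟨_, a.2⟩
        have h' : A ⟨((c • a : _) : WithLp 2 (ℂ × H)).snd, (c • a).2⟩ = c • A ⟨_, a.2⟩ := h
        apply WithLp.ofLp_injective
        refine Prod.ext ?_ ?_
        · simp
          ring
        · simp only [h', WithLp.ofLp_smul, RingHom.id_apply]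
          simp [smul_smul, smul_add]
          ring_nf }

variable [CompleteSpace H]

/-- `η(z) = z - Ω - lam² ∫_{σ(A)} (z - ν)⁻¹ d⟨g, E(ν) g⟩`. -/
def eta (A : H →ₗ.[ℂ] H) (g : H) (Ω lam : ℝ) (z : ℂ) : ℂ :=
  z - Ω - (lam : ℂ) ^ 2 * ∫ ν in realSpectrum A, (z - (ν : ℂ))⁻¹ ∂((spectralMeasure A).measure g)

/-- `η₊(x) = lim_{ε ↘ 0} η(x + iε)`. -/
def etaPlus (A : H →ₗ.[ℂ] H) (g : H) (Ω lam : ℝ) (x : ℝ) : ℂ :=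
  limUnder (𝓝[>] (0 : ℝ)) fun ε : ℝ => eta A g Ω lam (x + Complex.I * ε)

/-- `η₋(x) = lim_{ε ↘ 0} η(x - iε)`. -/
def etaMinus (A : H →ₗ.[ℂ] H) (g : H) (Ω lam : ℝ) (x : ℝ) : ℂ :=
  limUnder (𝓝[>] (0 : ℝ)) fun ε : ℝ => eta A g Ω lam (x - Complex.I * ε)

/-- Condition (B): `1 / η₊` belongs to `L^∞(ℝ)`; in particular it is defined almost everywhere. -/
def CondB (A : H →ₗ.[ℂ] H) (g : H) (Ω lam : ℝ) : Prop :=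
  (∀ᵐ x : ℝ, etaPlus A g Ω lam x ≠ 0) ∧ MemLp (fun x : ℝ => 1 / etaPlus A g Ω lam x) ∞ volume

/-- `⟨x, (ν - A - i0)⁻¹ y⟩ = lim_{ε ↘ 0} ⟨x, (ν - A - iε)⁻¹ y⟩`. -/
def resMinus (A : H →ₗ.[ℂ] H) (x y : H) (ν : ℝ) : ℂ :=
  limUnder (𝓝[>] (0 : ℝ)) fun ε : ℝ => ⟪x, res A (ν - Complex.I * ε) y⟫_ℂ

/-- `⟨x, (A - ν - i0)⁻¹ y⟩ = lim_{ε ↘ 0} ⟨x, (A - ν - iε)⁻¹ y⟩`, where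
`(A - w)⁻¹ = - (w - A)⁻¹`. -/
def resFlip (A : H →ₗ.[ℂ] H) (x y : H) (ν : ℝ) : ℂ :=
  limUnder (𝓝[>] (0 : ℝ)) fun ε : ℝ => ⟪x, -(res A (ν + Complex.I * ε) y)⟫_ℂ

/-- `F(ν; f) = c + lam ⟨g, (ν - A - i0)⁻¹ ψ⟩` for `f = (c, ψ)`. -/
def bigF (A : H →ₗ.[ℂ] H) (g : H) (lam : ℝ) (c : ℂ) (ψ : H) (ν : ℝ) : ℂ :=
  c + lam * resMinus A g ψ ν

/-- `φ(f) = ψ + lam (F(A; f) / η₋(A)) g` for `f = (c, ψ)`. -/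
def phi (A : H →ₗ.[ℂ] H) (g : H) (Ω lam : ℝ) (c : ℂ) (ψ : H) : H :=
  ψ + (lam : ℂ) •
    (spectralMeasure A).apply (fun ν => bigF A g lam c ψ ν / etaMinus A g Ω lam ν) g

/-- `c(t) = lam ⟨g, (e^{itA} / η₊(A)) φ(f)⟩`. -/
def evolC (A : H →ₗ.[ℂ] H) (g : H) (Ω lam : ℝ) (c : ℂ) (ψ : H) (t : ℝ) : ℂ :=
  lam * (spectralMeasure A).form
    (fun ν => Complex.exp (Complex.I * t * ν) / etaPlus A g Ω lam ν) g (phi A g Ω lam c ψ)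

/-- The form `⟨ξ, ψ(t)⟩ = ⟨ξ, e^{itA} φ(f)⟩
  - lam² ∫_{σ(A)} (e^{itν} / η₊(ν)) ⟨ξ, (A - ν - i0)⁻¹ g⟩ d⟨g, E(ν) φ(f)⟩`. -/
def evolPsi (A : H →ₗ.[ℂ] H) (g : H) (Ω lam : ℝ) (c : ℂ) (ψ ξ : H) (t : ℝ) : ℂ :=
  ⟪ξ, expI A t (phi A g Ω lam c ψ)⟫_ℂ -
    (lam : ℂ) ^ 2 *
      (((spectralMeasure A).complexMeasure g (phi A g Ω lam c ψ)).restrict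
        (realSpectrum A)).integral
        (fun ν => Complex.exp (Complex.I * t * ν) / etaPlus A g Ω lam ν * resFlip A ξ g ν)
        (ContinuousLinearMap.mul ℝ ℂ)

end Model

end CoupledReservoirs

end

open CoupledReservoirs

/-! The resolvent of the coupled operator is explicit. With R(z) the resolvent of the uncoupled
operator, eliminating the reservoir component (a Schur complement) gives ⟨(d,ξ), (z-h)⁻¹(c,ψ)⟩ = (c
+ λ⟨g,R(z)ψ⟩)(d̄ + λ⟨ξ,R(z)g⟩)/η(z) + ⟨ξ,R(z)ψ⟩; this is `inner_res_coupled`. A matrix element of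
e^{ith} integrates e^{itν} against the complex measure whose Stieltjes transform is this function,
so the task is to recover that measure from the boundary values of its transform.

The analytic core is `stieltjes_boundary`: a complex measure whose Stieltjes transform is bounded
off the real axis has boundary values a.e. from both sides, and it is absolutely continuous with
density (2πi)⁻¹(G₋ - G₊). Existence of the boundary values is Fatou's theorem
(`exists_boundary_value`): a weak limit along lines approaching the real axis represents the
function as a Poisson integral, and Poisson integrals converge at Lebesgue points. The density is
identified because the Poisson kernel is the jump of the Cauchy kernel.

Condition (Abs) bounds every factor of the resolvent formula except 1/η. Condition (B) bounds 1/η on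
the boundary only, and in general boundary bounds do not control a holomorphic function inside. Here
Im η(z) ≥ Im z in the upper half-plane, so i/η has positive real part, and for such functions the
boundary bound does propagate (`norm_le_of_boundary_value`, applied in `exists_norm_inv_eta_le`).
Hence (Abs) passes to the coupled operator (`abs_coupled`).

Both sides of the formula are now integrals of e^{itν} against explicit densities. They agree
pointwise a.e. by algebra from λ²(G₋ - G₊) = η₊ - η₋, where G± are the boundary values of ⟨g,R(z)g⟩;
this is the end of `coupled_evolution`. The spectral theorem is derived along the way
(`exists_isSpectralMeasure`), by applying the continuous functional calculus to the normal operator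
(i - A)⁻¹. -/

noncomputable section

namespace CoupledReservoirs

/-! ### The Poisson kernel of the half-plane -/

/-- The Poisson kernel of the upper half-plane, `y / (π ((s - x)² + y²))`. -/
def poissonHP (y x s : ℝ) : ℝ := Real.pi⁻¹ * y * ((s - x) ^ 2 + y ^ 2)⁻¹

lemma poissonHP_eq_cauchyPDFReal {y : ℝ} (hy : 0 < y) (x s : ℝ) :
    poissonHP y x s = ProbabilityTheory.cauchyPDFReal x y.toNNReal s := by
  rw [ProbabilityTheory.cauchyPDFReal_def, Real.coe_toNNReal _ hy.le, poissonHP]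

lemma poissonHP_pos {y : ℝ} (hy : 0 < y) (x s : ℝ) : 0 < poissonHP y x s := by
  unfold poissonHP
  positivity

lemma poissonHP_comm (y x s : ℝ) : poissonHP y x s = poissonHP y s x := by
  unfold poissonHP
  ring_nf

lemma continuous_poissonHP {y : ℝ} (hy : 0 < y) :
    Continuous fun p : ℝ × ℝ => poissonHP y p.1 p.2 := by
  unfold poissonHP
  refine continuous_const.mul (Continuous.inv₀ (by fun_prop) fun p => ?_)
  positivity

lemma continuous_poissonHP_right {y : ℝ} (hy : 0 < y) (x : ℝ) :
    Continuous (poissonHP y x) :=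
  (continuous_poissonHP hy).comp (by fun_prop : Continuous fun s : ℝ => (x, s))

lemma integrable_poissonHP {y : ℝ} (hy : 0 < y) (x : ℝ) : Integrable (poissonHP y x) := by
  have : poissonHP y x = ProbabilityTheory.cauchyPDFReal x y.toNNReal :=
    funext (poissonHP_eq_cauchyPDFReal hy x)
  rw [this]
  exact ProbabilityTheory.integrable_cauchyPDFReal x

lemma integral_poissonHP {y : ℝ} (hy : 0 < y) (x : ℝ) : ∫ s, poissonHP y x s = 1 := by
  have : poissonHP y x = ProbabilityTheory.cauchyPDFReal x y.toNNReal :=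
    funext (poissonHP_eq_cauchyPDFReal hy x)
  rw [this]
  exact ProbabilityTheory.integral_cauchyPDFReal_eq_one x (by simpa using hy)

lemma integrable_poissonHP_mul {y : ℝ} (hy : 0 < y) (x : ℝ) {f : ℝ → ℂ}
    (hf : AEStronglyMeasurable f volume) {C : ℝ} (hC : ∀ᵐ s, ‖f s‖ ≤ C) :
    Integrable fun s => (poissonHP y x s : ℂ) * f s :=
  (integrable_poissonHP hy x).ofReal.mul_bdd hf hC

/-- Partial fractions with poles at x ± iy. Through this identity the Poisson integral of a measure
is the jump of its Stieltjes transform across the real axis. -/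
lemma poissonHP_eq_resolvent_jump {y : ℝ} (hy : 0 < y) (x s : ℝ) :
    (poissonHP y x s : ℂ) = (2 * Real.pi * Complex.I)⁻¹ *
      (((x : ℂ) - Complex.I * y - s)⁻¹ - ((x : ℂ) + Complex.I * y - s)⁻¹) := by
  have h1 : (x : ℂ) - Complex.I * y - s ≠ 0 := fun h => by
    have := congrArg Complex.im h
    simp at this
    exact hy.ne' this
  have h2 : (x : ℂ) + Complex.I * y - s ≠ 0 := fun h => by
    have := congrArg Complex.im h
    simp at this
    exact hy.ne' this
  have h3 : ((s : ℂ) - x) ^ 2 + (y : ℂ) ^ 2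
      = ((x : ℂ) - Complex.I * y - s) * ((x : ℂ) + Complex.I * y - s) := by
    linear_combination (y : ℂ) ^ 2 * Complex.I_sq
  have hpi : (Real.pi : ℂ) ≠ 0 := by exact_mod_cast Real.pi_ne_zero
  unfold poissonHP
  push_cast
  rw [h3, inv_sub_inv h1 h2]
  have h4 : (x : ℂ) + Complex.I * y - s - (x - Complex.I * y - s) = 2 * Complex.I * y := by ring
  rw [h4, mul_inv, mul_inv]
  have hI : Complex.I ≠ 0 := Complex.I_ne_zero
  field_simp

/-! ### Poisson's formula -/

/-- Cauchy's theorem on the rectangle [-T,T] × [0,T]. The three sides off the real axis have total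
length 4T and all their points have modulus at least T, so they contribute at most 4C/T. -/
lemma tendsto_intervalIntegral_of_bounded_decay {h : ℂ → ℂ} {C T₀ : ℝ}
    (hd : DifferentiableOn ℂ h {z | 0 ≤ z.im})
    (hb : ∀ T, T₀ ≤ T → ∀ z : ℂ, 0 ≤ z.im → T ≤ ‖z‖ → ‖h z‖ ≤ C / T ^ 2) :
    Tendsto (fun T : ℝ => ∫ s in (-T)..T, h s) atTop (𝓝 0) := by
  have hlim : Tendsto (fun T : ℝ => 4 * C / T) atTop (𝓝 0) :=
    tendsto_const_nhds.div_atTop tendsto_id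
  refine squeeze_zero_norm' ?_ hlim
  filter_upwards [eventually_ge_atTop T₀, eventually_gt_atTop 0] with T hT hT0
  have hrect := Complex.integral_boundary_rect_eq_zero_of_differentiableOn h
    (⟨-T, 0⟩ : ℂ) (⟨T, T⟩ : ℂ) (hd.mono (by
      intro z hz
      have := hz.2
      simp only [Set.mem_preimage, Set.uIcc_of_le hT0.le] at this
      exact this.1))
  simp only [Complex.ofReal_zero, zero_mul, add_zero] at hrect
  have b1 : ‖∫ s in (-T)..T, h (s + T * Complex.I)‖ ≤ C / T ^ 2 * |T - -T| := by
    refine intervalIntegral.norm_integral_le_of_norm_le_const fun s _ => ?_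
    refine hb T hT _ (by simpa using hT0.le) ?_
    calc T ≤ |((s : ℂ) + T * Complex.I).im| := by simp [le_abs_self]
      _ ≤ _ := Complex.abs_im_le_norm _
  have b2 : ‖∫ s in (0 : ℝ)..T, h ((T : ℂ) + s * Complex.I)‖ ≤ C / T ^ 2 * |T - 0| := by
    refine intervalIntegral.norm_integral_le_of_norm_le_const fun s hs => ?_
    rw [Set.uIoc_of_le hT0.le] at hs
    refine hb T hT _ (by simpa using hs.1.le) ?_
    calc T ≤ |((T : ℂ) + s * Complex.I).re| := by simp [le_abs_self]
      _ ≤ _ := Complex.abs_re_le_norm _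
  have b3 : ‖∫ s in (0 : ℝ)..T, h (((-T : ℝ) : ℂ) + s * Complex.I)‖ ≤ C / T ^ 2 * |T - 0| := by
    refine intervalIntegral.norm_integral_le_of_norm_le_const fun s hs => ?_
    rw [Set.uIoc_of_le hT0.le] at hs
    refine hb T hT _ (by simpa using hs.1.le) ?_
    calc T ≤ |(((-T : ℝ) : ℂ) + s * Complex.I).re| := by simp [le_abs_self]
      _ ≤ _ := Complex.abs_re_le_norm _
  have heq : ∫ s in (-T)..T, h s = (∫ s in (-T)..T, h (s + T * Complex.I))
      - Complex.I • (∫ s in (0 : ℝ)..T, h ((T : ℂ) + s * Complex.I))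
      + Complex.I • ∫ s in (0 : ℝ)..T, h (((-T : ℝ) : ℂ) + s * Complex.I) := by
    linear_combination (exp := 1) hrect
  rw [heq]
  refine (norm_add_le _ _).trans ((add_le_add (norm_sub_le _ _) le_rfl).trans ?_)
  rw [norm_smul, norm_smul, Complex.norm_I, one_mul, one_mul]
  refine (add_le_add (add_le_add b1 b2) b3).trans (le_of_eq ?_)
  rw [abs_of_pos (by linarith), abs_of_pos (by linarith)]
  field_simp
  ring

/-- Poisson's formula for a bounded holomorphic function on a neighbourhood of the closed upper
half-plane. -/
lemma poisson_formula_of_bounded {f : ℂ → ℂ} {a C : ℝ} (ha : 0 < a)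
    (hd : DifferentiableOn ℂ f {z | -a < z.im}) (hC : ∀ z : ℂ, -a < z.im → ‖f z‖ ≤ C)
    (x : ℝ) {y : ℝ} (hy : 0 < y) :
    f (x + Complex.I * y) = ∫ s : ℝ, (poissonHP y x s : ℂ) * f s := by
  set p : ℂ := x + Complex.I * y with hp
  have hpim : p.im = y := by simp [hp]
  have hpre : p.re = x := by simp [hp]
  have hopen : IsOpen {z : ℂ | -a < z.im} := isOpen_lt continuous_const Complex.continuous_im
  have hpmem : p ∈ {z : ℂ | -a < z.im} := by
    simp only [Set.mem_ofPred_eq, hpim]; linarith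
  have hconj : ∀ z : ℂ, 0 ≤ z.im → z - conj p ≠ 0 := fun z hz h => by
    have := congrArg Complex.im h
    simp [hpim] at this
    linarith
  -- `dslope` removes the pole of (f z - f p)/(z - p), and the remaining pole conj p lies below the
  -- real axis. On the real line h is, up to the factor y/π, the Poisson kernel times f - f p, so
  -- the vanishing of ∫ h is Poisson's formula.
  set h : ℂ → ℂ := fun z => dslope f p z / (z - conj p) with hh
  have hC0 : 0 ≤ C := (norm_nonneg _).trans (hC p hpmem)
  have hdd : DifferentiableOn ℂ h {z | 0 ≤ z.im} := by
    refine DifferentiableOn.div ?_ (by fun_prop) hconj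
    refine ((Complex.differentiableOn_dslope (hopen.mem_nhds hpmem)).2 hd).mono ?_
    intro z hz
    simp only [Set.mem_ofPred_eq] at hz ⊢
    linarith
  have hval : ∀ z : ℂ, 0 ≤ z.im → z ≠ p →
      h z = (f z - f p) / ((z - p) * (z - conj p)) := fun z hz hzp => by
    simp only [hh]
    rw [dslope_of_ne _ hzp, slope_def_field, div_div]
  have hreal : ∀ s : ℝ, h s = (((s - x) ^ 2 + y ^ 2)⁻¹ : ℝ) * (f s - f p) := fun s => by
    have hsp : (s : ℂ) ≠ p := fun e => by
      have := congrArg Complex.im e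
      rw [hpim] at this
      simp at this
      exact hy.ne this
    rw [hval s (by simp) hsp]
    have : ((s : ℂ) - p) * (s - conj p) = (((s - x) ^ 2 + y ^ 2 : ℝ) : ℂ) := by
      simp only [hp, map_add, map_mul, Complex.conj_I, Complex.conj_ofReal]
      push_cast
      linear_combination -(y : ℂ) ^ 2 * Complex.I_sq
    rw [this, div_eq_inv_mul, Complex.ofReal_inv]
  have hbound : ∀ T, 2 * ‖p‖ + 1 ≤ T → ∀ z : ℂ, 0 ≤ z.im → T ≤ ‖z‖ →
      ‖h z‖ ≤ (8 * C) / T ^ 2 := fun T hT z hz hzT => by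
    have hTpos : 0 < T := by linarith [norm_nonneg p]
    have h1 : T / 2 ≤ ‖z - p‖ := by linarith [norm_sub_norm_le z p]
    have h2 : T / 2 ≤ ‖z - conj p‖ := by
      have := norm_sub_norm_le z (conj p)
      rw [RCLike.norm_conj] at this
      linarith
    have hzp : z ≠ p := fun e => by
      rw [e, sub_self, norm_zero] at h1; linarith
    rw [hval z hz hzp, norm_div, norm_mul]
    have h3 : ‖f z - f p‖ ≤ 2 * C := by
      have := norm_sub_le (f z) (f p)
      linarith [hC z (by linarith), hC p hpmem]
    calc ‖f z - f p‖ / (‖z - p‖ * ‖z - conj p‖) ≤ (2 * C) / (T / 2 * (T / 2)) := by gcongr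
      _ = 8 * C / T ^ 2 := by field_simp; ring
  have hlim := tendsto_intervalIntegral_of_bounded_decay hdd hbound
  have hcont : Continuous fun s : ℝ => f s := by
    refine hd.continuousOn.comp_continuous Complex.continuous_ofReal fun s => ?_
    simp [ha]
  have hfb : ∀ s : ℝ, ‖f s‖ ≤ C := fun s => hC _ (by simp [ha])
  have hPint : Integrable fun s : ℝ => (poissonHP y x s : ℂ) * (f s - f p) := by
    refine integrable_poissonHP_mul hy x (hcont.sub continuous_const).aestronglyMeasurable
      (C := 2 * C) (Eventually.of_forall fun s => ?_)
    have := norm_sub_le (f s) (f p)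
    linarith [hfb s, hC p hpmem]
  have hfun : (fun s : ℝ => (poissonHP y x s : ℂ) * (f s - f p))
      = fun s : ℝ => ((Real.pi⁻¹ * y : ℝ) : ℂ) * h s := by
    ext s
    rw [hreal s, poissonHP, Complex.ofReal_mul, mul_assoc]
  have hpos : ((Real.pi⁻¹ * y : ℝ) : ℂ) ≠ 0 := by
    exact_mod_cast (mul_pos (inv_pos.2 Real.pi_pos) hy).ne'
  have hhint : Integrable fun s : ℝ => h s := by
    rw [hfun] at hPint
    exact (integrable_const_mul_iff (isUnit_iff_ne_zero.2 hpos) _).1 hPint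
  have hzero : ∫ s : ℝ, h s = 0 :=
    tendsto_nhds_unique
      (intervalIntegral_tendsto_integral hhint tendsto_neg_atTop_atBot tendsto_id) hlim
  have hP0 : ∫ s : ℝ, (poissonHP y x s : ℂ) * (f s - f p) = 0 := by
    rw [hfun, integral_const_mul, hzero, mul_zero]
  have hsplit : ∫ s : ℝ, (poissonHP y x s : ℂ) * (f s - f p)
      = (∫ s : ℝ, (poissonHP y x s : ℂ) * f s) - f p := by
    have hPc : Integrable fun s : ℝ => (poissonHP y x s : ℂ) * f p :=
      Integrable.mul_const (integrable_poissonHP hy x).ofReal _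
    simp only [mul_sub]
    rw [integral_sub (integrable_poissonHP_mul hy x hcont.aestronglyMeasurable
      (Eventually.of_forall hfb)) hPc,
      integral_mul_const, integral_complex_ofReal, integral_poissonHP hy x]
    simp
  rw [hsplit] at hP0
  exact (sub_eq_zero.1 hP0).symm

/-- Poisson's formula on the half-plane `δ < Im z`, for a function which is holomorphic on the upper
half-plane and bounded away from the real line. -/
lemma poisson_formula {f : ℂ → ℂ} (hd : DifferentiableOn ℂ f {z | 0 < z.im})
    (hb : ∀ δ : ℝ, 0 < δ → ∃ C, ∀ z : ℂ, δ ≤ z.im → ‖f z‖ ≤ C)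
    (x : ℝ) {y δ : ℝ} (hy : 0 < y) (hδ : 0 < δ) :
    f (x + Complex.I * ((y + δ : ℝ) : ℂ))
      = ∫ s : ℝ, (poissonHP y x s : ℂ) * f (s + Complex.I * δ) := by
  obtain ⟨C, hC⟩ := hb (δ / 2) (half_pos hδ)
  -- Translating by iδ leaves a margin: the shifted function is holomorphic and bounded down to Im z
  -- > -δ/2.
  have key := poisson_formula_of_bounded (f := fun z => f (z + Complex.I * δ)) (a := δ / 2) (C := C)
    (half_pos hδ) ?_ ?_ x hy
  · rw [← key]
    congr 1
    push_cast
    ring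
  · refine hd.comp (by fun_prop) fun z hz => ?_
    simp only [Set.mem_ofPred_eq, Complex.add_im, Complex.mul_im, Complex.I_re, Complex.I_im,
      Complex.ofReal_re, Complex.ofReal_im] at hz ⊢
    linarith
  · intro z hz
    refine hC _ ?_
    simp only [Complex.add_im, Complex.mul_im, Complex.I_re, Complex.I_im,
      Complex.ofReal_re, Complex.ofReal_im]
    linarith

/-! ### Boundary values of bounded holomorphic functions -/

/-- The least admissible j works: if j > 0, minimality gives |t| > 2^(j-1), and this lost power of
two accounts for the factor 4. -/
lemma exists_dyadic_bound (t : ℝ) :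
    ∃ j : ℕ, |t| ≤ 2 ^ j ∧ (t ^ 2 + 1)⁻¹ ≤ 4 * (1 / 4 : ℝ) ^ j := by
  have hex : ∃ j : ℕ, |t| ≤ 2 ^ j :=
    (pow_unbounded_of_one_lt |t| one_lt_two).imp fun _ => le_of_lt
  refine ⟨Nat.find hex, Nat.find_spec hex, ?_⟩
  rcases h : Nat.find hex with _ | j
  · have : (t ^ 2 + 1)⁻¹ ≤ 1 := inv_le_one_of_one_le₀ (by nlinarith [sq_nonneg t])
    simpa using this.trans (by norm_num)
  · have hj : ¬ |t| ≤ 2 ^ j := Nat.find_min hex (by omega)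
    push Not at hj
    have h4 : (4 : ℝ) ^ j ≤ t ^ 2 + 1 := by
      have : ((2 : ℝ) ^ j) ^ 2 ≤ |t| ^ 2 := by gcongr
      rw [sq_abs, ← pow_mul, mul_comm, pow_mul] at this
      norm_num at this
      linarith
    have : (t ^ 2 + 1)⁻¹ ≤ ((4 : ℝ) ^ j)⁻¹ := by gcongr
    refine this.trans (le_of_eq ?_)
    rw [pow_succ, one_div, inv_pow]
    ring

/-- The kernel is dominated by a sum over dyadic balls: a point can be assigned a ball of radius 2^j
y on which the kernel there is at most 4·4^(-j)/(πy). Multiplying by the length 2·2^j y of the ball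
gives the weight (8/π)2^(-j). Convergence of Poisson integrals is thereby reduced to convergence of
averages. -/
lemma integral_poissonHP_mul_le_tsum {f : ℝ → ℝ} (hf : Measurable f) (hf0 : ∀ s, 0 ≤ f s) {C : ℝ}
    (hfC : ∀ s, f s ≤ C) (x : ℝ) {y : ℝ} (hy : 0 < y) :
    ∫ s, poissonHP y x s * f s ≤
      ∑' j : ℕ, 8 / Real.pi * (1 / 2 : ℝ) ^ j * ⨍ s in Metric.closedBall x (2 ^ j * y), f s := by
  have hpi := Real.pi_pos
  have hfi : ∀ j : ℕ, IntegrableOn f (Metric.closedBall x (2 ^ j * y)) := fun j =>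
    Measure.integrableOn_of_bounded (M := C) measure_closedBall_lt_top.ne
      hf.aestronglyMeasurable (Eventually.of_forall fun s => by
        rw [Real.norm_of_nonneg (hf0 s)]; exact hfC s)
  have ha0 : ∀ j : ℕ, 0 ≤ ⨍ s in Metric.closedBall x (2 ^ j * y), f s := fun j => by
    rw [setAverage_eq]
    exact smul_nonneg (by positivity) (integral_nonneg fun s => hf0 s)
  have haC : ∀ j : ℕ, ⨍ s in Metric.closedBall x (2 ^ j * y), f s ≤ C := fun j => by
    have hpos : 0 < volume.real (Metric.closedBall x (2 ^ j * y)) := by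
      rw [Real.volume_real_closedBall (by positivity)]; positivity
    rw [setAverage_eq, smul_eq_mul, inv_mul_le_iff₀ hpos]
    calc ∫ s in Metric.closedBall x (2 ^ j * y), f s
        ≤ ∫ s in Metric.closedBall x (2 ^ j * y), C :=
          setIntegral_mono (hfi j) (integrableOn_const measure_closedBall_lt_top.ne) hfC
      _ = _ := by simp
  have hsum : Summable fun j : ℕ => 8 / Real.pi * (1 / 2 : ℝ) ^ j *
      ⨍ s in Metric.closedBall x (2 ^ j * y), f s := by
    refine Summable.of_nonneg_of_le (fun j => mul_nonneg (by positivity) (ha0 j)) (fun j => ?_)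
      ((summable_geometric_two.mul_left (8 / Real.pi)).mul_right C)
    exact mul_le_mul_of_nonneg_left (haC j) (by positivity)
  have hnn : ∀ s, 0 ≤ poissonHP y x s * f s := fun s =>
    mul_nonneg (poissonHP_pos hy x s).le (hf0 s)
  rw [integral_eq_lintegral_of_nonneg_ae (Eventually.of_forall hnn)
    ((continuous_poissonHP_right hy x).measurable.mul hf).aestronglyMeasurable]
  refine ENNReal.toReal_le_of_le_ofReal
    (tsum_nonneg fun j => mul_nonneg (by positivity) (ha0 j)) ?_
  rw [ENNReal.ofReal_tsum_of_nonneg (fun j => mul_nonneg (by positivity) (ha0 j)) hsum]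
  have hpt : ∀ s, ENNReal.ofReal (poissonHP y x s * f s) ≤
      ∑' j : ℕ, (Metric.closedBall x (2 ^ j * y)).indicator
        (fun s => ENNReal.ofReal (4 / (Real.pi * y) * (1 / 4 : ℝ) ^ j * f s)) s := by
    intro s
    obtain ⟨j, hj1, hj2⟩ := exists_dyadic_bound ((s - x) / y)
    refine le_trans ?_ (ENNReal.le_tsum j)
    have hmem : s ∈ Metric.closedBall x (2 ^ j * y) := by
      rw [Metric.mem_closedBall, Real.dist_eq]
      rwa [abs_div, abs_of_pos hy, div_le_iff₀ hy] at hj1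
    rw [Set.indicator_of_mem hmem]
    refine ENNReal.ofReal_le_ofReal (mul_le_mul_of_nonneg_right ?_ (hf0 s))
    have heq : poissonHP y x s = (Real.pi * y)⁻¹ * (((s - x) / y) ^ 2 + 1)⁻¹ := by
      unfold poissonHP
      have : ((s - x) / y) ^ 2 + 1 = ((s - x) ^ 2 + y ^ 2) / y ^ 2 := by field_simp
      rw [this]
      field_simp
    rw [heq]
    calc (Real.pi * y)⁻¹ * (((s - x) / y) ^ 2 + 1)⁻¹
        ≤ (Real.pi * y)⁻¹ * (4 * (1 / 4 : ℝ) ^ j) := by gcongr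
      _ = _ := by field_simp
  refine (lintegral_mono hpt).trans ?_
  rw [lintegral_tsum fun j => (Measurable.indicator (by fun_prop) measurableSet_closedBall).aemeasurable]
  refine ENNReal.tsum_le_tsum fun j => ?_
  rw [lintegral_indicator measurableSet_closedBall,
    ← ofReal_integral_eq_lintegral_ofReal ((hfi j).const_mul _)
      (Eventually.of_forall fun s => mul_nonneg (by positivity) (hf0 s)), integral_const_mul]
  refine ENNReal.ofReal_le_ofReal (le_of_eq ?_)
  rw [setAverage_eq, Real.volume_real_closedBall (by positivity), smul_eq_mul]
  have : (1 / 4 : ℝ) ^ j = (1 / 2 : ℝ) ^ j * ((2 : ℝ) ^ j)⁻¹ := by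
    rw [← inv_pow, ← mul_pow]; norm_num
  rw [this]
  field_simp
  ring

/-- Poisson integrals of bounded functions converge almost everywhere. -/
lemma ae_tendsto_integral_poissonHP {k : ℝ → ℂ} (hk : Measurable k) {C : ℝ}
    (hkC : ∀ s, ‖k s‖ ≤ C) :
    ∀ᵐ x, Tendsto (fun y : ℝ => ∫ s, (poissonHP y x s : ℂ) * k s) (𝓝[>] 0) (𝓝 (k x)) := by
  have hloc : LocallyIntegrable k volume :=
    (memLp_top_of_bound hk.aestronglyMeasurable C (Eventually.of_forall hkC)).locallyIntegrable
      le_top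
  -- Lebesgue points: the averages of ‖k s - k x‖ over shrinking balls centred at x tend to zero.
  filter_upwards [IsUnifLocDoublingMeasure.ae_tendsto_average_norm_sub volume hloc 1] with x hx
  have ha : ∀ j : ℕ, Tendsto (fun y : ℝ => ⨍ s in Metric.closedBall x (2 ^ j * y), ‖k s - k x‖)
      (𝓝[>] 0) (𝓝 0) := fun j => by
    have hlim : Tendsto (fun y : ℝ => 2 ^ j * y) (𝓝[>] 0) (𝓝[>] 0) := by
      refine tendsto_nhdsWithin_iff.2 ⟨?_, ?_⟩
      · have : Tendsto (fun y : ℝ => 2 ^ j * y) (𝓝 0) (𝓝 (2 ^ j * 0)) := tendsto_id.const_mul _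
        rw [mul_zero] at this
        exact this.mono_left nhdsWithin_le_nhds
      · filter_upwards [self_mem_nhdsWithin] with y (hy : 0 < y)
        exact mul_pos (by positivity) hy
    refine hx (fun _ => x) _ hlim ?_
    filter_upwards [self_mem_nhdsWithin] with y (hy : 0 < y)
    exact Metric.mem_closedBall_self (by positivity)
  have hfC : ∀ s, ‖k s - k x‖ ≤ 2 * C := fun s =>
    (norm_sub_le _ _).trans (by linarith [hkC s, hkC x])
  have hfm : Measurable fun s => ‖k s - k x‖ := (hk.sub_const _).norm
  have hbd : ∀ (j : ℕ) (y : ℝ), 0 < y →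
      ‖⨍ s in Metric.closedBall x (2 ^ j * y), ‖k s - k x‖‖ ≤ 2 * C := fun j y hy => by
    have hpos : 0 < volume.real (Metric.closedBall x (2 ^ j * y)) := by
      rw [Real.volume_real_closedBall (by positivity)]; positivity
    rw [setAverage_eq, norm_smul, norm_inv, Real.norm_of_nonneg hpos.le, inv_mul_le_iff₀ hpos,
      mul_comm _ (2 * C)]
    refine norm_setIntegral_le_of_norm_le_const measure_closedBall_lt_top fun s _ => ?_
    rw [norm_norm]
    exact hfC s
  -- Each dyadic average tends to zero and all are at most 2C, so the geometric weights dominate the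
  -- series uniformly in y.
  have hts : Tendsto (fun y : ℝ => ∑' j : ℕ, 8 / Real.pi * (1 / 2 : ℝ) ^ j *
      ⨍ s in Metric.closedBall x (2 ^ j * y), ‖k s - k x‖) (𝓝[>] 0) (𝓝 0) := by
    have hz : (∑' j : ℕ, 8 / Real.pi * (1 / 2 : ℝ) ^ j * 0) = 0 := by simp
    rw [show 𝓝 (0 : ℝ) = 𝓝 (∑' j : ℕ, 8 / Real.pi * (1 / 2 : ℝ) ^ j * 0) by rw [hz]]
    refine tendsto_tsum_of_dominated_convergence
      (bound := fun j : ℕ => 8 / Real.pi * (1 / 2 : ℝ) ^ j * (2 * C))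
      ((summable_geometric_two.mul_left _).mul_right _) (fun j => (ha j).const_mul _) ?_
    filter_upwards [self_mem_nhdsWithin] with y (hy : 0 < y) j
    rw [norm_mul, Real.norm_of_nonneg (by positivity : 0 ≤ 8 / Real.pi * (1 / 2 : ℝ) ^ j)]
    exact mul_le_mul_of_nonneg_left (hbd j y hy) (by positivity)
  rw [tendsto_iff_norm_sub_tendsto_zero]
  refine squeeze_zero' (Eventually.of_forall fun _ => norm_nonneg _) ?_ hts
  filter_upwards [self_mem_nhdsWithin] with y (hy : 0 < y)
  refine le_trans ?_ (integral_poissonHP_mul_le_tsum hfm (fun _ => norm_nonneg _) hfC x hy)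
  have hPc : Integrable fun s : ℝ => (poissonHP y x s : ℂ) * k x :=
    Integrable.mul_const (integrable_poissonHP hy x).ofReal _
  have hsplit : (∫ s, (poissonHP y x s : ℂ) * k s) - k x
      = ∫ s, (poissonHP y x s : ℂ) * (k s - k x) := by
    simp only [mul_sub]
    rw [integral_sub (integrable_poissonHP_mul hy x hk.aestronglyMeasurable
      (Eventually.of_forall hkC)) hPc,
      integral_mul_const, integral_complex_ofReal, integral_poissonHP hy x]
    simp
  rw [hsplit]
  refine (norm_integral_le_integral_norm _).trans (le_of_eq (integral_congr_ae ?_))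
  refine Eventually.of_forall fun s => ?_
  simp only [norm_mul, Complex.norm_real, Real.norm_of_nonneg (poissonHP_pos hy x s).le]

/-- A bounded family in a Hilbert space converges weakly along an ultrafilter. -/
lemma exists_weak_limit {E ι : Type*} [NormedAddCommGroup E] [InnerProductSpace ℂ E]
    [CompleteSpace E] (𝒰 : Ultrafilter ι) (u : ι → E) {C : ℝ} (hu : ∀ᶠ i in 𝒰, ‖u i‖ ≤ C) :
    ∃ u₀ : E, ∀ v, Tendsto (fun i => ⟪v, u i⟫_ℂ) 𝒰 (𝓝 ⟪v, u₀⟫_ℂ) := by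
  let F : ι → WeakDual ℂ E := fun i => StrongDual.toWeakDual (InnerProductSpace.toDual ℂ E (u i))
  -- Banach–Alaoglu gives a limiting functional and the Riesz representation turns it into a vector.
  -- Conjugation appears because `toDual` places the vector in the antilinear slot.
  have hc := WeakDual.isCompact_closedBall (𝕜 := ℂ) (0 : StrongDual ℂ E) C
  obtain ⟨L, -, hL⟩ := hc.ultrafilter_le_nhds (𝒰.map F) (by
    rw [Ultrafilter.coe_map, le_principal_iff, mem_map]
    filter_upwards [hu] with i hi
    simpa [F] using hi)
  refine ⟨(InnerProductSpace.toDual ℂ E).symm (WeakDual.toStrongDual L), fun v => ?_⟩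
  have h1 : Tendsto F 𝒰 (𝓝 L) := hL
  have h2 : Tendsto (fun i => F i v) 𝒰 (𝓝 (L v)) :=
    ((WeakDual.eval_continuous v).tendsto L).comp h1
  have h3 := (Complex.continuous_conj.tendsto _).comp h2
  have e1 : ∀ i, conj (F i v) = ⟪v, u i⟫_ℂ := fun i => by
    simp [F]
  have e2 : conj (L v) = ⟪v, (InnerProductSpace.toDual ℂ E).symm (WeakDual.toStrongDual L)⟫_ℂ := by
    rw [← inner_conj_symm, InnerProductSpace.toDual_symm_apply]
    rfl
  rw [← e2]
  exact h3.congr e1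

/-! ### Poisson representation of bounded holomorphic functions -/

/-- The finite measure with density `1 / (π (1 + s²))`. -/
def cauchyWeight : Measure ℝ := volume.withDensity fun s => ENNReal.ofReal (poissonHP 1 0 s)

instance : IsFiniteMeasure cauchyWeight :=
  isFiniteMeasure_withDensity_ofReal (integrable_poissonHP one_pos 0).2

lemma measurable_poissonHP {y : ℝ} (hy : 0 < y) (x : ℝ) : Measurable (poissonHP y x) :=
  (continuous_poissonHP_right hy x).measurable

lemma integral_cauchyWeight (f : ℝ → ℂ) :
    ∫ s, f s ∂cauchyWeight = ∫ s, (poissonHP 1 0 s : ℂ) * f s := by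
  rw [cauchyWeight, integral_withDensity_eq_integral_toReal_smul
    (measurable_poissonHP one_pos 0).ennreal_ofReal (by simp)]
  refine integral_congr_ae (Eventually.of_forall fun s => ?_)
  simp only [ENNReal.toReal_ofReal (poissonHP_pos one_pos 0 s).le, Complex.real_smul]

lemma volume_absolutelyContinuous_cauchyWeight : (volume : Measure ℝ) ≪ cauchyWeight := by
  refine withDensity_absolutelyContinuous'
    (measurable_poissonHP one_pos 0).ennreal_ofReal.aemeasurable (Eventually.of_forall fun s => ?_)
  simpa using poissonHP_pos one_pos 0 s

/-- The constant comes from s² ≤ 2(s-x)² + 2x². Boundedness of this ratio makes it a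
square-integrable test function for `cauchyWeight`, so that evaluating a Poisson integral at x + iy
is a weakly continuous functional. -/
lemma poissonHP_le_mul_poissonHP_one {y : ℝ} (hy : 0 < y) (x : ℝ) :
    ∃ M : ℝ, ∀ s, poissonHP y x s / poissonHP 1 0 s ≤ M := by
  refine ⟨y * (2 + (2 * x ^ 2 + 1) / y ^ 2), fun s => ?_⟩
  have hpi := Real.pi_pos
  have hpos : 0 < (s - x) ^ 2 + y ^ 2 := by positivity
  have hpos' : 0 < s ^ 2 + 1 := by positivity
  have heq : poissonHP y x s / poissonHP 1 0 s = y * ((s ^ 2 + 1) / ((s - x) ^ 2 + y ^ 2)) := by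
    simp only [poissonHP, sub_zero, one_pow, mul_one]
    field_simp
  rw [heq]
  refine mul_le_mul_of_nonneg_left ?_ hy.le
  rw [div_le_iff₀ hpos]
  have h1 : (2 * x ^ 2 + 1) ≤ (2 * x ^ 2 + 1) / y ^ 2 * ((s - x) ^ 2 + y ^ 2) := by
    rw [div_mul_eq_mul_div, le_div_iff₀ (by positivity)]
    nlinarith [sq_nonneg (s - x), sq_nonneg x]
  nlinarith [sq_nonneg (s - 2 * x)]

/-- A bounded holomorphic function on the upper half-plane is the Poisson integral of a bounded
function. -/
lemma exists_eq_integral_poissonHP {G : ℂ → ℂ} {C : ℝ} (hd : DifferentiableOn ℂ G {z | 0 < z.im})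
    (hC : ∀ z : ℂ, 0 < z.im → ‖G z‖ ≤ C) :
    ∃ k : ℝ → ℂ, Measurable k ∧ (∀ s, ‖k s‖ ≤ C) ∧ ∀ x y : ℝ, 0 < y →
      G (x + Complex.I * y) = ∫ s, (poissonHP y x s : ℂ) * k s := by
  have him : ∀ s δ : ℝ, ((s : ℂ) + Complex.I * δ).im = δ := fun s δ => by simp
  have hC0 : 0 ≤ C := (norm_nonneg _).trans (hC Complex.I (by simp))
  have hGc : ∀ δ : ℝ, 0 < δ → Continuous fun s : ℝ => G (s + Complex.I * δ) := fun δ hδ =>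
    hd.continuousOn.comp_continuous (by fun_prop) fun s => by
      simp only [Set.mem_ofPred_eq, him, hδ]
  have hmem : ∀ δ : ℝ, 0 < δ → MemLp (fun s : ℝ => G (s + Complex.I * δ)) 2 cauchyWeight :=
    fun δ hδ => MemLp.of_bound (hGc δ hδ).aestronglyMeasurable C
      (Eventually.of_forall fun s => hC _ (by rw [him]; exact hδ))
  let u : ℝ → Lp ℂ 2 cauchyWeight := fun δ => if h : 0 < δ then (hmem δ h).toLp else 0
  have hu : ∀ δ (h : 0 < δ), u δ = (hmem δ h).toLp := fun δ h => dif_pos h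
  have hinner : ∀ (v : ℝ → ℂ) (hv : MemLp v 2 cauchyWeight) (w : Lp ℂ 2 cauchyWeight),
      ⟪hv.toLp, w⟫_ℂ = ∫ s, w s * conj (v s) ∂cauchyWeight := fun v hv w => by
    rw [L2.inner_def]
    refine integral_congr_ae ?_
    filter_upwards [hv.coeFn_toLp] with s hs
    simp [hs]
  -- An ultrafilter avoids extracting a subsequence; any weak cluster point of the functions G(· +
  -- iδ) serves.
  let 𝒰 : Ultrafilter ℝ := Ultrafilter.of (𝓝[>] 0)
  have h𝒰 : (𝒰 : Filter ℝ) ≤ 𝓝[>] 0 := Ultrafilter.of_le _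
  have hpos : ∀ᶠ δ in (𝒰 : Filter ℝ), 0 < δ := h𝒰 self_mem_nhdsWithin
  obtain ⟨u₀, hu₀⟩ := exists_weak_limit 𝒰 u
    (C := cauchyWeight.real Set.univ ^ ((2 : ℝ≥0∞).toReal)⁻¹ * C) (by
      filter_upwards [hpos] with δ hδ
      rw [hu δ hδ]
      refine Lp.norm_le_of_ae_bound hC0 ?_
      filter_upwards [(hmem δ hδ).coeFn_toLp] with s hs
      rw [hs]
      exact hC _ (by rw [him]; exact hδ))
  have hum : Measurable (u₀ : ℝ → ℂ) := (Lp.stronglyMeasurable u₀).measurable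
  have hlim : ∀ (v : ℝ → ℂ), MemLp v 2 cauchyWeight →
      Tendsto (fun δ : ℝ => ∫ s, G (s + Complex.I * δ) * conj (v s) ∂cauchyWeight) 𝒰
        (𝓝 (∫ s, u₀ s * conj (v s) ∂cauchyWeight)) := fun v hv => by
    rw [← hinner v hv]
    refine (hu₀ hv.toLp).congr' ?_
    filter_upwards [hpos] with δ hδ
    rw [hinner, hu δ hδ]
    refine integral_congr_ae ?_
    filter_upwards [(hmem δ hδ).coeFn_toLp] with s hs
    rw [hs]
  have hbound : ∀ᵐ s ∂cauchyWeight, ‖u₀ s‖ ≤ C := by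
    set S : Set ℝ := {s | C < ‖u₀ s‖} with hS
    have hSm : MeasurableSet S := measurableSet_lt measurable_const hum.norm
    -- Testing against the phase of u₀ on S gives ∫_S ‖u₀‖ ≤ C·μ(S), where μ is `cauchyWeight`.
    -- Since ‖u₀‖ > C on S, the set S is null.
    set v : ℝ → ℂ := S.indicator fun s => u₀ s / ‖u₀ s‖ with hv
    have hvm : Measurable v :=
      (hum.div (Complex.measurable_ofReal.comp hum.norm)).indicator hSm
    have hvb : ∀ s, ‖v s‖ ≤ S.indicator 1 s := fun s => by
      by_cases hs : s ∈ S
      · have : 0 < ‖u₀ s‖ := lt_of_le_of_lt hC0 hs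
        simp [hv, hs, this.ne']
      · simp [hv, hs]
    have hvb1 : ∀ s, ‖v s‖ ≤ 1 := fun s => (hvb s).trans (by
      by_cases hs : s ∈ S <;> simp [hs])
    have hvl : MemLp v 2 cauchyWeight :=
      MemLp.of_bound hvm.aestronglyMeasurable 1 (Eventually.of_forall hvb1)
    have h1 : ‖∫ s, u₀ s * conj (v s) ∂cauchyWeight‖ ≤ C * cauchyWeight.real S := by
      refine le_of_tendsto (hlim v hvl).norm ?_
      filter_upwards [hpos] with δ hδ
      have : ∫ s, S.indicator (fun _ => C) s ∂cauchyWeight = C * cauchyWeight.real S := by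
        rw [integral_indicator_const _ hSm, smul_eq_mul, mul_comm]
      rw [← this]
      refine norm_integral_le_of_norm_le ((integrable_const C).indicator hSm)
        (Eventually.of_forall fun s => ?_)
      rw [norm_mul, RCLike.norm_conj]
      have hGb := hC (s + Complex.I * δ) (by rw [him]; exact hδ)
      calc ‖G (s + Complex.I * δ)‖ * ‖v s‖ ≤ C * S.indicator 1 s := by
            gcongr
            exact hvb s
        _ = _ := by by_cases hs : s ∈ S <;> simp [hs]
    have hui : Integrable (fun s => ‖u₀ s‖) cauchyWeight :=
      ((Lp.memLp u₀).integrable (by norm_num)).norm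
    have h2 : ∫ s, u₀ s * conj (v s) ∂cauchyWeight
        = ((∫ s, S.indicator (fun s => ‖u₀ s‖) s ∂cauchyWeight : ℝ) : ℂ) := by
      rw [← integral_complex_ofReal]
      refine integral_congr_ae (Eventually.of_forall fun s => ?_)
      by_cases hs : s ∈ S
      · have h0 : 0 < ‖u₀ s‖ := lt_of_le_of_lt hC0 hs
        have h0' : ((‖u₀ s‖ : ℝ) : ℂ) ≠ 0 := by exact_mod_cast h0.ne'
        simp only [hv, Set.indicator_of_mem hs, map_div₀, Complex.conj_ofReal]
        rw [mul_div_assoc', RCLike.mul_conj, sq]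
        field_simp
        rfl
      · simp [hv, hs]
    rw [h2, Complex.norm_real] at h1
    have h3 : ∫ s, S.indicator (fun s => ‖u₀ s‖ - C) s ∂cauchyWeight ≤ 0 := by
      have : (fun s => S.indicator (fun s => ‖u₀ s‖ - C) s)
          = fun s => S.indicator (fun s => ‖u₀ s‖) s - S.indicator (fun _ => C) s := by
        ext s
        by_cases hs : s ∈ S <;> simp [hs]
      rw [this, integral_sub (hui.indicator hSm) ((integrable_const C).indicator hSm),
        integral_indicator_const _ hSm, smul_eq_mul, mul_comm _ C]
      linarith [le_abs_self (∫ s, S.indicator (fun s => ‖u₀ s‖) s ∂cauchyWeight),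
        Real.norm_eq_abs (∫ s, S.indicator (fun s => ‖u₀ s‖) s ∂cauchyWeight)]
    have hnn : ∀ s, 0 ≤ S.indicator (fun s => ‖u₀ s‖ - C) s := fun s =>
      Set.indicator_nonneg (fun s (hs : C < ‖u₀ s‖) => by linarith) s
    have h4 := (integral_eq_zero_iff_of_nonneg (μ := cauchyWeight) hnn
      ((hui.sub (integrable_const C)).indicator hSm)).1 (le_antisymm h3 (integral_nonneg hnn))
    filter_upwards [h4] with s hs
    by_contra hlt
    push Not at hlt
    have hsS : s ∈ S := hlt
    rw [Set.indicator_of_mem hsS] at hs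
    simp only [Pi.zero_apply] at hs
    linarith
  -- Truncation turns the almost everywhere bound into one valid at every point.
  refine ⟨fun s => if ‖u₀ s‖ ≤ C then u₀ s else 0,
    Measurable.ite (measurableSet_le hum.norm measurable_const) hum measurable_const, fun s => ?_,
    fun x y hy => ?_⟩
  · by_cases h : ‖u₀ s‖ ≤ C <;> simp [h, hC0]
  obtain ⟨M, hM⟩ := poissonHP_le_mul_poissonHP_one hy x
  -- Pairing with this ratio in `cauchyWeight` is Poisson integration at x + iy. For G(· + iδ) it
  -- gives G(x + i(y+δ)), which tends to G(x + iy), while the weak limit gives the Poisson integral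
  -- of u₀.
  set v : ℝ → ℂ := fun s => ((poissonHP y x s / poissonHP 1 0 s : ℝ) : ℂ) with hv
  have hvm : Measurable v := Complex.measurable_ofReal.comp
    ((measurable_poissonHP hy x).div (measurable_poissonHP one_pos 0))
  have hvl : MemLp v 2 cauchyWeight :=
    MemLp.of_bound hvm.aestronglyMeasurable M (Eventually.of_forall fun s => by
      rw [hv, Complex.norm_real, Real.norm_of_nonneg
        (div_nonneg (poissonHP_pos hy x s).le (poissonHP_pos one_pos 0 s).le)]
      exact hM s)
  have hconv : ∀ f : ℝ → ℂ, ∫ s, f s * conj (v s) ∂cauchyWeight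
      = ∫ s, (poissonHP y x s : ℂ) * f s := fun f => by
    rw [integral_cauchyWeight]
    refine integral_congr_ae (Eventually.of_forall fun s => ?_)
    have h0 : (poissonHP 1 0 s : ℂ) ≠ 0 := by exact_mod_cast (poissonHP_pos one_pos 0 s).ne'
    simp only [hv, Complex.conj_ofReal]
    push_cast
    field_simp
  have hl := hlim v hvl
  rw [hconv] at hl
  have hr : Tendsto (fun δ : ℝ => ∫ s, G (s + Complex.I * δ) * conj (v s) ∂cauchyWeight) 𝒰
      (𝓝 (G (x + Complex.I * y))) := by
    have hcont : Tendsto (fun δ : ℝ => G (x + Complex.I * ((y + δ : ℝ) : ℂ))) (𝓝[>] 0)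
        (𝓝 (G (x + Complex.I * y))) := by
      have hmem : (x + Complex.I * y : ℂ) ∈ {z : ℂ | 0 < z.im} := by
        simp only [Set.mem_ofPred_eq, him, hy]
      have h1 : ContinuousAt G (x + Complex.I * y) := hd.continuousOn.continuousAt
        ((isOpen_lt continuous_const Complex.continuous_im).mem_nhds hmem)
      refine h1.tendsto.comp ?_
      have : Tendsto (fun δ : ℝ => (x : ℂ) + Complex.I * ((y + δ : ℝ) : ℂ)) (𝓝 0)
          (𝓝 ((x : ℂ) + Complex.I * ((y + 0 : ℝ) : ℂ))) :=
        (by fun_prop : Continuous fun δ : ℝ => (x : ℂ) + Complex.I * ((y + δ : ℝ) : ℂ)).tendsto 0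
      rw [add_zero] at this
      exact this.mono_left nhdsWithin_le_nhds
    refine (hcont.mono_left h𝒰).congr' ?_
    filter_upwards [hpos] with δ hδ
    rw [hconv, poisson_formula hd (fun δ hδ => ⟨C, fun z hz => hC z (hδ.trans_le hz)⟩) x hy hδ]
  rw [tendsto_nhds_unique hr hl]
  refine integral_congr_ae ?_
  filter_upwards [volume_absolutelyContinuous_cauchyWeight.ae_le hbound] with s hs
  simp [hs]

/-- Fatou's theorem: a bounded holomorphic function on the upper half-plane has vertical boundary
values almost everywhere. -/
theorem exists_boundary_value {G : ℂ → ℂ} {C : ℝ} (hd : DifferentiableOn ℂ G {z | 0 < z.im})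
    (hC : ∀ z : ℂ, 0 < z.im → ‖G z‖ ≤ C) :
    ∃ k : ℝ → ℂ, Measurable k ∧ (∀ s, ‖k s‖ ≤ C) ∧ ∀ᵐ x : ℝ,
      Tendsto (fun ε : ℝ => G (x + Complex.I * ε)) (𝓝[>] 0) (𝓝 (k x)) := by
  obtain ⟨k, hk, hkC, hrep⟩ := exists_eq_integral_poissonHP hd hC
  refine ⟨k, hk, hkC, ?_⟩
  filter_upwards [ae_tendsto_integral_poissonHP hk hkC] with x hx
  refine hx.congr' ?_
  filter_upwards [self_mem_nhdsWithin] with y (hy : 0 < y)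
  exact (hrep x y hy).symm

/-! ### A maximum principle for functions with positive real part -/

lemma re_cpow_half_pos {z : ℂ} (hz : 0 < z.re) : 0 < (z ^ ((2 : ℂ)⁻¹)).re := by
  have h0 : z ≠ 0 := fun h => by simp [h] at hz
  rw [Complex.cpow_def_of_ne_zero h0, Complex.exp_re]
  refine mul_pos (Real.exp_pos _) (Real.cos_pos_of_mem_Ioo ?_)
  have him : (Complex.log z * (2 : ℂ)⁻¹).im = z.arg / 2 := by
    have : (2 : ℂ)⁻¹ = ((2⁻¹ : ℝ) : ℂ) := by push_cast; rfl
    rw [this, Complex.im_mul_ofReal, Complex.log_im]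
    ring
  rw [him]
  constructor <;> linarith [Complex.neg_pi_lt_arg z, Complex.arg_le_pi z, Real.pi_pos,
    Complex.abs_arg_lt_pi_div_two_iff.2 (Or.inl hz), neg_abs_le z.arg, le_abs_self z.arg]

/-- The square root v lies in the sector |arg v| ≤ π/4, since Re(v²) = (Re v)² - (Im v)² is
positive; there the real part controls the modulus. -/
lemma norm_le_two_mul_re_cpow_half {z : ℂ} (hz : 0 < z.re) :
    ‖z ^ ((2 : ℂ)⁻¹)‖ ≤ 2 * (z ^ ((2 : ℂ)⁻¹)).re := by
  have h1 := re_cpow_half_pos hz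
  have h2 : (z ^ ((2 : ℂ)⁻¹)) ^ 2 = z := Complex.cpow_ofNat_inv_pow z 2
  set v := z ^ ((2 : ℂ)⁻¹)
  have h3 : v.re * v.re - v.im * v.im = z.re := by rw [← h2, sq, Complex.mul_re]
  have h4 : |v.im| ≤ v.re := abs_le_of_sq_le_sq (by nlinarith) h1.le
  have h5 := Complex.norm_le_abs_re_add_abs_im v
  rw [abs_of_pos h1] at h5
  linarith

/-- A holomorphic function with positive real part on the upper half-plane is bounded by the
essential supremum of its boundary values. -/
theorem norm_le_of_boundary_value {W : ℂ → ℂ} (hd : DifferentiableOn ℂ W {z | 0 < z.im})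
    (hre : ∀ z : ℂ, 0 < z.im → 0 < (W z).re) (hb : ∀ z : ℂ, 0 < z.im → ‖W z‖ ≤ 1 / z.im)
    {Wp : ℝ → ℂ}
    (hlim : ∀ᵐ x : ℝ, Tendsto (fun ε : ℝ => W (x + Complex.I * ε)) (𝓝[>] 0) (𝓝 (Wp x)))
    {M : ℝ} (hM : ∀ᵐ x, ‖Wp x‖ ≤ M) {z : ℂ} (hz : 0 < z.im) : ‖W z‖ ≤ M := by
  have hM0 : 0 ≤ M := by
    obtain ⟨x, hx⟩ := hM.exists
    exact (norm_nonneg _).trans hx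
  -- The modulus of v = W^{1/2} is controlled by Re v, and q = W^{1/4} satisfies ‖q‖² = ‖v‖. Poisson
  -- means of Re v are values of Re v, so ‖q‖² is bounded in mean along all horizontal lines. This
  -- uniform integrability lets Poisson's formula for q pass to the boundary without a singular
  -- part.
  set v : ℂ → ℂ := fun z => W z ^ ((2 : ℂ)⁻¹) with hv
  set q : ℂ → ℂ := fun z => v z ^ ((2 : ℂ)⁻¹) with hq
  have hvre : ∀ z : ℂ, 0 < z.im → 0 < (v z).re := fun z hz => re_cpow_half_pos (hre z hz)
  have hvd : DifferentiableOn ℂ v {z | 0 < z.im} :=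
    hd.cpow (differentiableOn_const _) fun z hz => Or.inl (hre z hz)
  have hqd : DifferentiableOn ℂ q {z | 0 < z.im} :=
    hvd.cpow (differentiableOn_const _) fun z hz => Or.inl (hvre z hz)
  have hv2 : ∀ z, ‖v z‖ ^ 2 = ‖W z‖ := fun z => by
    rw [← norm_pow]; exact congrArg _ (Complex.cpow_ofNat_inv_pow (W z) 2)
  have hq2 : ∀ z, ‖q z‖ ^ 2 = ‖v z‖ := fun z => by
    rw [← norm_pow]; exact congrArg _ (Complex.cpow_ofNat_inv_pow (v z) 2)
  have hqs : ∀ z, ‖q z‖ = √(√‖W z‖) := fun z => by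
    rw [← hv2, Real.sqrt_sq (norm_nonneg _), ← hq2, Real.sqrt_sq (norm_nonneg _)]
  have hvb : ∀ δ : ℝ, 0 < δ → ∀ z : ℂ, δ ≤ z.im → ‖v z‖ ≤ 1 + 1 / δ := fun δ hδ z hz => by
    have h1 : ‖v z‖ ^ 2 ≤ 1 / δ := by
      rw [hv2]
      exact (hb z (hδ.trans_le hz)).trans (by gcongr)
    have : 0 < 1 / δ := by positivity
    nlinarith [norm_nonneg (v z), sq_nonneg (‖v z‖ - 1)]
  have hqb : ∀ δ : ℝ, 0 < δ → ∀ z : ℂ, δ ≤ z.im → ‖q z‖ ≤ 2 + 1 / δ := fun δ hδ z hz => by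
    have h1 := hvb δ hδ z hz
    rw [← hq2] at h1
    have : 0 < 1 / δ := by positivity
    nlinarith [norm_nonneg (q z), sq_nonneg (‖q z‖ - 1)]
  have him : ∀ s δ : ℝ, ((s : ℂ) + Complex.I * δ).im = δ := fun s δ => by simp
  set x := z.re with hx
  set y := z.im with hy
  have hzxy : z = x + Complex.I * y := by
    rw [mul_comm]; exact (Complex.re_add_im z).symm
  have hcont : ∀ (f : ℂ → ℂ), DifferentiableOn ℂ f {z | 0 < z.im} → ∀ δ : ℝ, 0 < δ →
      Continuous fun s : ℝ => f (s + Complex.I * δ) := fun f hf δ hδ =>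
    hf.continuousOn.comp_continuous (by fun_prop) fun s => by
      simp only [Set.mem_ofPred_eq, him, hδ]
  have hPr : ∀ (f : ℝ → ℝ) (C : ℝ), Continuous f → (∀ s, ‖f s‖ ≤ C) →
      Integrable fun s => poissonHP y x s * f s := fun f C hf hC =>
    (integrable_poissonHP hz x).mul_bdd hf.aestronglyMeasurable (Eventually.of_forall hC)
  -- the square of `q` is bounded in mean
  have hmean : ∀ δ : ℝ, 0 < δ →
      ∫ s, poissonHP y x s * ‖q (s + Complex.I * δ)‖ ^ 2 ≤ 2 * (1 + 1 / y) := fun δ hδ => by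
    have hP := poisson_formula hvd (fun δ hδ => ⟨_, hvb δ hδ⟩) x hz hδ
    have hPre : (v (x + Complex.I * ((y + δ : ℝ) : ℂ))).re
        = ∫ s, poissonHP y x s * (v (s + Complex.I * δ)).re := by
      rw [hP]
      have := integral_re (integrable_poissonHP_mul hz x
        (hcont v hvd δ hδ).aestronglyMeasurable
        (Eventually.of_forall fun s => hvb δ hδ _ (him s δ).ge))
      simp only [RCLike.re_eq_complex_re, Complex.re_ofReal_mul] at this
      exact this.symm
    calc ∫ s, poissonHP y x s * ‖q (s + Complex.I * δ)‖ ^ 2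
        ≤ ∫ s, 2 * (poissonHP y x s * (v (s + Complex.I * δ)).re) := by
          refine integral_mono (hPr _ ((2 + 1 / δ) ^ 2)
            ((hcont q hqd δ hδ).norm.pow 2) fun s => ?_)
            ((hPr _ (1 + 1 / δ) (Complex.continuous_re.comp (hcont v hvd δ hδ))
              fun s => ?_).const_mul 2) fun s => ?_
          · rw [norm_pow, norm_norm]
            have := hqb δ hδ _ (him s δ).ge
            gcongr
          · exact (Complex.abs_re_le_norm _).trans (hvb δ hδ _ (him s δ).ge)
          · have h1 : ‖v (s + Complex.I * δ)‖ ≤ 2 * (v (s + Complex.I * δ)).re :=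
              norm_le_two_mul_re_cpow_half (hre _ (by rw [him]; exact hδ))
            have h2 := mul_le_mul_of_nonneg_left h1 (poissonHP_pos hz x s).le
            simp only [hq2]
            linarith
      _ = 2 * (v (x + Complex.I * ((y + δ : ℝ) : ℂ))).re := by rw [integral_const_mul, hPre]
      _ ≤ 2 * (1 + 1 / y) := by
          refine mul_le_mul_of_nonneg_left ?_ two_pos.le
          refine (Complex.re_le_norm _).trans (hvb y hz _ ?_)
          rw [him]
          linarith
  -- Truncation by t ≤ min(t,K) + t²/K: the first term passes to the boundary by dominated
  -- convergence and is at most M^{1/4} there, while the second is O(1/K) by the bound in mean.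
  have hmain : ∀ K : ℝ, 0 < K → ‖q z‖ ≤ √(√M) + 2 * (1 + 1 / y) / K := fun K hK => by
    have hstep : ∀ δ : ℝ, 0 < δ → ‖q (x + Complex.I * ((y + δ : ℝ) : ℂ))‖ ≤
        (∫ s, poissonHP y x s * min ‖q (s + Complex.I * δ)‖ K) + 2 * (1 + 1 / y) / K :=
      fun δ hδ => by
      rw [poisson_formula hqd (fun δ hδ => ⟨_, hqb δ hδ⟩) x hz hδ]
      have hi1 := hPr (fun s => min ‖q (s + Complex.I * δ)‖ K) K
        ((hcont q hqd δ hδ).norm.min continuous_const) fun s => by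
          rw [Real.norm_of_nonneg (le_min (norm_nonneg _) hK.le)]
          exact min_le_right _ _
      have hi2 := hPr (fun s => ‖q (s + Complex.I * δ)‖ ^ 2) ((2 + 1 / δ) ^ 2)
        ((hcont q hqd δ hδ).norm.pow 2) fun s => by
          rw [norm_pow, norm_norm]
          have := hqb δ hδ _ (him s δ).ge
          gcongr
      calc ‖∫ s, (poissonHP y x s : ℂ) * q (s + Complex.I * δ)‖
          ≤ ∫ s, (poissonHP y x s * min ‖q (s + Complex.I * δ)‖ K
              + K⁻¹ * (poissonHP y x s * ‖q (s + Complex.I * δ)‖ ^ 2)) := by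
            refine norm_integral_le_of_norm_le (hi1.add (hi2.const_mul _))
              (Eventually.of_forall fun s => ?_)
            rw [norm_mul, Complex.norm_real, Real.norm_of_nonneg (poissonHP_pos hz x s).le]
            have hp := poissonHP_pos hz x s
            set t := ‖q (s + Complex.I * δ)‖
            have ht : t ≤ min t K + K⁻¹ * t ^ 2 := by
              rcases le_total t K with h | h
              · rw [min_eq_left h]
                have : 0 ≤ K⁻¹ * t ^ 2 := by positivity
                linarith
              · rw [min_eq_right h]
                have : t ≤ K⁻¹ * t ^ 2 := by
                  rw [inv_mul_eq_div, le_div_iff₀ hK]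
                  nlinarith
                linarith
            calc poissonHP y x s * t ≤ poissonHP y x s * (min t K + K⁻¹ * t ^ 2) := by gcongr
              _ = _ := by ring
        _ ≤ _ := by
            rw [integral_add hi1 (hi2.const_mul _), integral_const_mul, div_eq_inv_mul]
            gcongr
            exact hmean δ hδ
    have hl1 : Tendsto (fun δ : ℝ => ‖q (x + Complex.I * ((y + δ : ℝ) : ℂ))‖) (𝓝[>] 0)
        (𝓝 ‖q z‖) := by
      have h1 : ContinuousAt q z := hqd.continuousOn.continuousAt
        ((isOpen_lt continuous_const Complex.continuous_im).mem_nhds hz)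
      refine (h1.tendsto.comp ?_).norm
      have : Tendsto (fun δ : ℝ => (x : ℂ) + Complex.I * ((y + δ : ℝ) : ℂ)) (𝓝 0)
          (𝓝 ((x : ℂ) + Complex.I * ((y + 0 : ℝ) : ℂ))) :=
        (by fun_prop : Continuous fun δ : ℝ => (x : ℂ) + Complex.I * ((y + δ : ℝ) : ℂ)).tendsto 0
      rw [add_zero, ← hzxy] at this
      exact this.mono_left nhdsWithin_le_nhds
    have hl2 : Tendsto (fun δ : ℝ => ∫ s, poissonHP y x s * min ‖q (s + Complex.I * δ)‖ K)
        (𝓝[>] 0) (𝓝 (∫ s, poissonHP y x s * min (√(√‖Wp s‖)) K)) := by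
      refine tendsto_integral_filter_of_dominated_convergence
        (fun s => poissonHP y x s * K) ?_ ?_ ((integrable_poissonHP hz x).mul_const K) ?_
      · filter_upwards [self_mem_nhdsWithin] with δ (hδ : 0 < δ)
        exact ((continuous_poissonHP_right hz x).mul
          ((hcont q hqd δ hδ).norm.min continuous_const)).aestronglyMeasurable
      · refine Eventually.of_forall fun δ => Eventually.of_forall fun s => ?_
        rw [Real.norm_of_nonneg (mul_nonneg (poissonHP_pos hz x s).le
          (le_min (norm_nonneg _) hK.le))]
        exact mul_le_mul_of_nonneg_left (min_le_right _ _) (poissonHP_pos hz x s).le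
      · filter_upwards [hlim] with s hs
        simp only [hqs]
        exact (((Real.continuous_sqrt.tendsto _).comp
          ((Real.continuous_sqrt.tendsto _).comp hs.norm)).min tendsto_const_nhds).const_mul _
    have hle : ∫ s, poissonHP y x s * min (√(√‖Wp s‖)) K ≤ √(√M) := by
      have : ∫ s, poissonHP y x s * √(√M) = √(√M) := by
        rw [integral_mul_const, integral_poissonHP hz, one_mul]
      rw [← this]
      refine integral_mono_of_nonneg (Eventually.of_forall fun s =>
        mul_nonneg (poissonHP_pos hz x s).le (le_min (Real.sqrt_nonneg _) hK.le))
        ((integrable_poissonHP hz x).mul_const _) ?_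
      filter_upwards [hM] with s hs
      refine mul_le_mul_of_nonneg_left ((min_le_left _ _).trans ?_) (poissonHP_pos hz x s).le
      exact Real.sqrt_le_sqrt (Real.sqrt_le_sqrt hs)
    have := le_of_tendsto_of_tendsto hl1 (hl2.add_const (2 * (1 + 1 / y) / K)) (by
      filter_upwards [self_mem_nhdsWithin] with δ (hδ : 0 < δ) using hstep δ hδ)
    linarith
  have hfin : ‖q z‖ ≤ √(√M) := by
    have hl : Tendsto (fun K : ℝ => √(√M) + 2 * (1 + 1 / y) / K) atTop (𝓝 (√(√M) + 0)) :=
      tendsto_const_nhds.add (tendsto_const_nhds.div_atTop tendsto_id)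
    rw [add_zero] at hl
    exact ge_of_tendsto hl ((eventually_gt_atTop 0).mono hmain)
  rw [hqs] at hfin
  exact (Real.sqrt_le_sqrt_iff hM0).1 ((Real.sqrt_le_sqrt_iff (Real.sqrt_nonneg _)).1 hfin)

/-! ### Stieltjes transforms of complex measures -/

/-- The Stieltjes transform `∫ k(ν) / (z - ν) dμ(ν)` of the complex measure `k μ`. -/
def stieltjes (μ : Measure ℝ) (k : ℝ → ℂ) (z : ℂ) : ℂ := ∫ ν : ℝ, (z - ν)⁻¹ * k ν ∂μ

lemma abs_im_le_norm_sub_ofReal (z : ℂ) (ν : ℝ) : |z.im| ≤ ‖z - ν‖ := by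
  simpa using Complex.abs_im_le_norm (z - ν)

lemma norm_inv_sub_ofReal_le {z : ℂ} (hz : z.im ≠ 0) (ν : ℝ) : ‖(z - ν)⁻¹‖ ≤ |z.im|⁻¹ := by
  rw [norm_inv]
  exact inv_anti₀ (abs_pos.2 hz) (abs_im_le_norm_sub_ofReal z ν)

lemma measurable_inv_sub_ofReal (z : ℂ) : Measurable fun ν : ℝ => (z - ν)⁻¹ := by fun_prop

lemma integrable_inv_sub_mul {μ : Measure ℝ} {k : ℝ → ℂ} (hk : Integrable k μ) {z : ℂ}
    (hz : z.im ≠ 0) : Integrable (fun ν : ℝ => (z - ν)⁻¹ * k ν) μ :=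
  hk.bdd_mul (measurable_inv_sub_ofReal z).aestronglyMeasurable
    (Eventually.of_forall (norm_inv_sub_ofReal_le hz))

lemma differentiableOn_stieltjes {μ : Measure ℝ} {k : ℝ → ℂ} (hk : Integrable k μ) :
    DifferentiableOn ℂ (stieltjes μ k) {z | 0 < z.im} := by
  intro z₀ hz₀
  rw [Set.mem_ofPred_eq] at hz₀
  have hs : {z : ℂ | z₀.im / 2 < z.im} ∈ 𝓝 z₀ :=
    (isOpen_lt continuous_const Complex.continuous_im).mem_nhds (by
      rw [Set.mem_ofPred_eq]; linarith)
  refine (hasDerivAt_integral_of_dominated_loc_of_deriv_le (F := fun z ν => (z - (ν : ℂ))⁻¹ * k ν)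
    (F' := fun z ν => -((z - (ν : ℂ)) ^ 2)⁻¹ * k ν)
    (bound := fun ν => ((z₀.im / 2) ^ 2)⁻¹ * ‖k ν‖) hs ?_
    (integrable_inv_sub_mul hk hz₀.ne') ?_ ?_ (hk.norm.const_mul _)
    ?_).2.differentiableAt.differentiableWithinAt
  · exact Eventually.of_forall fun z =>
      (measurable_inv_sub_ofReal z).aestronglyMeasurable.mul hk.aestronglyMeasurable
  · refine AEStronglyMeasurable.mul (Measurable.aestronglyMeasurable ?_) hk.aestronglyMeasurable
    fun_prop
  · refine Eventually.of_forall fun ν z hz => ?_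
    rw [Set.mem_ofPred_eq] at hz
    rw [norm_mul, norm_neg, norm_inv, norm_pow]
    have h1 : z₀.im / 2 ≤ ‖z - ν‖ :=
      hz.le.trans ((le_abs_self _).trans (abs_im_le_norm_sub_ofReal z ν))
    have h2 : 0 < z₀.im / 2 := by linarith
    gcongr
  · refine Eventually.of_forall fun ν z hz => ?_
    rw [Set.mem_ofPred_eq] at hz
    have hne : z - (ν : ℂ) ≠ 0 := fun h => by
      have := congrArg Complex.im h
      simp at this
      linarith
    have := (((hasDerivAt_id z).sub_const (ν : ℂ)).inv hne).mul_const (k ν)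
    convert! this using 1
    simp [neg_div]

/-- Reflection in the real axis; it lets results on the upper half-plane serve for boundary values
from below. -/
lemma stieltjes_conj (μ : Measure ℝ) (k : ℝ → ℂ) (z : ℂ) :
    conj (stieltjes μ k z) = stieltjes μ (fun ν => conj (k ν)) (conj z) := by
  rw [stieltjes, stieltjes, ← integral_conj]
  simp

lemma conj_add_I_mul (x ε : ℝ) : conj ((x : ℂ) + Complex.I * ε) = x - Complex.I * ε := by
  simp [sub_eq_add_neg]

lemma poissonHP_le {y : ℝ} (hy : 0 < y) (x s : ℝ) : poissonHP y x s ≤ (Real.pi * y)⁻¹ := by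
  unfold poissonHP
  have hpi := Real.pi_pos
  rw [mul_inv, mul_assoc]
  refine mul_le_mul_of_nonneg_left ?_ (by positivity)
  rw [← div_eq_mul_inv, div_le_iff₀ (by positivity)]
  have : y⁻¹ * ((s - x) ^ 2 + y ^ 2) = y⁻¹ * (s - x) ^ 2 + y := by field_simp
  rw [this]
  have : 0 ≤ y⁻¹ * (s - x) ^ 2 := by positivity
  linarith

/-- The Poisson integral of the complex measure `k μ` is the jump of its Stieltjes transform. -/
lemma stieltjes_jump {μ : Measure ℝ} {k : ℝ → ℂ} (hk : Integrable k μ) (x : ℝ) {ε : ℝ}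
    (hε : 0 < ε) :
    (2 * Real.pi * Complex.I)⁻¹ *
      (stieltjes μ k (x - Complex.I * ε) - stieltjes μ k (x + Complex.I * ε)) =
      ∫ ν, (poissonHP ε x ν : ℂ) * k ν ∂μ := by
  rw [stieltjes, stieltjes, ← integral_sub
    (integrable_inv_sub_mul hk (by simpa using hε.ne'))
    (integrable_inv_sub_mul hk (by simpa using hε.ne')), ← integral_const_mul]
  refine integral_congr_ae (Eventually.of_forall fun ν => ?_)
  simp only [poissonHP_eq_resolvent_jump hε]
  ring

/-- Rescaling by ε reduces to a fixed kernel and dominated convergence. Convergence at every point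
is needed, because the limit will be integrated against a measure not yet known to be absolutely
continuous. -/
lemma tendsto_integral_poissonHP_of_continuous {φ : ℝ → ℂ} (hφ : Continuous φ) {C : ℝ}
    (hC : ∀ s, ‖φ s‖ ≤ C) (x : ℝ) :
    Tendsto (fun ε : ℝ => ∫ s, (poissonHP ε x s : ℂ) * φ s) (𝓝[>] 0) (𝓝 (φ x)) := by
  have heq : ∀ ε : ℝ, 0 < ε → ∫ s, (poissonHP ε x s : ℂ) * φ s
      = ∫ s, (poissonHP 1 0 s : ℂ) * φ (x + ε * s) := fun ε hε => by
    have h1 := Measure.integral_comp_mul_left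
      (fun s => (poissonHP ε x (x + s) : ℂ) * φ (x + s)) ε
    rw [integral_add_left_eq_self (fun s => (poissonHP ε x s : ℂ) * φ s) x,
      abs_of_pos (inv_pos.2 hε)] at h1
    have h2 : ∫ s, (poissonHP ε x s : ℂ) * φ s
        = ε • ∫ s, (poissonHP ε x (x + ε * s) : ℂ) * φ (x + ε * s) := by
      rw [h1, smul_smul, mul_inv_cancel₀ hε.ne', one_smul]
    rw [h2, ← integral_smul]
    refine integral_congr_ae (Eventually.of_forall fun s => ?_)
    have h3 : poissonHP 1 0 s = ε * poissonHP ε x (x + ε * s) := by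
      unfold poissonHP
      have : (x + ε * s - x) ^ 2 + ε ^ 2 = ε ^ 2 * (s ^ 2 + 1) := by ring
      rw [this, sub_zero, one_pow, mul_one]
      field_simp
    simp only [h3, Complex.real_smul]
    push_cast
    ring
  have hlim : Tendsto (fun ε : ℝ => ∫ s, (poissonHP 1 0 s : ℂ) * φ (x + ε * s)) (𝓝[>] 0)
      (𝓝 (∫ s, (poissonHP 1 0 s : ℂ) * φ (x + 0 * s))) := by
    refine tendsto_integral_filter_of_dominated_convergence (fun s => poissonHP 1 0 s * C) ?_ ?_
      ((integrable_poissonHP one_pos 0).mul_const C) ?_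
    · refine Eventually.of_forall fun ε => Continuous.aestronglyMeasurable ?_
      exact (Complex.continuous_ofReal.comp (continuous_poissonHP_right one_pos 0)).mul
        (hφ.comp (by fun_prop))
    · refine Eventually.of_forall fun ε => Eventually.of_forall fun s => ?_
      rw [norm_mul, Complex.norm_real, Real.norm_of_nonneg (poissonHP_pos one_pos 0 s).le]
      exact mul_le_mul_of_nonneg_left (hC _) (poissonHP_pos one_pos 0 s).le
    · refine Eventually.of_forall fun s => Tendsto.const_mul _ ?_
      exact ((hφ.comp (by fun_prop : Continuous fun ε : ℝ => x + ε * s)).tendsto 0).mono_left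
        nhdsWithin_le_nhds
  have hval : ∫ s, (poissonHP 1 0 s : ℂ) * φ (x + 0 * s) = φ x := by
    simp only [zero_mul, add_zero]
    rw [integral_mul_const, integral_complex_ofReal, integral_poissonHP one_pos]
    simp
  rw [hval] at hlim
  refine hlim.congr' ?_
  filter_upwards [self_mem_nhdsWithin] with ε (hε : 0 < ε) using (heq ε hε).symm

/-- Tonelli, and the symmetry of the kernel, which therefore has mass one in either variable. The
bound is uniform in ε, as Fatou's lemma requires. -/
lemma lintegral_enorm_poisson_le {μ : Measure ℝ} [IsFiniteMeasure μ] {k : ℝ → ℂ}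
    (hk : Integrable k μ) {ε : ℝ} (hε : 0 < ε) :
    ∫⁻ x, ‖∫ ν, (poissonHP ε x ν : ℂ) * k ν ∂μ‖ₑ ≤ ∫⁻ ν, ‖k ν‖ₑ ∂μ := by
  have hPm : Measurable fun p : ℝ × ℝ => ENNReal.ofReal (poissonHP ε p.1 p.2) :=
    (continuous_poissonHP hε).measurable.ennreal_ofReal
  calc ∫⁻ x, ‖∫ ν, (poissonHP ε x ν : ℂ) * k ν ∂μ‖ₑ
      ≤ ∫⁻ x, ∫⁻ ν, ENNReal.ofReal (poissonHP ε x ν) * ‖k ν‖ₑ ∂μ := by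
        refine lintegral_mono fun x => (enorm_integral_le_lintegral_enorm _).trans_eq ?_
        refine lintegral_congr fun ν => ?_
        rw [enorm_mul]
        congr 1
        rw [← ofReal_norm, Complex.norm_real, Real.norm_of_nonneg (poissonHP_pos hε x ν).le]
    _ = ∫⁻ ν, (∫⁻ x, ENNReal.ofReal (poissonHP ε x ν) * ‖k ν‖ₑ) ∂μ := by
        refine lintegral_lintegral_swap ?_
        exact hPm.aemeasurable.mul hk.aestronglyMeasurable.comp_snd.enorm
    _ = ∫⁻ ν, ‖k ν‖ₑ ∂μ := by
        refine lintegral_congr fun ν => ?_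
        have hm : Measurable fun x => ENNReal.ofReal (poissonHP ε x ν) := by
          simp only [poissonHP_comm ε _ ν]
          exact (measurable_poissonHP hε ν).ennreal_ofReal
        rw [lintegral_mul_const _ hm]
        have : ∫⁻ x, ENNReal.ofReal (poissonHP ε x ν) = 1 := by
          simp only [poissonHP_comm ε _ ν]
          rw [← ofReal_integral_eq_lintegral_ofReal (integrable_poissonHP hε ν)
            (Eventually.of_forall fun s => (poissonHP_pos hε ν s).le), integral_poissonHP hε]
          simp
        rw [this, one_mul]

/-- Fubini and the symmetry of the kernel move the smoothing from the measure onto the test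
function. -/
lemma integral_mul_poisson_swap {μ : Measure ℝ} [IsFiniteMeasure μ] {k : ℝ → ℂ}
    (hk : Integrable k μ) {φ : ℝ → ℂ} (hφ : Integrable φ) {ε : ℝ} (hε : 0 < ε) :
    ∫ x, φ x * ∫ ν, (poissonHP ε x ν : ℂ) * k ν ∂μ
      = ∫ ν, (∫ x, (poissonHP ε ν x : ℂ) * φ x) * k ν ∂μ := by
  have hint : Integrable (fun p : ℝ × ℝ => (poissonHP ε p.1 p.2 : ℂ) * (φ p.1 * k p.2))
      (volume.prod μ) := by
    refine (hφ.mul_prod hk).bdd_mul (c := (Real.pi * ε)⁻¹)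
      (Complex.continuous_ofReal.comp (continuous_poissonHP hε)).aestronglyMeasurable
      (Eventually.of_forall fun p => ?_)
    rw [Complex.norm_real, Real.norm_of_nonneg (poissonHP_pos hε _ _).le]
    exact poissonHP_le hε _ _
  calc ∫ x, φ x * ∫ ν, (poissonHP ε x ν : ℂ) * k ν ∂μ
      = ∫ x, ∫ ν, (poissonHP ε x ν : ℂ) * (φ x * k ν) ∂μ := by
        refine integral_congr_ae (Eventually.of_forall fun x => ?_)
        simp only
        rw [← integral_const_mul]
        refine integral_congr_ae (Eventually.of_forall fun ν => ?_)
        ring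
    _ = ∫ ν, (∫ x, (poissonHP ε x ν : ℂ) * (φ x * k ν)) ∂μ := integral_integral_swap hint
    _ = _ := by
        refine integral_congr_ae (Eventually.of_forall fun ν => ?_)
        simp only
        rw [← integral_mul_const]
        refine integral_congr_ae (Eventually.of_forall fun x => ?_)
        simp only [poissonHP_comm ε x ν]
        ring

/-- Two complex measures on the line which agree on test functions are equal. -/
lemma setIntegral_eq_of_forall_test {μ : Measure ℝ} [IsFiniteMeasure μ] {k ρ : ℝ → ℂ}
    (hk : Integrable k μ) (hρ : Integrable ρ)
    (h : ∀ φ : ℝ → ℝ, Continuous φ → HasCompactSupport φ →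
      ∫ ν, (φ ν : ℂ) * k ν ∂μ = ∫ ν, (φ ν : ℂ) * ρ ν)
    {S : Set ℝ} (hS : MeasurableSet S) : ∫ ν in S, k ν ∂μ = ∫ ν in S, ρ ν := by
  -- Both measures have densities with respect to their sum, so the claim becomes the vanishing of a
  -- single τ-integrable function tested against smooth ones.
  set τ : Measure ℝ := μ + volume with hτ
  have h1 : μ ≪ τ := (Measure.le_add_right le_rfl).absolutelyContinuous
  have h2 : (volume : Measure ℝ) ≪ τ := (Measure.le_add_left le_rfl).absolutelyContinuous
  have hk' := (integrable_rnDeriv_smul_iff (f := k) h1).2 hk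
  have hρ' := (integrable_rnDeriv_smul_iff (f := ρ) h2).2 hρ
  have hz := ae_eq_zero_of_integral_contDiff_smul_eq_zero
    (f := fun ν => (μ.rnDeriv τ ν).toReal • k ν - ((volume : Measure ℝ).rnDeriv τ ν).toReal • ρ ν)
    (μ := τ) (hk'.sub hρ').locallyIntegrable fun φ hφ hφc => by
      obtain ⟨B, hB⟩ := hφc.exists_bound_of_continuous hφ.continuous
      have i1 : Integrable (fun ν => φ ν • ((μ.rnDeriv τ ν).toReal • k ν)) τ :=
        hk'.bdd_smul B hφ.continuous.aestronglyMeasurable (Eventually.of_forall hB)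
      have i2 : Integrable (fun ν => φ ν • (((volume : Measure ℝ).rnDeriv τ ν).toReal • ρ ν)) τ :=
        hρ'.bdd_smul B hφ.continuous.aestronglyMeasurable (Eventually.of_forall hB)
      simp only [smul_sub]
      rw [integral_sub i1 i2]
      simp only [smul_comm (φ _) (ENNReal.toReal _)]
      rw [integral_rnDeriv_smul h1, integral_rnDeriv_smul h2, sub_eq_zero]
      simpa only [Complex.real_smul] using h φ hφ.continuous hφc
  rw [← setIntegral_rnDeriv_smul h1 hS, ← setIntegral_rnDeriv_smul h2 hS]
  refine integral_congr_ae (ae_restrict_of_ae ?_)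
  filter_upwards [hz] with ν hν using sub_eq_zero.1 hν

/-- A complex measure whose Stieltjes transform is bounded off the real axis is absolutely
continuous, and its density is the jump of the boundary values. -/
theorem stieltjes_boundary {μ : Measure ℝ} [IsFiniteMeasure μ] {k : ℝ → ℂ} (hk : Integrable k μ)
    {C : ℝ} (hC : ∀ x ε : ℝ, 0 < ε → ‖stieltjes μ k (x + Complex.I * ε)‖ ≤ C ∧
      ‖stieltjes μ k (x - Complex.I * ε)‖ ≤ C) :
    ∃ Gp Gm : ℝ → ℂ, Measurable Gp ∧ Measurable Gm ∧ (∀ x, ‖Gp x‖ ≤ C) ∧ (∀ x, ‖Gm x‖ ≤ C) ∧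
      (∀ᵐ x : ℝ, Tendsto (fun ε : ℝ => stieltjes μ k (x + Complex.I * ε)) (𝓝[>] 0) (𝓝 (Gp x))) ∧
      (∀ᵐ x : ℝ, Tendsto (fun ε : ℝ => stieltjes μ k (x - Complex.I * ε)) (𝓝[>] 0) (𝓝 (Gm x))) ∧
      Integrable (fun x => (2 * Real.pi * Complex.I)⁻¹ * (Gm x - Gp x)) ∧
      ∀ S, MeasurableSet S →
        ∫ ν in S, k ν ∂μ = ∫ x in S, (2 * Real.pi * Complex.I)⁻¹ * (Gm x - Gp x) := by
  have hzform : ∀ z : ℂ, z = (z.re : ℂ) + Complex.I * z.im := fun z => by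
    rw [mul_comm]; exact (Complex.re_add_im z).symm
  obtain ⟨Gp, hGpm, hGpC, hGp⟩ := exists_boundary_value (differentiableOn_stieltjes hk) (C := C)
    fun z hz => by
      rw [hzform z]
      exact (hC z.re z.im hz).1
  have hkc : Integrable (fun ν => conj (k ν)) μ :=
    (LinearIsometryEquiv.integrable_comp_iff Complex.conjLIE).2 hk
  have hconj : ∀ x ε : ℝ, conj (stieltjes μ (fun ν => conj (k ν)) (x + Complex.I * ε))
      = stieltjes μ k (x - Complex.I * ε) := fun x ε => by
    rw [stieltjes_conj, conj_add_I_mul]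
    simp
  obtain ⟨Gc, hGcm, hGcC, hGc⟩ := exists_boundary_value (differentiableOn_stieltjes hkc) (C := C)
    fun z hz => by
      rw [hzform z, ← RCLike.norm_conj, hconj]
      exact (hC z.re z.im hz).2
  have hGm : ∀ᵐ x : ℝ, Tendsto (fun ε : ℝ => stieltjes μ k (x - Complex.I * ε)) (𝓝[>] 0)
      (𝓝 (conj (Gc x))) := by
    filter_upwards [hGc] with x hx
    exact ((Complex.continuous_conj.tendsto _).comp hx).congr (hconj x)
  set ρ : ℝ → ℂ := fun x => (2 * Real.pi * Complex.I)⁻¹ * (conj (Gc x) - Gp x) with hρ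
  have hGcm' : Measurable fun x => conj (Gc x) := Complex.continuous_conj.measurable.comp hGcm
  have hρm : Measurable ρ := measurable_const.mul (hGcm'.sub hGpm)
  have hρlim : ∀ᵐ x : ℝ, Tendsto (fun ε : ℝ => ∫ ν, (poissonHP ε x ν : ℂ) * k ν ∂μ) (𝓝[>] 0)
      (𝓝 (ρ x)) := by
    filter_upwards [hGp, hGm] with x h1 h2
    refine ((h2.sub h1).const_mul (2 * Real.pi * Complex.I)⁻¹).congr' ?_
    filter_upwards [self_mem_nhdsWithin] with ε (hε : 0 < ε) using stieltjes_jump hk x hε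
  have hcontP : ∀ ε : ℝ, 0 < ε →
      AEStronglyMeasurable (fun x : ℝ => ∫ ν, (poissonHP ε x ν : ℂ) * k ν ∂μ) volume :=
    fun ε hε => by
    refine AEStronglyMeasurable.integral_prod_right' (μ := volume) (ν := μ)
      (f := fun p : ℝ × ℝ => (poissonHP ε p.1 p.2 : ℂ) * k p.2) ?_
    exact (Complex.continuous_ofReal.comp (continuous_poissonHP hε)).aestronglyMeasurable.mul
      hk.aestronglyMeasurable.comp_snd
  have hseq : Tendsto (fun n : ℕ => 1 / ((n : ℝ) + 1)) atTop (𝓝[>] 0) :=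
    tendsto_nhdsWithin_iff.2 ⟨tendsto_one_div_add_atTop_nhds_zero_nat,
      Eventually.of_forall fun n => by
        rw [Set.mem_Ioi]; positivity⟩
  -- Fatou's lemma along ε = 1/(n+1), with the L¹ bound on the Poisson integrals that is uniform in
  -- ε.
  have hρi : Integrable ρ := by
    refine ⟨hρm.aestronglyMeasurable, ?_⟩
    have h1 : ∫⁻ x, ‖ρ x‖ₑ ≤ liminf (fun n : ℕ =>
        ∫⁻ x, ‖∫ ν, (poissonHP (1 / ((n : ℝ) + 1)) x ν : ℂ) * k ν ∂μ‖ₑ) atTop := by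
      refine le_trans (le_of_eq (lintegral_congr_ae ?_)) (lintegral_liminf_le' fun n =>
        (hcontP _ (by positivity)).enorm)
      filter_upwards [hρlim] with x hx
      exact ((hx.comp hseq).enorm.liminf_eq).symm
    refine lt_of_le_of_lt (h1.trans (liminf_le_of_le (by isBoundedDefault) (a := ∫⁻ ν, ‖k ν‖ₑ ∂μ)
      fun b hb => ?_)) hk.2
    obtain ⟨n, hn⟩ := hb.exists
    exact hn.trans (lintegral_enorm_poisson_le hk (by positivity))
  refine ⟨Gp, fun x => conj (Gc x), hGpm, hGcm', hGpC, fun x => by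
    rw [RCLike.norm_conj]; exact hGcC x, hGp, hGm, hρi, fun S hS => ?_⟩
  refine setIntegral_eq_of_forall_test hk hρi (fun φ hφ hφc => ?_) hS
  obtain ⟨B, hB⟩ := hφc.exists_bound_of_continuous hφ
  have hφi : Integrable fun x => (φ x : ℂ) := (hφ.integrable_of_hasCompactSupport hφc).ofReal
  have hφB : ∀ x, ‖(φ x : ℂ)‖ ≤ B := fun x => by rw [Complex.norm_real]; exact hB x
  have hφcont : Continuous fun x => (φ x : ℂ) := Complex.continuous_ofReal.comp hφ
  have hPB : ∀ ε x : ℝ, 0 < ε → ‖∫ ν, (poissonHP ε x ν : ℂ) * k ν ∂μ‖ ≤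
      ‖(2 * Real.pi * Complex.I)⁻¹‖ * (C + C) := fun ε x hε => by
    rw [← stieltjes_jump hk x hε, norm_mul]
    refine mul_le_mul_of_nonneg_left ((norm_sub_le _ _).trans ?_) (norm_nonneg _)
    exact add_le_add (hC x ε hε).2 (hC x ε hε).1
  -- The same integrals are computed in the limit twice: here the bounded jump converges a.e. to ρ;
  -- in `hl2` the kernel is moved onto φ, where it acts as an approximate identity. Comparing the
  -- limits gives k μ = ρ dx on test functions.
  have hl1 : Tendsto (fun ε : ℝ => ∫ x, (φ x : ℂ) * ∫ ν, (poissonHP ε x ν : ℂ) * k ν ∂μ) (𝓝[>] 0)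
      (𝓝 (∫ x, (φ x : ℂ) * ρ x)) := by
    refine tendsto_integral_filter_of_dominated_convergence
      (fun x => ‖(φ x : ℂ)‖ * (‖(2 * Real.pi * Complex.I)⁻¹‖ * (C + C))) ?_ ?_
      (hφi.norm.mul_const _) ?_
    · filter_upwards [self_mem_nhdsWithin] with ε (hε : 0 < ε)
      exact hφcont.aestronglyMeasurable.mul (hcontP ε hε)
    · filter_upwards [self_mem_nhdsWithin] with ε (hε : 0 < ε)
      refine Eventually.of_forall fun x => ?_
      rw [norm_mul]
      exact mul_le_mul_of_nonneg_left (hPB ε x hε) (norm_nonneg _)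
    · filter_upwards [hρlim] with x hx using hx.const_mul _
  have hl2 : Tendsto (fun ε : ℝ => ∫ x, (φ x : ℂ) * ∫ ν, (poissonHP ε x ν : ℂ) * k ν ∂μ) (𝓝[>] 0)
      (𝓝 (∫ ν, (φ ν : ℂ) * k ν ∂μ)) := by
    have : Tendsto (fun ε : ℝ => ∫ ν, (∫ x, (poissonHP ε ν x : ℂ) * φ x) * k ν ∂μ) (𝓝[>] 0)
        (𝓝 (∫ ν, (φ ν : ℂ) * k ν ∂μ)) := by
      refine tendsto_integral_filter_of_dominated_convergence (fun ν => B * ‖k ν‖) ?_ ?_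
        (hk.norm.const_mul _) ?_
      · filter_upwards [self_mem_nhdsWithin] with ε (hε : 0 < ε)
        refine AEStronglyMeasurable.mul ?_ hk.aestronglyMeasurable
        refine AEStronglyMeasurable.integral_prod_right' (μ := μ) (ν := volume)
          (f := fun p : ℝ × ℝ => (poissonHP ε p.1 p.2 : ℂ) * φ p.2) ?_
        exact ((Complex.continuous_ofReal.comp (continuous_poissonHP hε)).mul
          (hφcont.comp continuous_snd)).aestronglyMeasurable
      · filter_upwards [self_mem_nhdsWithin] with ε (hε : 0 < ε)
        refine Eventually.of_forall fun ν => ?_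
        rw [norm_mul]
        refine mul_le_mul_of_nonneg_right ?_ (norm_nonneg _)
        have hone : ∫ s, poissonHP ε ν s * B = B := by
          rw [integral_mul_const, integral_poissonHP hε, one_mul]
        rw [← hone]
        refine norm_integral_le_of_norm_le ((integrable_poissonHP hε ν).mul_const B)
          (Eventually.of_forall fun s => ?_)
        rw [norm_mul, Complex.norm_real, Real.norm_of_nonneg (poissonHP_pos hε ν s).le]
        exact mul_le_mul_of_nonneg_left (hφB s) (poissonHP_pos hε ν s).le
      · exact Eventually.of_forall fun ν =>
          (tendsto_integral_poissonHP_of_continuous hφcont hφB ν).mul_const _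
    refine this.congr' ?_
    filter_upwards [self_mem_nhdsWithin] with ε (hε : 0 < ε)
    exact (integral_mul_poisson_swap hk hφi hε).symm
  exact tendsto_nhds_unique hl2 hl1

/-! ### Integration against complex measures with density -/

lemma norm_mul_toReal_inv_mul (w : ℂ) : (‖w‖ : ℂ) * (w / ‖w‖) = w := by
  by_cases h : w = 0
  · simp [h]
  · have : (‖w‖ : ℂ) ≠ 0 := by simpa using h
    field_simp

/-- The variation of k μ is ‖k‖ μ, and f‖k‖ is fk times the phase conj k/‖k‖. The convention 0/0 = 0
covers the zeros of k. -/
lemma integrable_withDensityᵥ {μ : Measure ℝ} {k f : ℝ → ℂ} (hk : Integrable k μ)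
    (hfk : Integrable (fun ν => f ν * k ν) μ) : (μ.withDensityᵥ k).Integrable f := by
  rw [VectorMeasure.Integrable, Measure.variation_withDensityᵥ hk,
    integrable_withDensity_iff_integrable_smul₀' hk.aestronglyMeasurable.enorm (by simp)]
  have hm : AEStronglyMeasurable (fun ν => conj (k ν) / ‖k ν‖) μ := by
    have h1 := hk.aestronglyMeasurable.aemeasurable
    exact ((Complex.continuous_conj.measurable.comp_aemeasurable h1).div
      (Complex.measurable_ofReal.comp_aemeasurable h1.norm)).aestronglyMeasurable
  refine (hfk.mul_bdd (c := 1) hm (Eventually.of_forall fun ν => ?_)).congr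
    (Eventually.of_forall fun ν => ?_)
  · rw [norm_div, RCLike.norm_conj, Complex.norm_real, norm_norm]
    exact div_self_le_one _
  · by_cases h : k ν = 0
    · simp [h]
    · have h0 : (‖k ν‖ : ℂ) ≠ 0 := by simpa using h
      have h1 : k ν * conj (k ν) = (‖k ν‖ : ℂ) ^ 2 := RCLike.mul_conj (k ν)
      simp only [toReal_enorm, Complex.real_smul]
      rw [mul_assoc, mul_div_assoc', h1, sq, mul_div_cancel_left₀ _ h0, mul_comm]

/-- Polar decomposition: k μ is a phase of modulus at most one times its variation. Both sides are
then continuous in f in L¹ of the variation, so indicators suffice. -/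
lemma integral_withDensityᵥ {μ : Measure ℝ} {k f : ℝ → ℂ} (hk : Integrable k μ)
    (hf : (μ.withDensityᵥ k).Integrable f) :
    (μ.withDensityᵥ k).integral f (ContinuousLinearMap.mul ℝ ℂ) = ∫ ν, f ν * k ν ∂μ := by
  have hvar := Measure.variation_withDensityᵥ hk
  set v := (μ.withDensityᵥ k).variation with hv
  have hkm := hk.aestronglyMeasurable.enorm
  have hσm : AEStronglyMeasurable (fun ν => k ν / ‖k ν‖) v := by
    have h1 := hk.aestronglyMeasurable.aemeasurable
    rw [hvar]
    exact ((h1.div (Complex.measurable_ofReal.comp_aemeasurable h1.norm)).aestronglyMeasurable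
      ).mono_ac (withDensity_absolutelyContinuous _ _)
  have hσb : ∀ ν, ‖k ν / ‖k ν‖‖ ≤ 1 := fun ν => by
    rw [norm_div, Complex.norm_real, norm_norm]; exact div_self_le_one _
  have hconv : ∀ f : ℝ → ℂ, ∫ ν, f ν * k ν ∂μ = ∫ ν, f ν * (k ν / ‖k ν‖) ∂v := fun f => by
    rw [hvar, integral_withDensity_eq_integral_toReal_smul₀ hkm (by simp)]
    refine integral_congr_ae (Eventually.of_forall fun ν => ?_)
    simp only [toReal_enorm, Complex.real_smul]
    rw [mul_left_comm, norm_mul_toReal_inv_mul]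
  have hint : ∀ f : ℝ → ℂ, Integrable f v → Integrable (fun ν => f ν * (k ν / ‖k ν‖)) v :=
    fun f hf => hf.mul_bdd hσm (Eventually.of_forall hσb)
  have hfin : IsFiniteMeasure v := ⟨by rw [hvar]; simpa using! hk.2⟩
  rw [hconv]
  have hf' : Integrable f v := hf
  refine Integrable.induction (μ := v)
    (fun f => (μ.withDensityᵥ k).integral f (ContinuousLinearMap.mul ℝ ℂ)
      = ∫ ν, f ν * (k ν / ‖k ν‖) ∂v) ?_ ?_ ?_ ?_ hf'
  · intro c S hS hSv
    rw [VectorMeasure.integral_eq_setToFun, setToFun_indicator_const _ hS hSv.ne, ← hconv]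
    change ContinuousLinearMap.mul ℝ ℂ c (μ.withDensityᵥ k S) = _
    rw [withDensityᵥ_apply hk hS, ContinuousLinearMap.mul_apply', ← integral_const_mul,
      ← integral_indicator hS]
    refine integral_congr_ae (Eventually.of_forall fun ν => ?_)
    by_cases h : ν ∈ S <;> simp [h]
  · intro f g _ hf hg h1 h2
    rw [VectorMeasure.integral_add hf hg, h1, h2, ← integral_add (hint f hf) (hint g hg)]
    refine integral_congr_ae (Eventually.of_forall fun ν => ?_)
    simp [add_mul]
  · refine isClosed_eq VectorMeasure.continuous_integral ?_
    refine LipschitzWith.continuous (K := 1) (LipschitzWith.of_dist_le_mul fun f g => ?_)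
    rw [NNReal.coe_one, one_mul, dist_eq_norm, dist_eq_norm, ← integral_sub
      (hint _ (L1.integrable_coeFn f)) (hint _ (L1.integrable_coeFn g)), L1.norm_eq_integral_norm]
    refine norm_integral_le_of_norm_le (L1.integrable_coeFn (f - g)).norm ?_
    filter_upwards [Lp.coeFn_sub f g] with ν hν
    rw [hν, Pi.sub_apply, ← sub_mul, norm_mul]
    exact mul_le_of_le_one_right (norm_nonneg _) (hσb ν)
  · intro f g hfg hf h
    rw [← VectorMeasure.integral_congr_ae hfg, h]
    refine integral_congr_ae ?_
    filter_upwards [hfg] with ν hν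
    rw [hν]

/-! ### Isometric extensions -/

section Isometry

variable {M E F : Type*} [AddCommGroup M] [Module ℂ M] [NormedAddCommGroup E] [NormedSpace ℂ E]
  [NormedAddCommGroup F] [NormedSpace ℂ F] [CompleteSpace F]

/-- Equality of norms lets b factor through a, and density extends the factor. It is applied to
simple functions, for a projection-valued measure, and to continuous functions, for a representation
of C(X). -/
lemma exists_linearIsometry_of_denseRange (a : M →ₗ[ℂ] E) (b : M →ₗ[ℂ] F) (ha : DenseRange a)
    (h : ∀ m, ‖b m‖ = ‖a m‖) : ∃ V : E →ₗᵢ[ℂ] F, ∀ m, V (a m) = b m := by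
  have hb : ∃ C : ℝ, ∀ m, ‖b m‖ ≤ C * ‖a m‖ := ⟨1, fun m => by rw [one_mul, h]⟩
  have heq := fun m => LinearMap.extendOfNorm_eq (f := b) (e := a) ha hb m
  refine ⟨⟨(b.extendOfNorm a).toLinearMap, fun x => ?_⟩, heq⟩
  refine ha.induction_on (p := fun x => ‖b.extendOfNorm a x‖ = ‖x‖) x
    (isClosed_eq (by fun_prop) (by fun_prop)) fun m => ?_
  rw [heq, h]

/-- The squared norm of a linear combination depends only on the Gram matrix. -/
lemma norm_linearCombination_eq {α E F : Type*} [NormedAddCommGroup E] [InnerProductSpace ℂ E]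
    [NormedAddCommGroup F] [InnerProductSpace ℂ F] (v : α → E) (w : α → F)
    (h : ∀ i j, ⟪v i, v j⟫_ℂ = ⟪w i, w j⟫_ℂ) (u : α →₀ ℂ) :
    ‖Finsupp.linearCombination ℂ v u‖ = ‖Finsupp.linearCombination ℂ w u‖ := by
  have hi : ⟪Finsupp.linearCombination ℂ v u, Finsupp.linearCombination ℂ v u⟫_ℂ
      = ⟪Finsupp.linearCombination ℂ w u, Finsupp.linearCombination ℂ w u⟫_ℂ := by
    simp only [Finsupp.linearCombination_apply, Finsupp.sum, sum_inner, inner_sum,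
      inner_smul_left, inner_smul_right, h]
  rw [inner_self_eq_norm_sq_to_K, inner_self_eq_norm_sq_to_K] at hi
  have hi' : ‖Finsupp.linearCombination ℂ v u‖ ^ 2 = ‖Finsupp.linearCombination ℂ w u‖ ^ 2 := by
    exact_mod_cast hi
  exact (sq_eq_sq₀ (norm_nonneg _) (norm_nonneg _)).1 hi'

end Isometry

/-! ### Calculus for projection-valued measures -/

section Calculus

variable {H : Type*} [NormedAddCommGroup H] [InnerProductSpace ℂ H] [CompleteSpace H] (E : PVM H)

lemma PVM.inner_proj_left (S : Set ℝ) (x y : H) : ⟪E.proj S x, y⟫_ℂ = ⟪x, E.proj S y⟫_ℂ := by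
  have hsa : ContinuousLinearMap.adjoint (E.proj S) = E.proj S :=
    (E.isStarProjection S).isSelfAdjoint
  conv_lhs => rw [← hsa]
  rw [ContinuousLinearMap.adjoint_inner_left]

lemma PVM.proj_proj {S T : Set ℝ} (hS : MeasurableSet S) (hT : MeasurableSet T) (x : H) :
    E.proj S (E.proj T x) = E.proj (S ∩ T) x := by
  rw [E.proj_inter S T hS hT]; rfl

lemma PVM.measure_apply (x : H) {S : Set ℝ} (hS : MeasurableSet S) :
    E.measure x S = ENNReal.ofReal (‖E.proj S x‖ ^ 2) :=
  Measure.ofMeasurable_apply S hS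

instance (x : H) : IsFiniteMeasure (E.measure x) :=
  ⟨by rw [E.measure_apply x MeasurableSet.univ]; exact ENNReal.ofReal_lt_top⟩

lemma PVM.measureReal_apply (x : H) {S : Set ℝ} (hS : MeasurableSet S) :
    (E.measure x).real S = ‖E.proj S x‖ ^ 2 := by
  rw [Measure.real, E.measure_apply x hS, ENNReal.toReal_ofReal (by positivity)]

lemma denseRange_linearCombination_indicator (μ : Measure ℝ) [IsFiniteMeasure μ] :
    DenseRange (Finsupp.linearCombination ℂ (fun S : {S : Set ℝ // MeasurableSet S} =>
      indicatorConstLp 2 S.2 (measure_ne_top μ S.1) (1 : ℂ))) := by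
  set a := Finsupp.linearCombination ℂ (fun S : {S : Set ℝ // MeasurableSet S} =>
      indicatorConstLp 2 S.2 (measure_ne_top μ S.1) (1 : ℂ))
  intro f
  have : f ∈ (LinearMap.range a).topologicalClosure := by
    refine Lp.induction (by norm_num) (fun f => f ∈ (LinearMap.range a).topologicalClosure)
      ?_ ?_ ?_ f
    · intro c S hS hμS
      refine Submodule.le_topologicalClosure _ ⟨Finsupp.single ⟨S, hS⟩ c, ?_⟩
      simp only [a, Finsupp.linearCombination_single]
      rw [Lp.simpleFunc.coe_indicatorConst]
      refine Lp.ext ?_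
      filter_upwards [Lp.coeFn_smul c (indicatorConstLp 2 hS (measure_ne_top μ S) (1 : ℂ)),
        indicatorConstLp_coeFn (p := 2) (hs := hS) (hμs := measure_ne_top μ S) (c := (1 : ℂ)),
        indicatorConstLp_coeFn (p := 2) (hs := hS) (hμs := measure_ne_top μ S) (c := c)]
        with ν h1 h2 h3
      rw [h1, Pi.smul_apply, h2, h3]
      by_cases h : ν ∈ S <;> simp [h]
    · intro f g hf hg _ h1 h2
      exact Submodule.add_mem _ h1 h2
    · exact Submodule.isClosed_topologicalClosure _
  rw [← SetLike.mem_coe, Submodule.topologicalClosure_coe, LinearMap.coe_range] at this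
  exact this

/-- The Gram matrices of the indicators and of the vectors E(S)y agree: ⟨E(S)y, E(T)y⟩ = ‖E(S ∩
T)y‖². -/
lemma PVM.exists_isom (y : H) : ∃ V : Lp ℂ 2 (E.measure y) →ₗᵢ[ℂ] H,
    ∀ (S : Set ℝ) (hS : MeasurableSet S),
      V (indicatorConstLp 2 hS (measure_ne_top _ S) (1 : ℂ)) = E.proj S y := by
  obtain ⟨V, hV⟩ := exists_linearIsometry_of_denseRange _
    (Finsupp.linearCombination ℂ fun S : {S : Set ℝ // MeasurableSet S} => E.proj S y)
    (denseRange_linearCombination_indicator (E.measure y))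
    (norm_linearCombination_eq _ _ fun S T => by
      rw [L2.inner_indicatorConstLp_one_indicatorConstLp_one S.2 T.2,
        E.measureReal_apply y (S.2.inter T.2), E.inner_proj_left, E.proj_proj S.2 T.2]
      exact E.inner_proj_self _ _)
  refine ⟨V, fun S hS => ?_⟩
  simpa using hV (Finsupp.single ⟨S, hS⟩ 1)

/-- The isometry `f ↦ (∫ f dE) y` of `L²(⟨y, E y⟩)` into the Hilbert space. -/
def PVM.isom (y : H) : Lp ℂ 2 (E.measure y) →ₗᵢ[ℂ] H := (E.exists_isom y).choose

lemma PVM.isom_indicator (y : H) {S : Set ℝ} (hS : MeasurableSet S) :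
    E.isom y (indicatorConstLp 2 hS (measure_ne_top _ S) (1 : ℂ)) = E.proj S y :=
  (E.exists_isom y).choose_spec S hS

/-- The density of `⟨x, E y⟩` with respect to `⟨y, E y⟩`. -/
def PVM.dens (x y : H) (ν : ℝ) : ℂ :=
  conj ((ContinuousLinearMap.adjoint (E.isom y).toContinuousLinearMap x : Lp ℂ 2 (E.measure y)) ν)

/-- The density comes from the adjoint of the isometry rather than from a Radon–Nikodym derivative,
so it is square integrable by construction and can be multiplied by any f in L² of the same measure.
-/
lemma PVM.memLp_dens (x y : H) : MemLp (E.dens x y) 2 (E.measure y) :=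
  (Lp.memLp (ContinuousLinearMap.adjoint (E.isom y).toContinuousLinearMap x)).star

lemma PVM.integrable_dens (x y : H) : Integrable (E.dens x y) (E.measure y) :=
  (E.memLp_dens x y).integrable (by norm_num)

lemma PVM.integrable_mul_dens (x y : H) {f : ℝ → ℂ} (hf : MemLp f 2 (E.measure y)) :
    Integrable (fun ν => f ν * E.dens x y ν) (E.measure y) :=
  hf.integrable_mul (E.memLp_dens x y)

lemma PVM.inner_isom (x y : H) {f : ℝ → ℂ} (hf : MemLp f 2 (E.measure y)) :
    ⟪x, E.isom y hf.toLp⟫_ℂ = ∫ ν, f ν * E.dens x y ν ∂E.measure y := by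
  have h := ContinuousLinearMap.adjoint_inner_left (E.isom y).toContinuousLinearMap hf.toLp x
  rw [LinearIsometry.coe_toContinuousLinearMap] at h
  rw [← h, L2.inner_def]
  refine integral_congr_ae ?_
  filter_upwards [hf.coeFn_toLp] with ν hν
  rw [hν]
  rfl

lemma PVM.inner_proj (x y : H) {S : Set ℝ} (hS : MeasurableSet S) :
    ⟪x, E.proj S y⟫_ℂ = ∫ ν in S, E.dens x y ν ∂E.measure y := by
  rw [← E.isom_indicator y hS, indicatorConstLp, E.inner_isom, ← integral_indicator hS]
  refine integral_congr_ae (Eventually.of_forall fun ν => ?_)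
  by_cases h : ν ∈ S <;> simp [h]

lemma PVM.complexMeasure_apply (x y : H) (S : Set ℝ) :
    E.complexMeasure x y S = ⟪x, E.proj S y⟫_ℂ := rfl

lemma PVM.complexMeasure_eq_withDensityᵥ_iff (x y : H) {μ : Measure ℝ} {k : ℝ → ℂ}
    (hk : Integrable k μ) : E.complexMeasure x y = μ.withDensityᵥ k ↔
      ∀ S, MeasurableSet S → ⟪x, E.proj S y⟫_ℂ = ∫ ν in S, k ν ∂μ := by
  constructor
  · intro h S hS
    rw [← withDensityᵥ_apply hk hS, ← h, E.complexMeasure_apply]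
  · intro h
    ext S hS
    rw [withDensityᵥ_apply hk hS, ← h S hS, E.complexMeasure_apply]

lemma PVM.complexMeasure_eq (x y : H) :
    E.complexMeasure x y = (E.measure y).withDensityᵥ (E.dens x y) :=
  (E.complexMeasure_eq_withDensityᵥ_iff x y (E.integrable_dens x y)).2
    fun _ hS => E.inner_proj x y hS

lemma PVM.form_eq (x y : H) {f : ℝ → ℂ} (hf : MemLp f 2 (E.measure y)) :
    E.form f x y = ∫ ν, f ν * E.dens x y ν ∂E.measure y := by
  rw [PVM.form, E.complexMeasure_eq x y]
  exact integral_withDensityᵥ (E.integrable_dens x y)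
    (integrable_withDensityᵥ (E.integrable_dens x y) (E.integrable_mul_dens x y hf))

/-- For square-integrable f the existence clause in `PVM.apply` always holds, with the isometry
supplying the vector; its inner products determine it. -/
lemma PVM.apply_eq_isom (y : H) {f : ℝ → ℂ} (hf : MemLp f 2 (E.measure y)) :
    E.apply f y = E.isom y hf.toLp := by
  have hex : ∃ v : H, ∀ x : H, ⟪x, v⟫_ℂ = E.form f x y :=
    ⟨E.isom y hf.toLp, fun x => by rw [E.inner_isom, E.form_eq x y hf]⟩
  rw [PVM.apply, dif_pos ⟨hf, hex⟩]
  refine ext_inner_left ℂ fun x => ?_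
  rw [Exists.choose_spec (p := fun v : H => ∀ x : H, ⟪x, v⟫_ℂ = E.form f x y) hex x,
    E.inner_isom, E.form_eq x y hf]

lemma PVM.dens_proj (x y : H) {S : Set ℝ} (hS : MeasurableSet S) :
    E.dens (E.proj S x) y =ᵐ[E.measure y] S.indicator (E.dens x y) := by
  refine Integrable.ae_eq_of_forall_setIntegral_eq _ _ (E.integrable_dens _ y)
    ((E.integrable_dens x y).indicator hS) fun T hT _ => ?_
  rw [← E.inner_proj _ y hT, E.inner_proj_left, E.proj_proj hS hT,
    E.inner_proj x y (hS.inter hT), setIntegral_indicator hS, Set.inter_comm]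

lemma PVM.inner_proj_isom (x w : H) {f : ℝ → ℂ} (hf : MemLp f 2 (E.measure w)) {S : Set ℝ}
    (hS : MeasurableSet S) :
    ⟪x, E.proj S (E.isom w hf.toLp)⟫_ℂ = ∫ ν in S, f ν * E.dens x w ν ∂E.measure w := by
  rw [← E.inner_proj_left, E.inner_isom, ← integral_indicator hS]
  refine integral_congr_ae ?_
  filter_upwards [E.dens_proj x w hS] with ν hν
  rw [hν]
  by_cases h : ν ∈ S <;> simp [h]

/-- If `⟨x, E y⟩` has the density `k` with respect to `μ`, then `⟨x, (∫ f dE) y⟩ = ∫ f k dμ`. -/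
lemma PVM.form_eq_of_complexMeasure_eq {x y : H} {μ : Measure ℝ} {k f : ℝ → ℂ}
    (hk : Integrable k μ) (h : E.complexMeasure x y = μ.withDensityᵥ k)
    (hfk : Integrable (fun ν => f ν * k ν) μ) : E.form f x y = ∫ ν, f ν * k ν ∂μ := by
  rw [PVM.form, h]
  exact integral_withDensityᵥ hk (integrable_withDensityᵥ hk hfk)

lemma PVM.isom_one (y : H) :
    E.isom y ((memLp_const (1 : ℂ) : MemLp (fun _ : ℝ => (1 : ℂ)) 2 (E.measure y)).toLp) = y := by
  have h := E.isom_indicator y MeasurableSet.univ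
  rw [E.proj_univ] at h
  convert! h using 2
  rw [indicatorConstLp]
  congr 1
  simp

lemma PVM.dens_self (y : H) : E.dens y y =ᵐ[E.measure y] fun _ => 1 := by
  refine Integrable.ae_eq_of_forall_setIntegral_eq _ _ (E.integrable_dens y y)
    (integrable_const _) fun S hS _ => ?_
  rw [← E.inner_proj y y hS, E.inner_proj_self, ← E.measureReal_apply y hS]
  simp

end Calculus

/-! ### Resolvents of self-adjoint operators -/

section SelfAdjoint

variable {H : Type*} [NormedAddCommGroup H] [InnerProductSpace ℂ H]

lemma isResolventAt_res {A : H →ₗ.[ℂ] H} {z : ℂ} (h : ∃ R, IsResolventAt A z R) :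
    IsResolventAt A z (res A z) := by
  rw [res, dif_pos h]
  exact h.choose_spec

/-- The resolvent identity. -/
lemma IsResolventAt.sub_eq {A : H →ₗ.[ℂ] H} {z w : ℂ} {R R' : H →L[ℂ] H} (h : IsResolventAt A z R)
    (h' : IsResolventAt A w R') : R - R' = (w - z) • (R' * R) := by
  ext x
  obtain ⟨hx, hx'⟩ := h.1 x
  have h1 := h'.2 ⟨R x, hx⟩
  have h2 : w • R x - A ⟨R x, hx⟩ = x + (w - z) • R x := by
    calc w • R x - A ⟨R x, hx⟩ = (z • R x - A ⟨R x, hx⟩) + (w - z) • R x := by module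
      _ = x + (w - z) • R x := by rw [hx']
  simp only [h2, map_add, map_smul] at h1
  change R x - R' x = (w - z) • R' (R x)
  rw [sub_eq_iff_eq_add', h1]

/-- The operator `z - A` on the domain of `A`. -/
def subMap (A : H →ₗ.[ℂ] H) (z : ℂ) : A.domain →ₗ[ℂ] H := z • A.domain.subtype - A.toFun

lemma subMap_apply (A : H →ₗ.[ℂ] H) (z : ℂ) (x : A.domain) : subMap A z x = z • (x : H) - A x := rfl

variable [CompleteSpace H]

/-- Self-adjointness in terms of inner products: a densely defined symmetric operator which is
maximal. -/
lemma isSelfAdjoint_iff {A : H →ₗ.[ℂ] H} : IsSelfAdjoint A ↔ Dense (A.domain : Set H) ∧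
    (∀ x y : A.domain, ⟪A x, (y : H)⟫_ℂ = ⟪(x : H), A y⟫_ℂ) ∧
    ∀ y w : H, (∀ x : A.domain, ⟪w, (x : H)⟫_ℂ = ⟪y, A x⟫_ℂ) → y ∈ A.domain := by
  constructor
  · intro hA
    have hd := hA.dense_domain
    have hadj : A.adjoint = A := LinearPMap.isSelfAdjoint_def.1 hA
    refine ⟨hd, ?_, ?_⟩
    · have := LinearPMap.adjoint_isFormalAdjoint hd
      rw [hadj] at this
      exact fun x y => this x y
    · intro y w h
      have := LinearPMap.mem_adjoint_domain_of_exists (T := A) y ⟨w, h⟩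
      rwa [hadj] at this
  · rintro ⟨hd, hs, hm⟩
    rw [LinearPMap.isSelfAdjoint_def]
    refine le_antisymm ?_ (LinearPMap.IsFormalAdjoint.le_adjoint hd fun x y => hs x y)
    have hfa := LinearPMap.adjoint_isFormalAdjoint hd
    refine ⟨fun y hy => hm y (A.adjoint ⟨y, hy⟩) fun x => hfa ⟨y, hy⟩ x, fun y y' hyy' => ?_⟩
    refine hd.eq_of_inner_left ℂ fun x hx => ?_
    rw [hfa y ⟨x, hx⟩, hs y' ⟨x, hx⟩, hyy']

lemma IsSelfAdjoint.inner_symm {A : H →ₗ.[ℂ] H} (hA : IsSelfAdjoint A) (x y : A.domain) :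
    ⟪A x, (y : H)⟫_ℂ = ⟪(x : H), A y⟫_ℂ := (isSelfAdjoint_iff.1 hA).2.1 x y

lemma IsSelfAdjoint.exists_apply_eq {A : H →ₗ.[ℂ] H} (hA : IsSelfAdjoint A) {y w : H}
    (h : ∀ x : A.domain, ⟪w, (x : H)⟫_ℂ = ⟪y, A x⟫_ℂ) : ∃ hy : y ∈ A.domain, A ⟨y, hy⟩ = w := by
  have hy := (isSelfAdjoint_iff.1 hA).2.2 y w h
  refine ⟨hy, hA.dense_domain.eq_of_inner_left ℂ fun x hx => ?_⟩
  rw [IsSelfAdjoint.inner_symm hA ⟨y, hy⟩ ⟨x, hx⟩, h ⟨x, hx⟩]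

/-- Since ⟨x,Ax⟩ is real, Im⟨x,(z-A)x⟩ = Im z·‖x‖², and Cauchy–Schwarz finishes. -/
lemma IsSelfAdjoint.norm_le {A : H →ₗ.[ℂ] H} (hA : IsSelfAdjoint A) (z : ℂ) (x : A.domain) :
    |z.im| * ‖(x : H)‖ ≤ ‖z • (x : H) - A x‖ := by
  have him : (⟪(x : H), A x⟫_ℂ).im = 0 := by
    have h1 : conj ⟪(x : H), A x⟫_ℂ = ⟪(x : H), A x⟫_ℂ := by
      rw [inner_conj_symm, IsSelfAdjoint.inner_symm hA]
    exact Complex.conj_eq_iff_im.1 h1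
  have h2 : (⟪(x : H), z • (x : H) - A x⟫_ℂ).im = z.im * ‖(x : H)‖ ^ 2 := by
    rw [inner_sub_right, inner_smul_right, inner_self_eq_norm_sq_to_K, Complex.sub_im, him, sub_zero]
    have : ((‖(x : H)‖ : ℂ)) ^ 2 = ((‖(x : H)‖ ^ 2 : ℝ) : ℂ) := by push_cast; rfl
    exact (congrArg (fun w : ℂ => (z * w).im) this).trans (Complex.im_mul_ofReal _ _)
  have h3 : |z.im| * ‖(x : H)‖ ^ 2 ≤ ‖(x : H)‖ * ‖z • (x : H) - A x‖ := by
    have h4 := (Complex.abs_im_le_norm _).trans (norm_inner_le_norm (𝕜 := ℂ) (x : H) (z • (x : H) - A x))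
    rw [h2, abs_mul, abs_of_nonneg (sq_nonneg ‖(x : H)‖)] at h4
    exact h4
  rcases (norm_nonneg (x : H)).eq_or_lt with h0 | h0
  · rw [← h0, mul_zero]; exact norm_nonneg _
  · refine le_of_mul_le_mul_left ?_ h0
    calc ‖(x : H)‖ * (|z.im| * ‖(x : H)‖) = |z.im| * ‖(x : H)‖ ^ 2 := by ring
      _ ≤ _ := h3

/-- The lower bound `IsSelfAdjoint.norm_le` makes preimages of Cauchy sequences Cauchy, and
maximality puts their limit in the domain, so the range is closed. A vector orthogonal to it
satisfies Aw = z̄w, which the same bound at z̄ rules out unless w = 0. -/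
lemma IsSelfAdjoint.range_subMap {A : H →ₗ.[ℂ] H} (hA : IsSelfAdjoint A) {z : ℂ} (hz : z.im ≠ 0) :
    LinearMap.range (subMap A z) = ⊤ := by
  have hz0 : 0 < |z.im| := abs_pos.2 hz
  have hclosed : IsClosed (LinearMap.range (subMap A z) : Set H) := by
    refine isClosed_of_closure_subset fun v hv => ?_
    obtain ⟨u, hu, huv⟩ := mem_closure_iff_seq_limit.1 hv
    choose x hx using hu
    have hcau : CauchySeq fun n => (x n : H) := by
      refine Metric.cauchySeq_iff'.2 fun ε hε => ?_
      obtain ⟨N, hN⟩ := Metric.cauchySeq_iff'.1 huv.cauchySeq (|z.im| * ε) (by positivity)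
      refine ⟨N, fun n hn => ?_⟩
      have h1 := IsSelfAdjoint.norm_le hA z (x n - x N)
      have h2 := hN n hn
      rw [← subMap_apply, map_sub, hx, hx, ← dist_eq_norm] at h1
      rw [dist_eq_norm]
      exact lt_of_mul_lt_mul_left (h1.trans_lt h2) hz0.le
    obtain ⟨y, hy⟩ := cauchySeq_tendsto_of_complete hcau
    have hAx : Tendsto (fun n => A (x n)) atTop (𝓝 (z • y - v)) := by
      refine ((hy.const_smul z).sub huv).congr fun n => ?_
      rw [← hx, subMap_apply, sub_sub_cancel]
    obtain ⟨hyd, hAy⟩ := IsSelfAdjoint.exists_apply_eq hA (y := y) (w := z • y - v) fun w => by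
      refine tendsto_nhds_unique (hAx.inner tendsto_const_nhds)
        ((hy.inner (tendsto_const_nhds (x := A w))).congr fun n => ?_)
      exact (IsSelfAdjoint.inner_symm hA (x n) w).symm
    exact ⟨⟨y, hyd⟩, by rw [subMap_apply, hAy, sub_sub_cancel]⟩
  have hcomplete : IsComplete (LinearMap.range (subMap A z) : Set H) := hclosed.isComplete
  have : CompleteSpace (LinearMap.range (subMap A z)) :=
    completeSpace_coe_iff_isComplete.2 hcomplete
  rw [← Submodule.orthogonal_eq_bot_iff, Submodule.eq_bot_iff]
  intro w hw
  obtain ⟨hwd, hAw⟩ := IsSelfAdjoint.exists_apply_eq hA (y := w) (w := conj z • w) fun x => by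
    have h1 := (Submodule.mem_orthogonal' _ _).1 hw _ ⟨x, rfl⟩
    rw [subMap_apply, inner_sub_right, inner_smul_right, sub_eq_zero] at h1
    rw [inner_smul_left, Complex.conj_conj, h1]
  have h2 := IsSelfAdjoint.norm_le hA (conj z) ⟨w, hwd⟩
  rw [hAw, sub_self, norm_zero, Complex.conj_im, abs_neg] at h2
  have h3 : ‖w‖ ≤ 0 := by
    by_contra h
    push Not at h
    exact absurd h2 (not_le.2 (mul_pos hz0 h))
  exact norm_le_zero_iff.1 h3

lemma IsSelfAdjoint.exists_isResolventAt {A : H →ₗ.[ℂ] H} (hA : IsSelfAdjoint A) {z : ℂ}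
    (hz : z.im ≠ 0) : ∃ R, IsResolventAt A z R := by
  have hz0 : 0 < |z.im| := abs_pos.2 hz
  have hinj : Function.Injective (subMap A z) := by
    rw [← LinearMap.ker_eq_bot, LinearMap.ker_eq_bot']
    intro x hx
    have h := IsSelfAdjoint.norm_le hA z x
    rw [← subMap_apply, hx, norm_zero] at h
    have h3 : ‖(x : H)‖ ≤ 0 := by
      by_contra h'
      push Not at h'
      exact absurd h (not_le.2 (mul_pos hz0 h'))
    exact Subtype.ext (norm_le_zero_iff.1 h3)
  let e := LinearEquiv.ofBijective (subMap A z)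
    ⟨hinj, LinearMap.range_eq_top.1 (IsSelfAdjoint.range_subMap hA hz)⟩
  have he : ∀ x, z • ((e.symm x : A.domain) : H) - A (e.symm x) = x := fun x => by
    rw [← subMap_apply]; exact e.apply_symm_apply x
  let R : H →L[ℂ] H := LinearMap.mkContinuous (A.domain.subtype.comp e.symm.toLinearMap)
    |z.im|⁻¹ fun x => by
      have h := IsSelfAdjoint.norm_le hA z (e.symm x)
      rw [he] at h
      rw [inv_mul_eq_div, le_div_iff₀ hz0, mul_comm]
      exact h
  refine ⟨R, fun x => ⟨(e.symm x).2, he x⟩, fun y => ?_⟩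
  change ((e.symm (subMap A z y) : A.domain) : H) = y
  rw [show subMap A z y = e y from rfl, e.symm_apply_apply]

lemma IsSelfAdjoint.isResolventAt_res {A : H →ₗ.[ℂ] H} (hA : IsSelfAdjoint A) {z : ℂ}
    (hz : z.im ≠ 0) : IsResolventAt A z (res A z) :=
  CoupledReservoirs.isResolventAt_res (IsSelfAdjoint.exists_isResolventAt hA hz)

lemma IsResolventAt.inner_left {A : H →ₗ.[ℂ] H} (hA : IsSelfAdjoint A) {z : ℂ} {R R' : H →L[ℂ] H}
    (h : IsResolventAt A z R) (h' : IsResolventAt A (conj z) R') (x y : H) :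
    ⟪R x, y⟫_ℂ = ⟪x, R' y⟫_ℂ := by
  obtain ⟨hx, hx'⟩ := h.1 x
  obtain ⟨hy, hy'⟩ := h'.1 y
  have hs := IsSelfAdjoint.inner_symm hA ⟨R x, hx⟩ ⟨R' y, hy⟩
  nth_rewrite 1 [← hy']
  nth_rewrite 2 [← hx']
  rw [inner_sub_right, inner_sub_left, inner_smul_left, inner_smul_right, hs]

/-- The resolvent set is open. -/
lemma isClosed_realSpectrum (A : H →ₗ.[ℂ] H) : IsClosed (realSpectrum A) := by
  rw [← isOpen_compl_iff, Metric.isOpen_iff]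
  intro x₀ hx₀
  simp only [realSpectrum, Set.mem_compl_iff, Set.mem_ofPred_eq, not_not] at hx₀
  obtain ⟨R, hR⟩ := hx₀
  -- This radius makes ‖(x - x₀)R‖ < 1, so 1 + (x - x₀)R is invertible by a Neumann series, and R(1
  -- + (x - x₀)R)⁻¹ is the resolvent at x.
  refine ⟨(‖R‖ + 1)⁻¹, by positivity, fun x hx => ?_⟩
  simp only [realSpectrum, Set.mem_compl_iff, Set.mem_ofPred_eq, not_not]
  rw [Metric.mem_ball, Real.dist_eq] at hx
  set c : ℂ := ((x - x₀ : ℝ) : ℂ) with hc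
  have hnorm : ‖-(c • R)‖ < 1 := by
    rw [norm_neg, norm_smul, hc, Complex.norm_real, Real.norm_eq_abs]
    have hpos : 0 < ‖R‖ + 1 := by positivity
    calc |x - x₀| * ‖R‖ ≤ (‖R‖ + 1)⁻¹ * ‖R‖ := by gcongr
      _ < (‖R‖ + 1)⁻¹ * (‖R‖ + 1) := by gcongr; linarith
      _ = 1 := inv_mul_cancel₀ hpos.ne'
  let u : (H →L[ℂ] H)ˣ := Units.oneSub (-(c • R)) hnorm
  have hu : (u : H →L[ℂ] H) = 1 + c • R := by simp [u]
  have hu1 : ∀ v, ((u⁻¹ : (H →L[ℂ] H)ˣ) : H →L[ℂ] H) v + c • R (((u⁻¹ : (H →L[ℂ] H)ˣ) : H →L[ℂ] H) v) = v := by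
    intro v
    have := congrArg (fun T : H →L[ℂ] H => T v) u.mul_inv
    rw [hu] at this
    simpa using this
  have hu2 : ∀ v, ((u⁻¹ : (H →L[ℂ] H)ˣ) : H →L[ℂ] H) (v + c • R v) = v := by
    intro v
    have := congrArg (fun T : H →L[ℂ] H => T v) u.inv_mul
    rw [hu] at this
    simpa using this
  have hcomm : ∀ v, R (((u⁻¹ : (H →L[ℂ] H)ˣ) : H →L[ℂ] H) v)
      = ((u⁻¹ : (H →L[ℂ] H)ˣ) : H →L[ℂ] H) (R v) := by
    intro v
    nth_rewrite 2 [← hu1 v]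
    rw [map_add, map_smul, hu2]
  have hxc : (x : ℂ) = x₀ + c := by rw [hc]; push_cast; ring
  refine ⟨R * ((u⁻¹ : (H →L[ℂ] H)ˣ) : H →L[ℂ] H), fun v => ?_, fun y => ?_⟩
  · obtain ⟨h1, h2⟩ := hR.1 (((u⁻¹ : (H →L[ℂ] H)ˣ) : H →L[ℂ] H) v)
    refine ⟨h1, ?_⟩
    change (x : ℂ) • R (((u⁻¹ : (H →L[ℂ] H)ˣ) : H →L[ℂ] H) v) - A ⟨_, h1⟩ = v
    rw [hxc, add_smul, add_sub_right_comm, h2, hu1]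
  · change R (((u⁻¹ : (H →L[ℂ] H)ˣ) : H →L[ℂ] H) ((x : ℂ) • (y : H) - A y)) = y
    rw [hcomm, hxc, add_smul, add_sub_right_comm, map_add, hR.2 y, map_smul, hu2]

end SelfAdjoint

/-! ### The spectral measures of a representation of `C(X)` -/

section Representation

open scoped CompactlySupported

variable {H : Type*} [NormedAddCommGroup H] [InnerProductSpace ℂ H] [CompleteSpace H]
  {X : Type*} [MetricSpace X] (π : C(X, ℂ) →⋆ₐ[ℂ] (H →L[ℂ] H))

/-- The complex-valued function underlying a real-valued one. -/
def ofRealMap (f : C(X, ℝ)) : C(X, ℂ) := ⟨fun t => (f t : ℂ), Complex.continuous_ofReal.comp f.2⟩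

lemma rep_inner (f g : C(X, ℂ)) (x y : H) : ⟪π f x, π g y⟫_ℂ = ⟪x, π (star f * g) y⟫_ℂ := by
  rw [map_mul, map_star]
  exact (ContinuousLinearMap.adjoint_inner_right (π f) x (π g y)).symm

variable [CompactSpace X] [MeasurableSpace X] [BorelSpace X]

/-- The positive functional `f ↦ ⟨x, π(f) x⟩`. -/
def repFunctional (x : H) : C_c(X, ℝ) →ₚ[ℝ] ℝ :=
  PositiveLinearMap.mk₀
    { toFun := fun f => (⟪x, π (ofRealMap f.toContinuousMap) x⟫_ℂ).re
      map_add' := fun f g => by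
        have : ofRealMap (f + g).toContinuousMap
            = ofRealMap f.toContinuousMap + ofRealMap g.toContinuousMap := by
          ext t; simp [ofRealMap]
        rw [this, map_add, add_apply, inner_add_right, Complex.add_re]
      map_smul' := fun c f => by
        have : ofRealMap (c • f).toContinuousMap = (c : ℂ) • ofRealMap f.toContinuousMap := by
          ext t; simp [ofRealMap]
        rw [this, map_smul, smul_apply, inner_smul_right]
        simp }
    (fun f hf => by
      have hf' : ∀ t, 0 ≤ f t := fun t => hf t
      -- Positivity: ⟨x, π(f)x⟩ = ‖π(√f)x‖².
      let r : C(X, ℝ) := ⟨fun t => √(f t), Real.continuous_sqrt.comp f.continuous⟩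
      have : ofRealMap f.toContinuousMap = star (ofRealMap r) * ofRealMap r := by
        ext t
        simp only [ofRealMap, ContinuousMap.coe_mk, ContinuousMap.mul_apply,
          ContinuousMap.star_apply, RCLike.star_def, Complex.conj_ofReal, r]
        rw [← Complex.ofReal_mul, Real.mul_self_sqrt (hf' t)]
        rfl
      change 0 ≤ (⟪x, π (ofRealMap f.toContinuousMap) x⟫_ℂ).re
      rw [this, ← rep_inner]
      exact inner_self_nonneg (𝕜 := ℂ))

/-- The measure representing `f ↦ ⟨x, π(f) x⟩`. -/
def repMeasure (x : H) : Measure X := RealRMK.rieszMeasure (repFunctional π x)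

instance (x : H) : (repMeasure π x).Regular := RealRMK.regular_rieszMeasure _

instance (x : H) : IsFiniteMeasure (repMeasure π x) :=
  ⟨isCompact_univ.measure_lt_top⟩

lemma integral_repMeasure (x : H) (f : C(X, ℝ)) :
    ∫ t, f t ∂repMeasure π x = (⟪x, π (ofRealMap f) x⟫_ℂ).re :=
  RealRMK.integral_rieszMeasure (repFunctional π x)
    ⟨f, HasCompactSupport.of_compactSpace f⟩

/-- Both squares equal ∫‖f‖², because ‖π(f)x‖² = ⟨x, π(f* f)x⟩. -/
lemma norm_toLp_repMeasure (x : H) (f : C(X, ℂ)) :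
    ‖π f x‖ = ‖ContinuousMap.toLp 2 (repMeasure π x) ℂ f‖ := by
  refine (sq_eq_sq₀ (norm_nonneg _) (norm_nonneg _)).1 ?_
  let n : C(X, ℝ) := ⟨fun t => ‖f t‖ ^ 2, by fun_prop⟩
  have hn : star f * f = ofRealMap n := by
    ext t
    simp only [ofRealMap, ContinuousMap.coe_mk, ContinuousMap.mul_apply, ContinuousMap.star_apply,
      RCLike.star_def, n]
    rw [mul_comm, RCLike.mul_conj]
    push_cast
    rfl
  have h1 : ‖π f x‖ ^ 2 = ∫ t, n t ∂repMeasure π x := by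
    rw [integral_repMeasure, ← hn, ← rep_inner]
    exact norm_sq_eq_re_inner (𝕜 := ℂ) _
  have h2 : ‖ContinuousMap.toLp 2 (repMeasure π x) ℂ f‖ ^ 2 = ∫ t, n t ∂repMeasure π x := by
    rw [norm_sq_eq_re_inner (𝕜 := ℂ), L2.inner_def, ← integral_re (L2.integrable_inner _ _)]
    refine integral_congr_ae ?_
    filter_upwards [ContinuousMap.coeFn_toLp (p := 2) (𝕜 := ℂ) (repMeasure π x) f] with t ht
    rw [ht]
    exact (norm_sq_eq_re_inner (𝕜 := ℂ) (f t)).symm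
  rw [h1, h2]

lemma exists_repIsom (x : H) : ∃ V : Lp ℂ 2 (repMeasure π x) →ₗᵢ[ℂ] H,
    ∀ f : C(X, ℂ), V (ContinuousMap.toLp 2 (repMeasure π x) ℂ f) = π f x := by
  let b : C(X, ℂ) →ₗ[ℂ] H :=
    { toFun := fun f => π f x
      map_add' := fun f g => by rw [map_add]; rfl
      map_smul' := fun c f => by rw [map_smul]; rfl }
  have hd : DenseRange ⇑(ContinuousMap.toLp 2 (repMeasure π x) ℂ :
      C(X, ℂ) →L[ℂ] Lp ℂ 2 (repMeasure π x)).toLinearMap :=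
    ContinuousMap.toLp_denseRange ℂ (repMeasure π x) ℂ (by norm_num)
  obtain ⟨V, hV⟩ := exists_linearIsometry_of_denseRange _ b hd (norm_toLp_repMeasure π x)
  exact ⟨V, hV⟩

/-- The isometric extension of `f ↦ π(f) x` to `L²`. -/
def repIsom (x : H) : Lp ℂ 2 (repMeasure π x) →ₗᵢ[ℂ] H := (exists_repIsom π x).choose

open Classical in
/-- The vector `π(F) x` for a square-integrable function `F`. -/
def repApply (x : H) (F : X → ℂ) : H :=
  if h : MemLp F 2 (repMeasure π x) then repIsom π x h.toLp else 0

lemma repApply_eq (x : H) {F : X → ℂ} (hF : MemLp F 2 (repMeasure π x)) :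
    repApply π x F = repIsom π x hF.toLp := dif_pos hF

lemma memLp_continuousMap (x : H) (f : C(X, ℂ)) : MemLp f 2 (repMeasure π x) :=
  MemLp.of_bound f.continuous.aestronglyMeasurable ‖f‖ (Eventually.of_forall f.norm_coe_le_norm)

lemma repApply_continuousMap (x : H) (f : C(X, ℂ)) : repApply π x f = π f x := by
  rw [repApply_eq π x (memLp_continuousMap π x f), ← (exists_repIsom π x).choose_spec f]
  rfl

lemma norm_repApply_sub (x : H) {F G : X → ℂ} (hF : MemLp F 2 (repMeasure π x))
    (hG : MemLp G 2 (repMeasure π x)) :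
    ‖repApply π x F - repApply π x G‖ = (eLpNorm (F - G) 2 (repMeasure π x)).toReal := by
  rw [repApply_eq π x hF, repApply_eq π x hG, ← map_sub, LinearIsometry.norm_map,
    ← MemLp.toLp_sub, Lp.norm_toLp]

lemma repApply_congr (x : H) {F G : X → ℂ} (h : F =ᵐ[repMeasure π x] G) :
    repApply π x F = repApply π x G := by
  by_cases hF : MemLp F 2 (repMeasure π x)
  · have hG : MemLp G 2 (repMeasure π x) := (memLp_congr_ae h).1 hF
    rw [repApply_eq π x hF, repApply_eq π x hG]
    congr 1
    exact (MemLp.toLp_eq_toLp_iff hF hG).2 h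
  · have hG : ¬ MemLp G 2 (repMeasure π x) := fun hG => hF ((memLp_congr_ae h).2 hG)
    rw [repApply, repApply, dif_neg hF, dif_neg hG]

lemma repApply_sub (x : H) {F G : X → ℂ} (hF : MemLp F 2 (repMeasure π x))
    (hG : MemLp G 2 (repMeasure π x)) :
    repApply π x (F - G) = repApply π x F - repApply π x G := by
  rw [repApply_eq π x hF, repApply_eq π x hG, repApply_eq π x (hF.sub hG), ← map_sub,
    MemLp.toLp_sub]

/-- Approximation in L² of the sum of the two measures. A common approximant is what allows
identities involving two vectors to pass from continuous to bounded measurable functions. -/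
lemma exists_continuousMap_approx (x y : H) {F : X → ℂ} (hF : Measurable F) {C : ℝ}
    (hC : ∀ t, ‖F t‖ ≤ C) {ε : ℝ} (hε : 0 < ε) : ∃ f : C(X, ℂ),
      eLpNorm (F - ⇑f) 2 (repMeasure π x) ≤ ENNReal.ofReal ε ∧
      eLpNorm (F - ⇑f) 2 (repMeasure π y) ≤ ENNReal.ofReal ε := by
  have hm : MemLp F 2 (repMeasure π x + repMeasure π y) :=
    MemLp.of_bound hF.aestronglyMeasurable C (Eventually.of_forall hC)
  obtain ⟨g, hg, -⟩ := hm.exists_boundedContinuous_eLpNorm_sub_le (by norm_num)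
    (ε := ENNReal.ofReal ε) (by simpa using hε)
  refine ⟨g.toContinuousMap, (eLpNorm_mono_measure _ ?_).trans hg,
    (eLpNorm_mono_measure _ ?_).trans hg⟩
  · exact Measure.le_add_right le_rfl
  · exact Measure.le_add_left le_rfl

lemma eq_zero_of_forall_norm_le {E : Type*} [NormedAddCommGroup E] {v : E} {B : ℝ}
    (h : ∀ ε : ℝ, 0 < ε → ‖v‖ ≤ ε * B) : v = 0 := by
  have hl : Tendsto (fun ε : ℝ => ε * B) (𝓝[>] 0) (𝓝 0) := by
    have : Tendsto (fun ε : ℝ => ε * B) (𝓝 0) (𝓝 (0 * B)) := tendsto_id.mul_const B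
    rw [zero_mul] at this
    exact this.mono_left nhdsWithin_le_nhds
  refine norm_le_zero_iff.1 (ge_of_tendsto hl ?_)
  filter_upwards [self_mem_nhdsWithin] with ε hε using h ε hε

lemma memLp_of_bounded (x : H) {F : X → ℂ} (hF : Measurable F) {C : ℝ} (hC : ∀ t, ‖F t‖ ≤ C) :
    MemLp F 2 (repMeasure π x) :=
  MemLp.of_bound hF.aestronglyMeasurable C (Eventually.of_forall hC)

/-- For bounded measurable `F`, the adjoint of `y ↦ π(F) y` is `x ↦ π(conj F) x`. -/
lemma inner_repApply (x y : H) {F : X → ℂ} (hF : Measurable F) {C : ℝ} (hC : ∀ t, ‖F t‖ ≤ C) :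
    ⟪x, repApply π y F⟫_ℂ = ⟪repApply π x (star F), y⟫_ℂ := by
  rw [← sub_eq_zero]
  refine eq_zero_of_forall_norm_le (B := ‖x‖ + ‖y‖) fun ε hε => ?_
  obtain ⟨f, hfx, hfy⟩ := exists_continuousMap_approx π x y hF hC hε
  have hF' : Measurable (star F) := Complex.continuous_conj.measurable.comp hF
  have hC' : ∀ t, ‖star F t‖ ≤ C := fun t => by
    rw [Pi.star_apply, norm_star]; exact hC t
  have h1 : ‖repApply π y F - π f y‖ ≤ ε := by
    rw [← repApply_continuousMap, norm_repApply_sub π y (memLp_of_bounded π y hF hC)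
      (memLp_continuousMap π y f)]
    exact ENNReal.toReal_le_of_le_ofReal hε.le hfy
  have h2 : ‖repApply π x (star F) - π (star f) x‖ ≤ ε := by
    rw [← repApply_continuousMap, norm_repApply_sub π x (memLp_of_bounded π x hF' hC')
      (memLp_continuousMap π x _)]
    refine ENNReal.toReal_le_of_le_ofReal hε.le (le_trans (le_of_eq ?_) hfx)
    refine eLpNorm_congr_norm_ae (Eventually.of_forall fun t => ?_)
    simp only [Pi.sub_apply, Pi.star_apply, ContinuousMap.star_apply]
    rw [← star_sub, norm_star]
  have h3 : ⟪x, π f y⟫_ℂ = ⟪π (star f) x, y⟫_ℂ := by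
    have := rep_inner π (star f) 1 x y
    simpa using this.symm
  calc ‖⟪x, repApply π y F⟫_ℂ - ⟪repApply π x (star F), y⟫_ℂ‖
      = ‖⟪x, repApply π y F - π f y⟫_ℂ - ⟪repApply π x (star F) - π (star f) x, y⟫_ℂ‖ := by
        rw [inner_sub_right, inner_sub_left, h3]; congr 1; ring
    _ ≤ ‖x‖ * ‖repApply π y F - π f y‖ + ‖repApply π x (star F) - π (star f) x‖ * ‖y‖ :=
        (norm_sub_le _ _).trans (add_le_add (norm_inner_le_norm _ _) (norm_inner_le_norm _ _))
    _ ≤ ‖x‖ * ε + ε * ‖y‖ := by gcongr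
    _ = ε * (‖x‖ + ‖y‖) := by ring

lemma rep_repApply (f : C(X, ℂ)) (y : H) {G : X → ℂ} (hG : Measurable G) {C : ℝ}
    (hC : ∀ t, ‖G t‖ ≤ C) : π f (repApply π y G) = repApply π y (fun t => f t * G t) := by
  rw [← sub_eq_zero]
  refine eq_zero_of_forall_norm_le (B := ‖π f‖ + ‖f‖) fun ε hε => ?_
  obtain ⟨g, hg, -⟩ := exists_continuousMap_approx π y y hG hC hε
  have hfG : Measurable fun t => f t * G t := f.continuous.measurable.mul hG
  have hfC : ∀ t, ‖f t * G t‖ ≤ ‖f‖ * C := fun t => by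
    rw [norm_mul]
    exact mul_le_mul (f.norm_coe_le_norm t) (hC t) (norm_nonneg _) (norm_nonneg _)
  have h1 : ‖repApply π y G - π g y‖ ≤ ε := by
    rw [← repApply_continuousMap, norm_repApply_sub π y (memLp_of_bounded π y hG hC)
      (memLp_continuousMap π y g)]
    exact ENNReal.toReal_le_of_le_ofReal hε.le hg
  have h2 : ‖repApply π y (fun t => f t * G t) - π (f * g) y‖ ≤ ‖f‖ * ε := by
    rw [← repApply_continuousMap, norm_repApply_sub π y (memLp_of_bounded π y hfG hfC)
      (memLp_continuousMap π y _)]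
    have h3 : eLpNorm ((fun t => f t * G t) - ⇑(f * g)) 2 (repMeasure π y)
        ≤ ENNReal.ofReal ‖f‖ * eLpNorm (G - ⇑g) 2 (repMeasure π y) := by
      refine eLpNorm_le_mul_eLpNorm_of_ae_le_mul (Eventually.of_forall fun t => ?_) 2
      simp only [Pi.sub_apply, ContinuousMap.mul_apply, ← mul_sub, norm_mul]
      exact mul_le_mul_of_nonneg_right (f.norm_coe_le_norm t) (norm_nonneg _)
    refine ENNReal.toReal_le_of_le_ofReal (by positivity) (h3.trans ?_)
    rw [ENNReal.ofReal_mul (norm_nonneg _)]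
    gcongr
  calc ‖π f (repApply π y G) - repApply π y (fun t => f t * G t)‖
      = ‖π f (repApply π y G - π g y) - (repApply π y (fun t => f t * G t) - π (f * g) y)‖ := by
        rw [map_sub, map_mul]
        congr 1
        simp only [mul_apply_eq_comp]
        abel
    _ ≤ ‖π f‖ * ‖repApply π y G - π g y‖ + ‖repApply π y (fun t => f t * G t) - π (f * g) y‖ :=
        (norm_sub_le _ _).trans (add_le_add ((π f).le_opNorm _) le_rfl)
    _ ≤ ‖π f‖ * ε + ‖f‖ * ε := by gcongr
    _ = ε * (‖π f‖ + ‖f‖) := by ring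

/-- F is approximated by one continuous f for both π(G)y and y, since the two sides measure the
error in different measures; for continuous f the identity is `rep_repApply`. -/
lemma repApply_repApply (y : H) {F G : X → ℂ} (hF : Measurable F) {C : ℝ} (hC : ∀ t, ‖F t‖ ≤ C)
    (hG : Measurable G) {D : ℝ} (hD : ∀ t, ‖G t‖ ≤ D) :
    repApply π (repApply π y G) F = repApply π y (fun t => F t * G t) := by
  rw [← sub_eq_zero]
  set y' := repApply π y G with hy'
  refine eq_zero_of_forall_norm_le (B := 1 + |D|) fun ε hε => ?_
  obtain ⟨f, hf', hf⟩ := exists_continuousMap_approx π y' y hF hC hε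
  have hFG : Measurable fun t => F t * G t := hF.mul hG
  have hbd : ∀ (P : X → ℂ) (B : ℝ), (∀ t, ‖P t‖ ≤ B) → ∀ t, ‖P t * G t‖ ≤ B * D :=
    fun P B hP t => by
    rw [norm_mul]
    exact mul_le_mul (hP t) (hD t) (norm_nonneg _) ((norm_nonneg _).trans (hP t))
  have h1 : ‖repApply π y' F - π f y'‖ ≤ ε := by
    rw [← repApply_continuousMap, norm_repApply_sub π y' (memLp_of_bounded π y' hF hC)
      (memLp_continuousMap π y' f)]
    exact ENNReal.toReal_le_of_le_ofReal hε.le hf'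
  have h2 : ‖repApply π y (fun t => F t * G t) - π f y'‖ ≤ |D| * ε := by
    have hfG : Measurable fun t => f t * G t := f.continuous.measurable.mul hG
    rw [hy', rep_repApply π f y hG hD, norm_repApply_sub π y
      (memLp_of_bounded π y hFG (hbd F C hC))
      (memLp_of_bounded π y hfG (hbd f ‖f‖ f.norm_coe_le_norm))]
    have h3 : eLpNorm ((fun t => F t * G t) - fun t => f t * G t) 2 (repMeasure π y)
        ≤ ENNReal.ofReal |D| * eLpNorm (F - ⇑f) 2 (repMeasure π y) := by
      refine eLpNorm_le_mul_eLpNorm_of_ae_le_mul (Eventually.of_forall fun t => ?_) 2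
      simp only [Pi.sub_apply, ← sub_mul, norm_mul]
      rw [mul_comm]
      exact mul_le_mul_of_nonneg_right ((hD t).trans (le_abs_self D)) (norm_nonneg _)
    refine ENNReal.toReal_le_of_le_ofReal (by positivity) (h3.trans ?_)
    rw [ENNReal.ofReal_mul (abs_nonneg _)]
    gcongr
  calc ‖repApply π y' F - repApply π y (fun t => F t * G t)‖
      = ‖(repApply π y' F - π f y') - (repApply π y (fun t => F t * G t) - π f y')‖ := by
        congr 1; abel
    _ ≤ ε + |D| * ε := (norm_sub_le _ _).trans (add_le_add h1 h2)
    _ = ε * (1 + |D|) := by ring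

end Representation

/-! ### The projection-valued measure of a representation of `C(X)` -/

section RepresentationPVM

variable {H : Type*} [NormedAddCommGroup H] [InnerProductSpace ℂ H] [CompleteSpace H]
  {X : Type*}

lemma norm_indicator_one_le (S : Set X) (t : X) : ‖S.indicator (fun _ => (1 : ℂ)) t‖ ≤ 1 := by
  by_cases h : t ∈ S <;> simp [h]

lemma measurable_indicator_one [MeasurableSpace X] {S : Set X} (hS : MeasurableSet S) :
    Measurable (S.indicator fun _ => (1 : ℂ)) := measurable_const.indicator hS

lemma star_indicator_one (S : Set X) :
    star (S.indicator fun _ => (1 : ℂ)) = S.indicator fun _ => (1 : ℂ) := by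
  ext t; by_cases h : t ∈ S <;> simp [h]

variable [MetricSpace X] (π : C(X, ℂ) →⋆ₐ[ℂ] (H →L[ℂ] H))
  [CompactSpace X] [MeasurableSpace X] [BorelSpace X]

lemma inner_repApply_indicator {S : Set X} (hS : MeasurableSet S) (x y : H) :
    ⟪x, repApply π y (S.indicator fun _ => 1)⟫_ℂ = ⟪repApply π x (S.indicator fun _ => 1), y⟫_ℂ := by
  rw [inner_repApply π x y (measurable_indicator_one hS) (norm_indicator_one_le S),
    star_indicator_one]

lemma repApply_indicator_inter {S T : Set X} (hS : MeasurableSet S) (hT : MeasurableSet T) (x : H) :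
    repApply π (repApply π x (T.indicator fun _ => 1)) (S.indicator fun _ => 1)
      = repApply π x ((S ∩ T).indicator fun _ => 1) := by
  rw [repApply_repApply π x (measurable_indicator_one hS) (norm_indicator_one_le S)
    (measurable_indicator_one hT) (norm_indicator_one_le T)]
  congr 1
  ext t
  by_cases h1 : t ∈ S <;> by_cases h2 : t ∈ T <;> simp [h1, h2]

lemma norm_repApply_indicator_le {S : Set X} (hS : MeasurableSet S) (x : H) :
    ‖repApply π x (S.indicator fun _ => 1)‖ ≤ ‖x‖ := by
  set y := repApply π x (S.indicator fun _ => 1) with hy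
  have h1 : ⟪y, y⟫_ℂ = ⟪x, y⟫_ℂ := by
    have h2 : repApply π y (S.indicator fun _ => 1) = y := by
      rw [hy, repApply_indicator_inter π hS hS, Set.inter_self]
    have h3 := inner_repApply_indicator π hS x y
    rw [h2, ← hy] at h3
    exact h3.symm
  have h3 : ‖y‖ * ‖y‖ ≤ ‖x‖ * ‖y‖ := by
    have h4 : ‖⟪y, y⟫_ℂ‖ = ‖y‖ * ‖y‖ := by
      rw [inner_self_eq_norm_sq_to_K]; simp [sq]
    rw [← h4, h1]
    exact norm_inner_le_norm _ _
  rcases eq_or_ne ‖y‖ 0 with h | h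
  · rw [h]; positivity
  · exact le_of_mul_le_mul_right h3 (lt_of_le_of_ne (norm_nonneg _) h.symm)

/-- The projection `π(1_S)`. -/
def repProj {S : Set X} (hS : MeasurableSet S) : H →L[ℂ] H :=
  LinearMap.mkContinuous
    { toFun := fun x => repApply π x (S.indicator fun _ => 1)
      -- `repApply` is built from a measure that depends on the vector, so linearity in that vector
      -- is not visible; moving the operator to the other side of the inner product makes it so.
      map_add' := fun x y => ext_inner_left ℂ fun v => by
        rw [inner_add_right]
        simp only [inner_repApply_indicator π hS, inner_add_right]
      map_smul' := fun c x => ext_inner_left ℂ fun v => by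
        rw [RingHom.id_apply, inner_smul_right]
        simp only [inner_repApply_indicator π hS, inner_smul_right] } 1
    (fun x => by rw [one_mul]; exact norm_repApply_indicator_le π hS x)

lemma repProj_apply {S : Set X} (hS : MeasurableSet S) (x : H) :
    repProj π hS x = repApply π x (S.indicator fun _ => 1) := rfl

lemma isStarProjection_repProj {S : Set X} (hS : MeasurableSet S) :
    IsStarProjection (repProj π hS) where
  isIdempotentElem := by
    ext x
    change repProj π hS (repProj π hS x) = _
    simp only [repProj_apply]
    rw [repApply_indicator_inter π hS hS, Set.inter_self]
  isSelfAdjoint := by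
    rw [ContinuousLinearMap.isSelfAdjoint_iff_isSymmetric]
    exact fun x y => (inner_repApply_indicator π hS x y).symm

lemma repProj_univ : repProj π MeasurableSet.univ = 1 := by
  ext x
  rw [repProj_apply]
  have h := repApply_continuousMap π x 1
  rw [map_one] at h
  rw [← h]
  congr 1
  ext t
  simp

lemma repProj_inter {S T : Set X} (hS : MeasurableSet S) (hT : MeasurableSet T) :
    repProj π (hS.inter hT) = repProj π hS * repProj π hT := by
  ext x
  exact (repApply_indicator_inter π hS hT x).symm

lemma repProj_diff {S T : Set X} (hS : MeasurableSet S) (hT : MeasurableSet T) (h : T ⊆ S) (x : H) :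
    repProj π (hS.diff hT) x = repProj π hS x - repProj π hT x := by
  simp only [repProj_apply]
  rw [← repApply_sub π x (memLp_of_bounded π x (measurable_indicator_one hS)
    (norm_indicator_one_le S)) (memLp_of_bounded π x (measurable_indicator_one hT)
    (norm_indicator_one_le T))]
  congr 1
  ext t
  by_cases h1 : t ∈ T
  · simp [h1, h h1]
  · by_cases h2 : t ∈ S <;> simp [h1, h2]

lemma norm_repProj_sq {S : Set X} (hS : MeasurableSet S) (x : H) :
    ‖repProj π hS x‖ ^ 2 = (repMeasure π x).real S := by
  rw [repProj_apply, repApply_eq π x (memLp_indicator_const 2 hS 1 (.inr (measure_ne_top _ S))),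
    LinearIsometry.norm_map]
  have h := norm_indicatorConstLp (p := 2) (hs := hS) (hμs := measure_ne_top (repMeasure π x) S)
    (c := (1 : ℂ)) (by norm_num) (by norm_num)
  rw [indicatorConstLp] at h
  rw [h, norm_one, one_mul, ← Real.rpow_natCast, ← Real.rpow_mul measureReal_nonneg]
  norm_num

lemma repProj_congr {S T : Set X} (hS : MeasurableSet S) (hT : MeasurableSet T) (h : S = T) :
    repProj π hS = repProj π hT := by
  subst h; rfl

lemma sum_repProj {S : ℕ → Set X} (hS : ∀ n, MeasurableSet (S n))
    (hd : Pairwise (Function.onFun Disjoint S)) (x : H) (s : Finset ℕ) :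
    ∑ n ∈ s, repProj π (hS n) x = repProj π (s.measurableSet_biUnion fun n _ => hS n) x := by
  induction s using Finset.induction_on with
  | empty =>
    rw [Finset.sum_empty, repProj_apply]
    have h := repApply_continuousMap π x 0
    rw [map_zero] at h
    refine (h.symm.trans ?_)
    congr 1
    ext t
    simp
  | insert a s ha ih =>
    rw [Finset.sum_insert ha, ih, add_comm]
    have hm := (insert a s).measurableSet_biUnion fun n _ => hS n
    have hsub : ⋃ n ∈ s, S n ⊆ ⋃ n ∈ insert a s, S n :=
      Set.biUnion_subset_biUnion_left fun n hn => Finset.mem_insert_of_mem hn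
    have hdiff := repProj_diff π hm (s.measurableSet_biUnion fun n _ => hS n) hsub x
    have heq : (⋃ n ∈ insert a s, S n) \ (⋃ n ∈ s, S n) = S a := by
      rw [Finset.set_biUnion_insert, Set.union_sdiff_right]
      refine Disjoint.sdiff_eq_left ?_
      rw [Set.disjoint_iUnion₂_right]
      exact fun n hn => hd (fun h => ha (h ▸ hn))
    rw [repProj_congr π _ (hS a) heq] at hdiff
    rw [hdiff]
    abel

/-- The squared norm of the remainder is the `repMeasure` of what is left of the union, so strong
countable additivity reduces to that of a finite scalar measure. -/
lemma hasSum_repProj {S : ℕ → Set X} (hS : ∀ n, MeasurableSet (S n))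
    (hd : Pairwise (Function.onFun Disjoint S)) (x : H) :
    HasSum (fun n => repProj π (hS n) x) (repProj π (MeasurableSet.iUnion hS) x) := by
  have h1 : HasSum (fun n => (repMeasure π x).real (S n)) ((repMeasure π x).real (⋃ n, S n)) := by
    have := (repMeasure π x).toSignedMeasure.m_iUnion hS hd
    simpa only [Measure.toSignedMeasure_apply_measurable (hS _),
      Measure.toSignedMeasure_apply_measurable (MeasurableSet.iUnion hS)] using this
  have hn : ∀ s : Finset ℕ, ‖∑ n ∈ s, repProj π (hS n) x - repProj π (MeasurableSet.iUnion hS) x‖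
      = √((repMeasure π x).real (⋃ n, S n) - ∑ n ∈ s, (repMeasure π x).real (S n)) := fun s => by
    have hms := s.measurableSet_biUnion fun n _ => hS n
    have hsub : ⋃ n ∈ s, S n ⊆ ⋃ n, S n := Set.iUnion₂_subset fun n _ => Set.subset_iUnion S n
    rw [norm_sub_rev, sum_repProj π hS hd, ← repProj_diff π (MeasurableSet.iUnion hS) hms hsub,
      ← measureReal_biUnion_finset (fun i _ j _ hij => hd hij) (fun n _ => hS n),
      ← measureReal_sdiff hsub hms, ← norm_repProj_sq π ((MeasurableSet.iUnion hS).diff hms),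
      Real.sqrt_sq (norm_nonneg _)]
  rw [HasSum, tendsto_iff_norm_sub_tendsto_zero]
  simp only [SummationFilter.unconditional_filter, hn]
  have h2 := ((tendsto_const_nhds (x := (repMeasure π x).real (⋃ n, S n))).sub h1).sqrt
  simpa using h2

open Classical in
/-- The image under `κ : X → ℝ` of the projection-valued measure of a representation of `C(X)`. -/
def repPVM {κ : X → ℝ} (hκ : Measurable κ) : PVM H where
  proj S := if h : MeasurableSet S then repProj π (hκ h) else 0
  isStarProjection S := by
    split_ifs
    · exact isStarProjection_repProj π _
    · exact IsStarProjection.zero _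
  proj_not_measurable S hS := dif_neg hS
  proj_univ := by
    rw [dif_pos MeasurableSet.univ]
    exact repProj_univ π
  proj_inter S T hS hT := by
    rw [dif_pos hS, dif_pos hT, dif_pos (hS.inter hT)]
    exact repProj_inter π (hκ hS) (hκ hT)
  hasSum_proj S hS hd x := by
    simp only [dif_pos (hS _), dif_pos (MeasurableSet.iUnion hS)]
    have h := hasSum_repProj π (fun n => hκ (hS n)) (fun i j hij => (hd hij).preimage κ) x
    rwa [repProj_congr π _ (hκ (MeasurableSet.iUnion hS)) Set.preimage_iUnion.symm] at h

lemma repPVM_proj {κ : X → ℝ} (hκ : Measurable κ) {S : Set ℝ} (hS : MeasurableSet S) :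
    (repPVM π hκ).proj S = repProj π (hκ hS) := dif_pos hS

lemma repPVM_measure {κ : X → ℝ} (hκ : Measurable κ) (y : H) :
    (repPVM π hκ).measure y = (repMeasure π y).map κ := by
  ext S hS
  rw [PVM.measure_apply _ _ hS, Measure.map_apply hκ hS, repPVM_proj π hκ hS, norm_repProj_sq,
    ofReal_measureReal]

/-- The functional calculus of `repPVM` is that of the representation. -/
lemma repPVM_isom {κ : X → ℝ} (hκ : Measurable κ) (y : H) {f : ℝ → ℂ}
    (hf : MemLp f 2 ((repPVM π hκ).measure y)) :
    (repPVM π hκ).isom y hf.toLp = repApply π y (f ∘ κ) := by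
  have hmp : MeasurePreserving κ (repMeasure π y) ((repPVM π hκ).measure y) :=
    ⟨hκ, (repPVM_measure π hκ y).symm⟩
  set E := repPVM π hκ
  have key : ∀ F : Lp ℂ 2 (E.measure y),
      E.isom y F = repIsom π y (Lp.compMeasurePreserving κ hmp F) := by
    intro F
    refine (denseRange_linearCombination_indicator (E.measure y)).induction_on
      (p := fun F => E.isom y F = repIsom π y (Lp.compMeasurePreserving κ hmp F)) F ?_ ?_
    · exact isClosed_eq (E.isom y).continuous ((repIsom π y).continuous.comp
        (Lp.compMeasurePreservingₗᵢ ℂ κ hmp).continuous)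
    · intro u
      change E.isom y _ = repIsom π y (Lp.compMeasurePreservingₗᵢ ℂ κ hmp _)
      simp only [Finsupp.linearCombination_apply, Finsupp.sum, map_sum, map_smul]
      refine Finset.sum_congr rfl fun S _ => ?_
      congr 1
      rw [E.isom_indicator y S.2, repPVM_proj π hκ S.2, repProj_apply,
        repApply_eq π y (memLp_of_bounded π y (measurable_indicator_one (hκ S.2))
          (norm_indicator_one_le _))]
      congr 1
  have hf' : MemLp (f ∘ κ) 2 (repMeasure π y) := hf.comp_measurePreserving hmp
  rw [key, repApply_eq π y hf', Lp.toLp_compMeasurePreserving hf hmp]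

end RepresentationPVM

/-! ### The spectral theorem -/

/-! ### Composition of functions of a projection-valued measure -/

section Composition

variable {H : Type*} [NormedAddCommGroup H] [InnerProductSpace ℂ H] [CompleteSpace H] (E : PVM H)

lemma PVM.proj_isom (w : H) {f : ℝ → ℂ} (hf : MemLp f 2 (E.measure w)) {S : Set ℝ}
    (hS : MeasurableSet S) : E.proj S (E.isom w hf.toLp) = E.isom w (hf.indicator hS).toLp := by
  refine ext_inner_left ℂ fun x => ?_
  rw [E.inner_proj_isom x w hf hS, E.inner_isom, ← integral_indicator hS]
  refine integral_congr_ae (Eventually.of_forall fun ν => ?_)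
  by_cases h : ν ∈ S <;> simp [h]

lemma PVM.measure_isom (w : H) {f : ℝ → ℂ} (hf : MemLp f 2 (E.measure w)) :
    E.measure (E.isom w hf.toLp) = (E.measure w).withDensity fun ν => ‖f ν‖ₑ ^ 2 := by
  ext S hS
  rw [E.measure_apply _ hS, E.proj_isom w hf hS, LinearIsometry.norm_map, Lp.norm_toLp,
    withDensity_apply _ hS, ENNReal.ofReal_pow ENNReal.toReal_nonneg,
    ENNReal.ofReal_toReal (hf.indicator hS).2.ne, eLpNorm_indicator_eq_eLpNorm_restrict hS,
    eLpNorm_eq_lintegral_rpow_enorm_toReal (by norm_num) (by norm_num), ← ENNReal.rpow_natCast,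
    ← ENNReal.rpow_mul]
  norm_num

lemma PVM.complexMeasure_isom (x w : H) {f : ℝ → ℂ} (hf : MemLp f 2 (E.measure w)) :
    E.complexMeasure x (E.isom w hf.toLp)
      = (E.measure w).withDensityᵥ fun ν => f ν * E.dens x w ν :=
  (E.complexMeasure_eq_withDensityᵥ_iff x _ (E.integrable_mul_dens x w hf)).2
    fun _ hS => E.inner_proj_isom x w hf hS

/-- The composition rule h(E)f(E)w = (hf)(E)w in weak form. Only f and hf need be square integrable,
so h may be unbounded, as z - ν is. -/
lemma PVM.form_isom (x w : H) {f h : ℝ → ℂ} (hf : MemLp f 2 (E.measure w))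
    (hhf : MemLp (fun ν => h ν * f ν) 2 (E.measure w)) :
    E.form h x (E.isom w hf.toLp) = ⟪x, E.isom w hhf.toLp⟫_ℂ := by
  rw [E.inner_isom, E.form_eq_of_complexMeasure_eq (E.integrable_mul_dens x w hf)
    (E.complexMeasure_isom x w hf)]
  · simp only [mul_assoc]
  · simpa only [mul_assoc] using E.integrable_mul_dens x w hhf

lemma PVM.inner_isom_eq_form (x y : H) {f : ℝ → ℂ} (hf : MemLp f 2 (E.measure y)) :
    ⟪x, E.isom y hf.toLp⟫_ℂ = E.form f x y := by
  rw [E.inner_isom, E.form_eq x y hf]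

lemma memLp_inv_sub {μ : Measure ℝ} [IsFiniteMeasure μ] {z : ℂ} (hz : z.im ≠ 0) :
    MemLp (fun ν : ℝ => (z - ν)⁻¹) 2 μ :=
  MemLp.of_bound (measurable_inv_sub_ofReal z).aestronglyMeasurable |z.im|⁻¹
    (Eventually.of_forall fun ν => norm_inv_sub_ofReal_le hz ν)

lemma memLp_ofReal {μ : Measure ℝ} (h : Integrable (fun ν : ℝ => ν ^ 2) μ) :
    MemLp (fun ν : ℝ => (ν : ℂ)) 2 μ := by
  rw [memLp_two_iff_integrable_sq_norm Complex.measurable_ofReal.aestronglyMeasurable]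
  simpa using h

lemma memLp_sub_ofReal {μ : Measure ℝ} [IsFiniteMeasure μ] (h : Integrable (fun ν : ℝ => ν ^ 2) μ)
    (z : ℂ) : MemLp (fun ν : ℝ => z - ν) 2 μ := (memLp_const z).sub (memLp_ofReal h)

lemma sub_ofReal_ne_zero {z : ℂ} (hz : z.im ≠ 0) (ν : ℝ) : z - ν ≠ 0 := fun h => hz (by
  have := congrArg Complex.im h
  simpa using this)

lemma PVM.isom_congr (y : H) {f g : ℝ → ℂ} (hf : MemLp f 2 (E.measure y))
    (hg : MemLp g 2 (E.measure y)) (h : ∀ ν, f ν = g ν) : E.isom y hf.toLp = E.isom y hg.toLp := by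
  obtain rfl : f = g := funext h
  rfl

end Composition

/-! ### From a single resolvent to the spectral measure -/

section Spectral

variable {H : Type*} [NormedAddCommGroup H] [InnerProductSpace ℂ H] [CompleteSpace H]
  {A : H →ₗ.[ℂ] H}

/-- One non-real point suffices, because R has range D(A). Vectors Ru have finite second moment
since ν/(z-ν) is bounded; conversely y with finite second moment is R applied to (z-ν)(E)y. The
action of A follows from AR = zR - 1 and ν/(z-ν) = z/(z-ν) - 1. -/
lemma isSpectralMeasure_of_resolvent {z : ℂ} (hz : z.im ≠ 0) {R : H →L[ℂ] H}
    (hR : IsResolventAt A z R) (E : PVM H)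
    (hE : ∀ y, R y = E.isom y (memLp_inv_sub (μ := E.measure y) hz).toLp) :
    IsSpectralMeasure A E := by
  have hbd : ∀ ν : ℝ, ‖(ν : ℂ) * (z - ν)⁻¹‖ ≤ ‖z‖ * |z.im|⁻¹ + 1 := fun ν => by
    have h0 := sub_ofReal_ne_zero hz ν
    have h1 : (ν : ℂ) * (z - ν)⁻¹ = z * (z - ν)⁻¹ - 1 := by field_simp; ring
    rw [h1]
    refine (norm_sub_le _ _).trans ?_
    rw [norm_mul, norm_one]
    gcongr
    exact norm_inv_sub_ofReal_le hz ν
  have hmeas : Measurable fun ν : ℝ => (ν : ℂ) * (z - ν)⁻¹ :=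
    Complex.measurable_ofReal.mul (measurable_inv_sub_ofReal z)
  have hmem : ∀ u, MemLp (fun ν : ℝ => (ν : ℂ) * (z - ν)⁻¹) 2 (E.measure u) := fun u =>
    MemLp.of_bound hmeas.aestronglyMeasurable _ (Eventually.of_forall hbd)
  refine ⟨fun y => ⟨fun hy => ?_, fun hy => ?_⟩, fun y x => ?_⟩
  · have h1 : y = R (z • y - A ⟨y, hy⟩) := (hR.2 ⟨y, hy⟩).symm
    rw [h1, hE, E.measure_isom, integrable_withDensity_iff_integrable_smul₀'
      ((measurable_inv_sub_ofReal z).enorm.pow_const 2).aemeasurable (by simp)]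
    refine ((memLp_two_iff_integrable_sq_norm hmeas.aestronglyMeasurable).1 (hmem _)).congr
      (Eventually.of_forall fun ν => ?_)
    simp only [ENNReal.toReal_pow, toReal_enorm, norm_mul, mul_pow, Complex.norm_real,
      Real.norm_eq_abs, sq_abs, smul_eq_mul]
    ring
  · have hm := memLp_sub_ofReal hy z
    have h1 : R (E.isom y hm.toLp) = y := by
      refine ext_inner_left ℂ fun x => ?_
      have hm1 : MemLp (fun ν : ℝ => (z - ν)⁻¹ * (z - ν)) 2 (E.measure y) := by
        simp only [inv_mul_cancel₀ (sub_ofReal_ne_zero hz _)]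
        exact memLp_const 1
      rw [hE, E.inner_isom_eq_form, E.form_isom x y hm hm1,
        E.isom_congr y hm1 (memLp_const 1) fun ν => inv_mul_cancel₀ (sub_ofReal_ne_zero hz ν),
        E.isom_one]
    rw [← h1]
    exact (hR.1 _).1
  · set u := z • (y : H) - A y with hu
    have h1 : (y : H) = R u := (hR.2 y).symm
    have h2 : A y = z • R u - u := by rw [← h1, hu]; abel
    rw [h2, h1, hE u, E.form_isom x u _ (hmem u), inner_sub_right, inner_smul_right, E.inner_isom,
      E.inner_isom]
    have h3 : ⟪x, u⟫_ℂ = ∫ ν, 1 * E.dens x u ν ∂E.measure u := by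
      conv_lhs => rw [← E.isom_one u]
      rw [E.inner_isom]
    rw [h3, ← integral_const_mul, ← integral_sub
      ((E.integrable_mul_dens x u (memLp_inv_sub hz)).const_mul z)
      (E.integrable_mul_dens x u (memLp_const 1))]
    refine integral_congr_ae (Eventually.of_forall fun ν => ?_)
    have h0 := sub_ofReal_ne_zero hz ν
    simp only
    field_simp
    ring

lemma IsSpectralMeasure.isom_sub {E : PVM H} (hE : IsSpectralMeasure A E) (z : ℂ) (w : A.domain) :
    E.isom w (memLp_sub_ofReal ((hE.1 w).1 w.2) z).toLp = z • (w : H) - A w := by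
  refine ext_inner_left ℂ fun x => ?_
  have hm := memLp_ofReal ((hE.1 w).1 w.2)
  have h3 : ⟪x, (w : H)⟫_ℂ = ∫ ν, 1 * E.dens x w ν ∂E.measure w := by
    conv_lhs => rw [← E.isom_one (w : H)]
    rw [E.inner_isom]
  rw [inner_sub_right, inner_smul_right, hE.2, E.inner_isom, E.form_eq x w hm, h3,
    ← integral_const_mul, ← integral_sub
      ((E.integrable_mul_dens x w (memLp_const 1)).const_mul z) (E.integrable_mul_dens x w hm)]
  refine integral_congr_ae (Eventually.of_forall fun ν => ?_)
  simp only
  ring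

/-- The matrix elements of the resolvent are Stieltjes transforms. -/
lemma IsSpectralMeasure.inner_resolvent {E : PVM H} (hE : IsSpectralMeasure A E) {z : ℂ}
    (hz : z.im ≠ 0) {R : H →L[ℂ] H} (hR : IsResolventAt A z R) (x y : H) :
    ⟪x, R y⟫_ℂ = stieltjes (E.measure y) (E.dens x y) z := by
  obtain ⟨hw, hw'⟩ := hR.1 y
  have h1 := hE.isom_sub z ⟨R y, hw⟩
  simp only [hw'] at h1
  have hm := memLp_sub_ofReal ((hE.1 (R y)).1 hw) z
  have hm1 : MemLp (fun ν : ℝ => (z - ν)⁻¹ * (z - ν)) 2 (E.measure (R y)) := by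
    simp only [inv_mul_cancel₀ (sub_ofReal_ne_zero hz _)]
    exact memLp_const 1
  have h2 := E.form_isom x (R y) hm hm1
  rw [E.isom_congr _ hm1 (memLp_const 1) fun ν => inv_mul_cancel₀ (sub_ofReal_ne_zero hz ν),
    E.isom_one, h1, E.form_eq x y (memLp_inv_sub hz)] at h2
  exact h2.symm

/-- The adjoint of a resolvent is a resolvent. -/
lemma IsResolventAt.adjoint_eq (hA : IsSelfAdjoint A) {z : ℂ} {R R' : H →L[ℂ] H}
    (h : IsResolventAt A z R) (h' : IsResolventAt A (conj z) R') :
    ContinuousLinearMap.adjoint R = R' := by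
  ext x
  refine ext_inner_left ℂ fun y => ?_
  rw [ContinuousLinearMap.adjoint_inner_right, h.inner_left hA h']

/-- T = (i - A)⁻¹ is normal by the resolvent identity. Its continuous functional calculus yields a
projection-valued measure on the spectrum of T, which is carried to the line by inverting w = 1/(i -
ν). -/
lemma exists_isSpectralMeasure (hA : IsSelfAdjoint A) : ∃ E : PVM H, IsSpectralMeasure A E := by
  have hz : Complex.I.im ≠ 0 := by simp
  have hz' : (conj Complex.I).im ≠ 0 := by simp
  have hT := IsSelfAdjoint.isResolventAt_res hA hz
  have hT' := IsSelfAdjoint.isResolventAt_res hA hz'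
  set T := res A Complex.I
  set T' := res A (conj Complex.I)
  have hadj : star T = T' := hT.adjoint_eq hA hT'
  have h1 : T - star T = (-2 * Complex.I) • (star T * T) := by
    rw [hadj, hT.sub_eq hT', Complex.conj_I]
    congr 1
    ring
  have h2 : T - star T = (-2 * Complex.I) • (T * star T) := by
    rw [hadj, ← neg_sub, hT'.sub_eq hT, Complex.conj_I, ← neg_smul]
    congr 1
    ring
  have hnormal : IsStarNormal T := ⟨by
    have h3 : (-2 * Complex.I) • (star T * T) = (-2 * Complex.I) • (T * star T) := h1.symm.trans h2
    exact smul_right_injective _ (by simp) h3⟩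
  let π : C(spectrum ℂ T, ℂ) →⋆ₐ[ℂ] (H →L[ℂ] H) := cfcHom hnormal
  let ι : C(spectrum ℂ T, ℂ) := (ContinuousMap.id ℂ).restrict (spectrum ℂ T)
  have hι : π ι = T := cfcHom_id hnormal
  -- The resolvent identity read on the spectrum. For w ≠ 0 it says Im(1/w) = 1, that is, i - 1/w is
  -- real.
  have hrel : ∀ w : spectrum ℂ T, (w : ℂ) - conj (w : ℂ) = -2 * Complex.I * (conj (w : ℂ) * w) := by
    have h3 : ι - star ι = (-2 * Complex.I) • (star ι * ι) := by
      refine cfcHom_injective hnormal ?_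
      change π _ = π _
      rw [map_sub, map_smul, map_mul, map_star, hι, h1]
    intro w
    have h4 := congrArg (fun f : C(spectrum ℂ T, ℂ) => f w) h3
    simpa [ι] using h4
  let κ : spectrum ℂ T → ℝ := fun w => (Complex.I - (w : ℂ)⁻¹).re
  have hκ : Measurable κ := by
    have : Measurable fun w : spectrum ℂ T => (w : ℂ) := measurable_subtype_coe
    exact Complex.measurable_re.comp (measurable_const.sub this.inv)
  have hικ : ∀ w : spectrum ℂ T, (w : ℂ) ≠ 0 → (w : ℂ) = (Complex.I - (κ w : ℂ))⁻¹ := by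
    intro w hw
    have hcw : conj (w : ℂ) ≠ 0 := by simpa using hw
    have h3 : conj ((w : ℂ)⁻¹) - (w : ℂ)⁻¹ = -2 * Complex.I := by
      rw [map_inv₀]
      field_simp
      linear_combination hrel w
    have h4 : ((w : ℂ)⁻¹).im = 1 := by
      generalize (w : ℂ)⁻¹ = q at h3
      have := congrArg Complex.im h3
      simp at this
      linarith
    have h5 : (κ w : ℂ) = Complex.I - (w : ℂ)⁻¹ := by
      apply Complex.ext
      · simp [κ]
      · simp only [Complex.ofReal_im, Complex.sub_im, Complex.I_im, h4, sub_self]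
    rw [h5, sub_sub_cancel, inv_inv]
  have hZ : MeasurableSet {w : spectrum ℂ T | (w : ℂ) = 0} :=
    (measurable_subtype_coe (measurableSet_singleton (0 : ℂ)))
  -- The point w = 0 corresponds to ν = ∞. It carries no mass because T kills its spectral
  -- projection and T is injective, so the value of κ at 0, given by the convention 0⁻¹ = 0, is
  -- immaterial.
  have hnull : ∀ y : H, ∀ᵐ w : spectrum ℂ T ∂repMeasure π y, (w : ℂ) ≠ 0 := by
    intro y
    have hTz : T (repProj π hZ y) = 0 := by
      have h3 := rep_repApply π ι y (measurable_indicator_one hZ) (norm_indicator_one_le _)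
      have h4 := repApply_continuousMap π y 0
      rw [map_zero] at h4
      refine (congrArg (fun S : H →L[ℂ] H => S (repProj π hZ y)) hι).symm.trans (h3.trans ?_)
      refine Eq.trans ?_ h4
      congr 1
      ext w
      by_cases h : (w : ℂ) = 0 <;> simp [ι, h]
    have hz0 : repProj π hZ y = 0 := by
      obtain ⟨hx, hx'⟩ := hT.1 (repProj π hZ y)
      have h3 : A ⟨T (repProj π hZ y), hx⟩ = 0 := by
        have : (⟨T (repProj π hZ y), hx⟩ : A.domain) = 0 := Subtype.ext hTz
        rw [this, A.map_zero]
      rw [h3, hTz] at hx'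
      simpa using hx'.symm
    have h4 := norm_repProj_sq π hZ y
    rw [hz0, norm_zero, zero_pow two_ne_zero] at h4
    rw [ae_iff]
    simp only [not_not]
    exact (measureReal_eq_zero_iff (measure_ne_top _ _)).1 h4.symm
  refine ⟨repPVM π hκ, isSpectralMeasure_of_resolvent hz hT _ fun y => ?_⟩
  rw [repPVM_isom π hκ y]
  refine (congrArg (fun S : H →L[ℂ] H => S y) hι).symm.trans ?_
  rw [← repApply_continuousMap]
  refine repApply_congr π y ?_
  filter_upwards [hnull y] with w hw
  exact hικ w hw

lemma isSpectralMeasure_spectralMeasure (hA : IsSelfAdjoint A) :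
    IsSpectralMeasure A (spectralMeasure A) := by
  rw [spectralMeasure, dif_pos (exists_isSpectralMeasure hA)]
  exact (exists_isSpectralMeasure hA).choose_spec

end Spectral

/-! ### The support of the spectral measure, and `η` as a matrix element -/

section Support

variable {H : Type*} [NormedAddCommGroup H] [InnerProductSpace ℂ H] [CompleteSpace H]
  {A : H →ₗ.[ℂ] H}

lemma PVM.measure_proj (E : PVM H) (v : H) {S : Set ℝ} (hS : MeasurableSet S) :
    E.measure (E.proj S v) = (E.measure v).restrict S := by
  ext T hT
  rw [E.measure_apply _ hT, Measure.restrict_apply hT, E.measure_apply _ (hT.inter hS),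
    E.proj_proj hT hS]

/-- Near a point x₀ of the resolvent set with inverse R, put y = E(ball)v for a ball of radius δ.
Then ‖(x₀ - A)y‖ ≤ δ‖y‖, hence ‖y‖ ≤ ‖R‖δ‖y‖, and δ‖R‖ < 1 forces y = 0. -/
lemma IsSpectralMeasure.measure_compl_realSpectrum {E : PVM H} (hE : IsSpectralMeasure A E)
    (v : H) : E.measure v (realSpectrum A)ᶜ = 0 := by
  refine measure_null_of_locally_null _ fun x₀ hx₀ => ?_
  simp only [realSpectrum, Set.mem_compl_iff, Set.mem_ofPred_eq, not_not] at hx₀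
  obtain ⟨R, hR⟩ := hx₀
  have hδ : 0 < (‖R‖ + 1)⁻¹ := by positivity
  set δ := (‖R‖ + 1)⁻¹ with hδdef
  refine ⟨Metric.ball x₀ δ, mem_nhdsWithin_of_mem_nhds (Metric.ball_mem_nhds x₀ hδ), ?_⟩
  have hB : MeasurableSet (Metric.ball x₀ δ) := measurableSet_ball
  set y := E.proj (Metric.ball x₀ δ) v with hy
  have hae : ∀ᵐ ν ∂E.measure y, |ν - x₀| < δ := by
    rw [hy, E.measure_proj v hB]
    filter_upwards [ae_restrict_mem hB] with ν hν
    exact hν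
  have hdom : y ∈ A.domain := by
    refine (hE.1 y).2 (Integrable.of_bound (by fun_prop) ((|x₀| + δ) ^ 2) ?_)
    filter_upwards [hae] with ν hν
    rw [norm_pow, Real.norm_eq_abs]
    gcongr
    have := abs_sub_abs_le_abs_sub ν x₀
    linarith
  have h1 := hR.2 ⟨y, hdom⟩
  rw [← hE.isom_sub (x₀ : ℂ) ⟨y, hdom⟩] at h1
  have h2 : ‖E.isom y (memLp_sub_ofReal ((hE.1 y).1 hdom) (x₀ : ℂ)).toLp‖ ≤ δ * ‖y‖ := by
    have hn : ‖y‖ = ‖(memLp_const (1 : ℂ) :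
        MemLp (fun _ : ℝ => (1 : ℂ)) 2 (E.measure y)).toLp‖ := by
      rw [← (E.isom y).norm_map, E.isom_one]
    rw [LinearIsometry.norm_map, hn]
    refine Lp.norm_le_mul_norm_of_ae_le_mul ?_
    filter_upwards [hae, MemLp.coeFn_toLp (memLp_sub_ofReal ((hE.1 y).1 hdom) (x₀ : ℂ)),
      MemLp.coeFn_toLp (memLp_const (1 : ℂ) : MemLp (fun _ : ℝ => (1 : ℂ)) 2 (E.measure y))]
      with ν hν h3 h4
    rw [h3, h4, norm_one, mul_one, ← Complex.ofReal_sub, Complex.norm_real, Real.norm_eq_abs,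
      abs_sub_comm]
    exact hν.le
  have h3 : ‖y‖ ≤ ‖R‖ * (δ * ‖y‖) := by
    calc ‖y‖ = _ := (congrArg norm h1).symm
      _ ≤ ‖R‖ * _ := R.le_opNorm _
      _ ≤ _ := by gcongr
  have h4 : ‖y‖ = 0 := by
    have h5 : ‖R‖ * δ < 1 := by
      rw [hδdef, ← div_eq_mul_inv, div_lt_one (by positivity)]; linarith
    by_contra hne
    have hpos : 0 < ‖y‖ := lt_of_le_of_ne (norm_nonneg _) (Ne.symm hne)
    nlinarith
  rw [E.measure_apply v hB, ← hy, h4]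
  simp

lemma IsSpectralMeasure.restrict_realSpectrum {E : PVM H} (hE : IsSpectralMeasure A E) (v : H) :
    (E.measure v).restrict (realSpectrum A) = E.measure v :=
  Measure.restrict_eq_self_of_ae_mem (hE.measure_compl_realSpectrum v)

/-- The restriction to the spectrum is harmless because the measure lives there, and ⟨g,Eg⟩ has
density one with respect to itself. -/
lemma eta_eq (hA : IsSelfAdjoint A) (g : H) (Ω lam : ℝ) {z : ℂ} (hz : z.im ≠ 0) :
    eta A g Ω lam z = z - Ω - (lam : ℂ) ^ 2 * ⟪g, res A z g⟫_ℂ := by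
  have hE := isSpectralMeasure_spectralMeasure hA
  rw [eta, hE.restrict_realSpectrum,
    hE.inner_resolvent hz (IsSelfAdjoint.isResolventAt_res hA hz), stieltjes]
  congr 2
  refine integral_congr_ae ?_
  filter_upwards [(spectralMeasure A).dens_self g] with ν hν
  rw [hν, mul_one]

lemma inner_res_conj (hA : IsSelfAdjoint A) (x y : H) {z : ℂ} (hz : z.im ≠ 0) :
    ⟪x, res A (conj z) y⟫_ℂ = conj ⟪y, res A z x⟫_ℂ := by
  have hz' : (conj z).im ≠ 0 := by simpa using hz
  rw [← (IsSelfAdjoint.isResolventAt_res hA hz).inner_left hA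
    (IsSelfAdjoint.isResolventAt_res hA hz'), inner_conj_symm]

lemma eta_conj (hA : IsSelfAdjoint A) (g : H) (Ω lam : ℝ) {z : ℂ} (hz : z.im ≠ 0) :
    eta A g Ω lam (conj z) = conj (eta A g Ω lam z) := by
  have hz' : (conj z).im ≠ 0 := by simpa using hz
  rw [eta_eq hA g Ω lam hz, eta_eq hA g Ω lam hz', inner_res_conj hA g g hz]
  simp

lemma im_inner_res (hA : IsSelfAdjoint A) (g : H) {z : ℂ} (hz : z.im ≠ 0) :
    (⟪g, res A z g⟫_ℂ).im = -(z.im * ‖res A z g‖ ^ 2) := by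
  obtain ⟨hw, hw'⟩ := (IsSelfAdjoint.isResolventAt_res hA hz).1 g
  set w := res A z g
  have him : (⟪A ⟨w, hw⟩, w⟫_ℂ).im = 0 := by
    have h1 : conj ⟪A ⟨w, hw⟩, w⟫_ℂ = ⟪A ⟨w, hw⟩, w⟫_ℂ := by
      rw [inner_conj_symm]
      exact (IsSelfAdjoint.inner_symm hA ⟨w, hw⟩ ⟨w, hw⟩).symm
    exact Complex.conj_eq_iff_im.1 h1
  have h2 : ⟪g, w⟫_ℂ = conj z * (‖w‖ ^ 2 : ℝ) - ⟪A ⟨w, hw⟩, w⟫_ℂ := by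
    nth_rewrite 1 [← hw']
    rw [inner_sub_left, inner_smul_left, inner_self_eq_norm_sq_to_K]
    norm_cast
  rw [h2, Complex.sub_im, him, Complex.im_mul_ofReal, Complex.conj_im]
  ring

/-- The source of all positivity: η has no zeros off the real axis, and Im η(z) ≥ Im z in the upper
half-plane. -/
lemma im_eta (hA : IsSelfAdjoint A) (g : H) (Ω lam : ℝ) {z : ℂ} (hz : z.im ≠ 0) :
    (eta A g Ω lam z).im = z.im * (1 + lam ^ 2 * ‖res A z g‖ ^ 2) := by
  rw [eta_eq hA g Ω lam hz, Complex.sub_im, Complex.sub_im, ← Complex.ofReal_pow,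
    Complex.im_ofReal_mul, im_inner_res hA g hz, Complex.ofReal_im]
  ring

lemma eta_ne_zero (hA : IsSelfAdjoint A) (g : H) (Ω lam : ℝ) {z : ℂ} (hz : z.im ≠ 0) :
    eta A g Ω lam z ≠ 0 := fun h => by
  have h1 := im_eta hA g Ω lam hz
  rw [h, Complex.zero_im] at h1
  exact mul_ne_zero hz (by positivity) h1.symm

/-- The Stieltjes representation of the matrix elements of the resolvent. -/
lemma inner_res_eq (hA : IsSelfAdjoint A) (x y : H) {z : ℂ} (hz : z.im ≠ 0) :
    ⟪x, res A z y⟫_ℂ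
      = stieltjes ((spectralMeasure A).measure y) ((spectralMeasure A).dens x y) z :=
  (isSpectralMeasure_spectralMeasure hA).inner_resolvent hz
    (IsSelfAdjoint.isResolventAt_res hA hz) x y

/-- Taking adjoints of resolvents exchanges the two vectors and the two signs of iε. -/
lemma Abs.symm (hA : IsSelfAdjoint A) {x y : H} (h : Abs A x y) : Abs A y x := by
  obtain ⟨C, hC⟩ := h
  refine ⟨C, fun ν ε hε => ⟨?_, ?_⟩⟩
  · have hz : (ν - Complex.I * ε : ℂ).im ≠ 0 := by simpa using hε.ne'
    have h1 : (ν + Complex.I * ε : ℂ) = conj (ν - Complex.I * ε : ℂ) := by simp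
    rw [h1, inner_res_conj hA y x hz, RCLike.norm_conj]
    exact (hC ν ε hε).2
  · have hz : (ν + Complex.I * ε : ℂ).im ≠ 0 := by simpa using hε.ne'
    have h1 : (ν - Complex.I * ε : ℂ) = conj (ν + Complex.I * ε : ℂ) := by simp [sub_eq_add_neg]
    rw [h1, inner_res_conj hA y x hz, RCLike.norm_conj]
    exact (hC ν ε hε).1

end Support

/-! ### The direct sum -/

section DirectSum

variable {N : ℕ} {K : Fin N → Type*} [∀ k, NormedAddCommGroup (K k)]
  [∀ k, InnerProductSpace ℂ (K k)] [∀ k, CompleteSpace (K k)] {h : ∀ k, K k →ₗ.[ℂ] K k}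

/-- Maximality is checked one summand at a time, with test vectors supported in a single component.
-/
lemma isSelfAdjoint_directSum (hs : ∀ k, IsSelfAdjoint (h k)) : IsSelfAdjoint (directSum h) := by
  rw [isSelfAdjoint_iff]
  refine ⟨?_, fun x y => ?_, fun y w hyw k => ?_⟩
  · have h1 : Dense (Set.pi Set.univ fun k => ((h k).domain : Set (K k))) :=
      dense_pi Set.univ fun k _ => (hs k).dense_domain
    have h2 := h1.preimage (PiLp.homeomorph 2 K).isOpenMap
    refine Dense.mono (fun ψ hψ k => ?_) h2
    exact hψ k trivial
  · rw [PiLp.inner_apply, PiLp.inner_apply]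
    exact Finset.sum_congr rfl fun k _ => IsSelfAdjoint.inner_symm (hs k) ⟨_, x.2 k⟩ ⟨_, y.2 k⟩
  · refine (isSelfAdjoint_iff.1 (hs k)).2.2 (y k) (w k) fun u => ?_
    have hmem : ∀ j, (PiLp.single 2 k (u : K k) : PiLp 2 K) j ∈ (h j).domain := fun j => by
      by_cases hj : j = k
      · subst hj; rw [PiLp.single_eq_same]; exact u.2
      · rw [PiLp.single_eq_of_ne 2 hj]; exact (h j).domain.zero_mem
    have h1 := hyw ⟨PiLp.single 2 k (u : K k), hmem⟩
    rw [PiLp.inner_apply, PiLp.inner_apply, Finset.sum_eq_single k, Finset.sum_eq_single k] at h1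
    · have h2 : directSum h ⟨PiLp.single 2 k (u : K k), hmem⟩ k = h k u := by
        change h k ⟨_, hmem k⟩ = h k u
        congr 1
        exact Subtype.ext (PiLp.single_eq_same 2 k (u : K k))
      rw [h2, PiLp.single_eq_same] at h1
      exact h1
    · intro j _ hj
      have h2 : directSum h ⟨PiLp.single 2 k (u : K k), hmem⟩ j = 0 := by
        change h j ⟨_, hmem j⟩ = 0
        have h3 : (⟨_, hmem j⟩ : (h j).domain) = 0 :=
          Subtype.ext (PiLp.single_eq_of_ne 2 hj (u : K k))
        rw [h3, (h j).map_zero]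
      rw [h2, inner_zero_right]
    · simp
    · intro j _ hj
      rw [PiLp.single_eq_of_ne 2 hj, inner_zero_right]
    · simp

lemma res_directSum_apply (hs : ∀ k, IsSelfAdjoint (h k)) {z : ℂ} (hz : z.im ≠ 0) (ξ : PiLp 2 K)
    (k : Fin N) : res (directSum h) z ξ k = res (h k) z (ξ k) := by
  obtain ⟨hx, hx'⟩ := (IsSelfAdjoint.isResolventAt_res (isSelfAdjoint_directSum hs) hz).1 ξ
  have h1 := (IsSelfAdjoint.isResolventAt_res (hs k) hz).2 ⟨_, hx k⟩
  have h2 : z • res (directSum h) z ξ k - h k ⟨_, hx k⟩ = ξ k := by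
    conv_rhs => rw [← hx']
    rfl
  rw [h2] at h1
  exact h1.symm

/-- The resolvent of the direct sum acts componentwise, so its matrix elements are finite sums of
bounded ones. -/
lemma AbsSum.abs (hs : ∀ k, IsSelfAdjoint (h k)) {ψ ξ : PiLp 2 K} (hψξ : AbsSum h ψ ξ) :
    Abs (directSum h) ψ ξ := by
  choose C hC using hψξ
  refine ⟨∑ k, C k, fun ν ε hε => ⟨?_, ?_⟩⟩ <;> rw [PiLp.inner_apply] <;>
    refine norm_sum_le_of_le _ fun k _ => ?_
  · rw [res_directSum_apply hs (by simpa using hε.ne')]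
    exact (hC k ν ε hε).1
  · rw [res_directSum_apply hs (by simpa using hε.ne')]
    exact (hC k ν ε hε).2

end DirectSum

/-! ### The coupled operator -/

section Coupled

variable {H : Type*} [NormedAddCommGroup H] [InnerProductSpace ℂ H] [CompleteSpace H]
  {A : H →ₗ.[ℂ] H}

/-- The coupling is a bounded symmetric perturbation. Maximality needs only the test vectors (0,u):
on them the coupling contributes a multiple of ⟨g,u⟩, which is absorbed into w. -/
lemma isSelfAdjoint_coupled (hA : IsSelfAdjoint A) (g : H) (Ω lam : ℝ) :
    IsSelfAdjoint (coupled A g Ω lam) := by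
  rw [isSelfAdjoint_iff]
  refine ⟨?_, fun x y => ?_, fun y w hyw => ?_⟩
  · exact hA.dense_domain.preimage
      (isOpenMap_snd.comp (WithLp.homeomorphProd 2 ℂ H).isOpenMap)
  · obtain ⟨x, hx⟩ := x
    obtain ⟨y, hy⟩ := y
    have h1 : ⟪A ⟨x.snd, hx⟩, y.snd⟫_ℂ = ⟪x.snd, A ⟨y.snd, hy⟩⟫_ℂ :=
      IsSelfAdjoint.inner_symm hA ⟨x.snd, hx⟩ ⟨y.snd, hy⟩
    change ⟪(Ω : ℂ) * x.fst + lam * ⟪g, x.snd⟫_ℂ, y.fst⟫_ℂ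
        + ⟪A ⟨x.snd, hx⟩ + ((lam : ℂ) * x.fst) • g, y.snd⟫_ℂ
      = ⟪x.fst, (Ω : ℂ) * y.fst + lam * ⟪g, y.snd⟫_ℂ⟫_ℂ
        + ⟪x.snd, A ⟨y.snd, hy⟩ + ((lam : ℂ) * y.fst) • g⟫_ℂ
    simp only [inner_add_left, inner_add_right, inner_smul_left, inner_smul_right,
      RCLike.inner_apply, map_add, map_mul, Complex.conj_ofReal, inner_conj_symm, h1]
    ring
  · refine (isSelfAdjoint_iff.1 hA).2.2 y.snd (w.snd - ((lam : ℂ) * y.fst) • g) fun u => ?_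
    have h1 := hyw ⟨WithLp.toLp 2 (0, (u : H)), u.2⟩
    change ⟪w.fst, (0 : ℂ)⟫_ℂ + ⟪w.snd, (u : H)⟫_ℂ
      = ⟪y.fst, (Ω : ℂ) * 0 + lam * ⟪g, (u : H)⟫_ℂ⟫_ℂ
        + ⟪y.snd, A u + ((lam : ℂ) * 0) • g⟫_ℂ at h1
    simp only [RCLike.inner_apply, mul_zero, zero_mul, zero_add, zero_smul, add_zero] at h1
    rw [inner_sub_left, inner_smul_left, map_mul, Complex.conj_ofReal]
    linear_combination h1

/-- The matrix elements of the resolvent of the coupled operator. -/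
lemma inner_res_coupled (hA : IsSelfAdjoint A) (g : H) (Ω lam : ℝ) {z : ℂ} (hz : z.im ≠ 0)
    (c d : ℂ) (ψ ξ : H) :
    ⟪WithLp.toLp 2 (d, ξ), res (coupled A g Ω lam) z (WithLp.toLp 2 (c, ψ))⟫_ℂ
      = (c + lam * ⟪g, res A z ψ⟫_ℂ) * (conj d + lam * ⟪ξ, res A z g⟫_ℂ) / eta A g Ω lam z
        + ⟪ξ, res A z ψ⟫_ℂ := by
  obtain ⟨hx, hx'⟩ := (IsSelfAdjoint.isResolventAt_res (isSelfAdjoint_coupled hA g Ω lam) hz).1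
    (WithLp.toLp 2 (c, ψ))
  have hR := IsSelfAdjoint.isResolventAt_res hA hz
  set X := res (coupled A g Ω lam) z (WithLp.toLp 2 (c, ψ)) with hX
  have h1 : z * X.fst - ((Ω : ℂ) * X.fst + lam * ⟪g, X.snd⟫_ℂ) = c :=
    congrArg WithLp.fst hx'
  have h2 : z • X.snd - (A ⟨X.snd, hx⟩ + ((lam : ℂ) * X.fst) • g) = ψ :=
    congrArg WithLp.snd hx'
  -- The reservoir row of (z - h)X = (c,ψ) is solved for X.snd; substituted into the first row it
  -- leaves a scalar equation with coefficient η(z).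
  have h3 : X.snd = res A z ψ + ((lam : ℂ) * X.fst) • res A z g := by
    rw [← map_smul, ← map_add, ← h2]
    have h4 := hR.2 ⟨X.snd, hx⟩
    rw [← sub_sub, sub_add_cancel, h4]
  have h5 : X.fst * eta A g Ω lam z = c + lam * ⟪g, res A z ψ⟫_ℂ := by
    rw [eta_eq hA g Ω lam hz]
    rw [h3, inner_add_right, inner_smul_right] at h1
    linear_combination h1
  have hη := eta_ne_zero hA g Ω lam hz
  rw [WithLp.prod_inner_apply, ← h5]
  change ⟪d, X.fst⟫_ℂ + ⟪ξ, X.snd⟫_ℂ = _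
  rw [h3, inner_add_right, inner_smul_right, RCLike.inner_apply]
  field_simp
  ring

end Coupled

/-! ### Boundary values of matrix elements of the resolvent -/

section Boundary

variable {H : Type*} [NormedAddCommGroup H] [InnerProductSpace ℂ H] [CompleteSpace H]
  {A : H →ₗ.[ℂ] H}

/-- The density `(2πi)⁻¹ (G₋ - G₊)` obtained from boundary values by the Stieltjes inversion
formula. -/
def jump (Gp Gm : ℝ → ℂ) (ν : ℝ) : ℂ := (2 * Real.pi * Complex.I)⁻¹ * (Gm ν - Gp ν)

/-- `Gp` and `Gm` are the boundary values of `z ↦ ⟨x, (z - A)⁻¹ y⟩` from above and from below. -/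
structure BoundaryValues (A : H →ₗ.[ℂ] H) (x y : H) (Gp Gm : ℝ → ℂ) : Prop where
  measurable_plus : Measurable Gp
  measurable_minus : Measurable Gm
  bounded : ∃ C, ∀ ν, ‖Gp ν‖ ≤ C ∧ ‖Gm ν‖ ≤ C
  tendsto_plus : ∀ᵐ ν : ℝ,
    Tendsto (fun ε : ℝ => ⟪x, res A (ν + Complex.I * ε) y⟫_ℂ) (𝓝[>] 0) (𝓝 (Gp ν))
  tendsto_minus : ∀ᵐ ν : ℝ,
    Tendsto (fun ε : ℝ => ⟪x, res A (ν - Complex.I * ε) y⟫_ℂ) (𝓝[>] 0) (𝓝 (Gm ν))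
  integrable : Integrable (jump Gp Gm)
  complexMeasure_eq : (spectralMeasure A).complexMeasure x y = volume.withDensityᵥ (jump Gp Gm)

lemma im_add_I_mul_ne_zero (ν : ℝ) {ε : ℝ} (hε : 0 < ε) : (ν + Complex.I * ε : ℂ).im ≠ 0 := by
  simpa using hε.ne'

lemma im_sub_I_mul_ne_zero (ν : ℝ) {ε : ℝ} (hε : 0 < ε) : (ν - Complex.I * ε : ℂ).im ≠ 0 := by
  simpa using hε.ne'

lemma Abs.exists_boundaryValues (hA : IsSelfAdjoint A) {x y : H} (h : Abs A x y) :
    ∃ Gp Gm, BoundaryValues A x y Gp Gm := by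
  obtain ⟨C, hC⟩ := h
  obtain ⟨Gp, Gm, hp, hm, hpC, hmC, htp, htm, hint, heq⟩ := stieltjes_boundary
    ((spectralMeasure A).integrable_dens x y) (C := C) fun ν ε hε => by
      rw [← inner_res_eq hA x y (im_add_I_mul_ne_zero ν hε),
        ← inner_res_eq hA x y (im_sub_I_mul_ne_zero ν hε)]
      exact hC ν ε hε
  refine ⟨Gp, Gm, hp, hm, ⟨C, fun ν => ⟨hpC ν, hmC ν⟩⟩, ?_, ?_, hint, ?_⟩
  · filter_upwards [htp] with ν hν
    refine hν.congr' ?_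
    filter_upwards [self_mem_nhdsWithin] with ε hε
    exact (inner_res_eq hA x y (im_add_I_mul_ne_zero ν hε)).symm
  · filter_upwards [htm] with ν hν
    refine hν.congr' ?_
    filter_upwards [self_mem_nhdsWithin] with ε hε
    exact (inner_res_eq hA x y (im_sub_I_mul_ne_zero ν hε)).symm
  · refine ((spectralMeasure A).complexMeasure_eq_withDensityᵥ_iff x y hint).2 fun S hS => ?_
    rw [(spectralMeasure A).inner_proj x y hS]
    exact heq S hS

variable {g : H} {Ω lam : ℝ} {Gp Gm : ℝ → ℂ}

lemma BoundaryValues.tendsto_eta_plus (hA : IsSelfAdjoint A) (hG : BoundaryValues A g g Gp Gm)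
    (Ω lam : ℝ) : ∀ᵐ ν : ℝ, Tendsto (fun ε : ℝ => eta A g Ω lam (ν + Complex.I * ε)) (𝓝[>] 0)
      (𝓝 (ν - Ω - (lam : ℂ) ^ 2 * Gp ν)) := by
  filter_upwards [hG.tendsto_plus] with ν hν
  have h1 : Tendsto (fun ε : ℝ => (ν + Complex.I * ε : ℂ)) (𝓝[>] 0) (𝓝 ν) := by
    have : Tendsto (fun ε : ℝ => (ν + Complex.I * ε : ℂ)) (𝓝 0) (𝓝 (ν + Complex.I * (0 : ℝ))) :=
      Continuous.tendsto (by fun_prop) 0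
    simpa using this.mono_left nhdsWithin_le_nhds
  refine ((h1.sub_const (Ω : ℂ)).sub (hν.const_mul ((lam : ℂ) ^ 2))).congr' ?_
  filter_upwards [self_mem_nhdsWithin] with ε hε
  exact (eta_eq hA g Ω lam (im_add_I_mul_ne_zero ν hε)).symm

lemma BoundaryValues.tendsto_eta_minus (hA : IsSelfAdjoint A) (hG : BoundaryValues A g g Gp Gm)
    (Ω lam : ℝ) : ∀ᵐ ν : ℝ, Tendsto (fun ε : ℝ => eta A g Ω lam (ν - Complex.I * ε)) (𝓝[>] 0)
      (𝓝 (ν - Ω - (lam : ℂ) ^ 2 * Gm ν)) := by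
  filter_upwards [hG.tendsto_minus] with ν hν
  have h1 : Tendsto (fun ε : ℝ => (ν - Complex.I * ε : ℂ)) (𝓝[>] 0) (𝓝 ν) := by
    have : Tendsto (fun ε : ℝ => (ν - Complex.I * ε : ℂ)) (𝓝 0) (𝓝 (ν - Complex.I * (0 : ℝ))) :=
      Continuous.tendsto (by fun_prop) 0
    simpa using this.mono_left nhdsWithin_le_nhds
  refine ((h1.sub_const (Ω : ℂ)).sub (hν.const_mul ((lam : ℂ) ^ 2))).congr' ?_
  filter_upwards [self_mem_nhdsWithin] with ε hε
  exact (eta_eq hA g Ω lam (im_sub_I_mul_ne_zero ν hε)).symm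

lemma differentiableOn_eta (hA : IsSelfAdjoint A) (g : H) (Ω lam : ℝ) :
    DifferentiableOn ℂ (eta A g Ω lam) {z | 0 < z.im} := by
  have h1 : DifferentiableOn ℂ (fun z : ℂ => z - Ω - (lam : ℂ) ^ 2 *
      stieltjes ((spectralMeasure A).measure g) ((spectralMeasure A).dens g g) z)
      {z | 0 < z.im} := by
    refine (differentiableOn_id.sub_const _).sub (DifferentiableOn.const_mul ?_ _)
    exact differentiableOn_stieltjes ((spectralMeasure A).integrable_dens g g)
  refine h1.congr fun z hz => ?_
  have hz0 : z.im ≠ 0 := (show 0 < z.im from hz).ne'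
  rw [eta_eq hA g Ω lam hz0, inner_res_eq hA g g hz0]

/-- Condition (B) bounds `1 / η` off the real axis. -/
lemma exists_norm_inv_eta_le (hA : IsSelfAdjoint A) (hG : BoundaryValues A g g Gp Gm)
    (hB : CondB A g Ω lam) : ∃ M : ℝ, ∀ z : ℂ, z.im ≠ 0 → ‖(eta A g Ω lam z)⁻¹‖ ≤ M := by
  have hmem := hB.2
  set M := (eLpNormEssSup (fun x : ℝ => 1 / etaPlus A g Ω lam x) volume).toReal
  have hM : ∀ᵐ x : ℝ, ‖1 / etaPlus A g Ω lam x‖ ≤ M := by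
    have hfin : eLpNormEssSup (fun x : ℝ => 1 / etaPlus A g Ω lam x) volume ≠ ∞ := by
      have := hmem.2
      rw [eLpNorm_exponent_top] at this
      exact this.ne
    filter_upwards [ae_le_eLpNormEssSup (f := fun x : ℝ => 1 / etaPlus A g Ω lam x)] with x hx
    rw [← toReal_enorm]
    exact ENNReal.toReal_mono hfin hx
  have hup : ∀ z : ℂ, 0 < z.im → ‖(eta A g Ω lam z)⁻¹‖ ≤ M := by
    intro z hz
    have him : ∀ z : ℂ, 0 < z.im → z.im ≤ (eta A g Ω lam z).im := fun z hz => by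
      rw [im_eta hA g Ω lam hz.ne']
      exact le_mul_of_one_le_right hz.le (le_add_of_nonneg_right (by positivity))
    -- The factor i turns Im η > 0 into Re(i/η) > 0, and Im η ≥ Im z gives the required bound 1/Im
    -- z.
    have h := norm_le_of_boundary_value (W := fun z => Complex.I * (eta A g Ω lam z)⁻¹)
      (Wp := fun x => Complex.I * (etaPlus A g Ω lam x)⁻¹) (M := M) ?_ ?_ ?_ ?_ ?_ hz
    · simpa using h
    · exact ((differentiableOn_eta hA g Ω lam).inv fun z hz =>
        eta_ne_zero hA g Ω lam (show 0 < z.im from hz).ne').const_mul _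
    · intro z hz
      have h0 := eta_ne_zero hA g Ω lam hz.ne'
      have h1 : (Complex.I * (eta A g Ω lam z)⁻¹).re
          = (eta A g Ω lam z).im / Complex.normSq (eta A g Ω lam z) := by
        rw [Complex.I_mul_re, Complex.inv_im, neg_div, neg_neg]
      rw [h1]
      exact div_pos (hz.trans_le (him z hz)) (Complex.normSq_pos.2 h0)
    · intro z hz
      rw [norm_mul, Complex.norm_I, one_mul, norm_inv, one_div]
      exact inv_anti₀ hz ((him z hz).trans ((le_abs_self _).trans (Complex.abs_im_le_norm _)))
    · filter_upwards [hG.tendsto_eta_plus hA Ω lam, hB.1] with x hx hx0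
      have h1 : etaPlus A g Ω lam x = x - Ω - (lam : ℂ) ^ 2 * Gp x := hx.limUnder_eq
      rw [← h1] at hx
      exact (hx.inv₀ hx0).const_mul _
    · filter_upwards [hM] with x hx
      simpa using hx
  refine ⟨M, fun z hz => ?_⟩
  rcases lt_or_gt_of_ne hz with h | h
  · have hz' : (conj z).im ≠ 0 := by simpa using hz
    have h1 := eta_conj hA g Ω lam hz'
    rw [Complex.conj_conj] at h1
    rw [h1, ← map_inv₀, RCLike.norm_conj]
    exact hup _ (by simpa using h)
  · exact hup z h

/-- Each factor in `inner_res_coupled` is bounded, so Stieltjes inversion also applies to the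
coupled operator. -/
lemma abs_coupled (hA : IsSelfAdjoint A) {M : ℝ}
    (hM : ∀ z : ℂ, z.im ≠ 0 → ‖(eta A g Ω lam z)⁻¹‖ ≤ M) (c d : ℂ) {ψ ξ : H}
    (hgψ : Abs A g ψ) (hξg : Abs A ξ g) (hξψ : Abs A ξ ψ) :
    Abs (coupled A g Ω lam) (WithLp.toLp 2 (d, ξ)) (WithLp.toLp 2 (c, ψ)) := by
  obtain ⟨C₁, h₁⟩ := hgψ
  obtain ⟨C₂, h₂⟩ := hξg
  obtain ⟨C₃, h₃⟩ := hξψ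
  have key : ∀ z : ℂ, z.im ≠ 0 → ‖⟪g, res A z ψ⟫_ℂ‖ ≤ C₁ → ‖⟪ξ, res A z g⟫_ℂ‖ ≤ C₂ →
      ‖⟪ξ, res A z ψ⟫_ℂ‖ ≤ C₃ →
      ‖⟪WithLp.toLp 2 (d, ξ), res (coupled A g Ω lam) z
        (WithLp.toLp 2 (c, ψ))⟫_ℂ‖ ≤ (‖c‖ + |lam| * C₁) * (‖d‖ + |lam| * C₂) * M + C₃ := by
    intro z hz k₁ k₂ k₃
    rw [inner_res_coupled hA g Ω lam hz, div_eq_mul_inv]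
    refine (norm_add_le _ _).trans (add_le_add ?_ k₃)
    rw [norm_mul, norm_mul]
    have e₁ : ‖c + lam * ⟪g, res A z ψ⟫_ℂ‖ ≤ ‖c‖ + |lam| * C₁ := by
      refine (norm_add_le _ _).trans ?_
      rw [norm_mul, Complex.norm_real, Real.norm_eq_abs]
      gcongr
    have e₂ : ‖conj d + lam * ⟪ξ, res A z g⟫_ℂ‖ ≤ ‖d‖ + |lam| * C₂ := by
      refine (norm_add_le _ _).trans ?_
      rw [norm_mul, Complex.norm_real, Real.norm_eq_abs, RCLike.norm_conj]
      gcongr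
    have p₁ := (norm_nonneg _).trans e₁
    have p₂ := (norm_nonneg _).trans e₂
    gcongr
    exact hM z hz
  refine ⟨(‖c‖ + |lam| * C₁) * (‖d‖ + |lam| * C₂) * M + C₃, fun ν ε hε => ⟨?_, ?_⟩⟩
  · exact key _ (im_add_I_mul_ne_zero ν hε) (h₁ ν ε hε).1 (h₂ ν ε hε).1 (h₃ ν ε hε).1
  · exact key _ (im_sub_I_mul_ne_zero ν hε) (h₁ ν ε hε).2 (h₂ ν ε hε).2 (h₃ ν ε hε).2

/-- The boundary values for the coupled operator in terms of those for the uncoupled one. -/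
lemma BoundaryValues.coupled_eq (hA : IsSelfAdjoint A) {c d : ℂ} {ψ ξ : H}
    {Pp Pm Yp Ym Zp Zm Mp Mm : ℝ → ℂ} (hG : BoundaryValues A g g Gp Gm)
    (hP : BoundaryValues A g ψ Pp Pm) (hY : BoundaryValues A ξ g Yp Ym)
    (hZ : BoundaryValues A ξ ψ Zp Zm)
    (hM : BoundaryValues (coupled A g Ω lam) (WithLp.toLp 2 (d, ξ)) (WithLp.toLp 2 (c, ψ)) Mp Mm)
    (hp0 : ∀ᵐ ν : ℝ, (ν - Ω - (lam : ℂ) ^ 2 * Gp ν : ℂ) ≠ 0)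
    (hm0 : ∀ᵐ ν : ℝ, (ν - Ω - (lam : ℂ) ^ 2 * Gm ν : ℂ) ≠ 0) :
    (∀ᵐ ν : ℝ, Mp ν = (c + lam * Pp ν) * (conj d + lam * Yp ν) / (ν - Ω - (lam : ℂ) ^ 2 * Gp ν)
      + Zp ν) ∧
    ∀ᵐ ν : ℝ, Mm ν = (c + lam * Pm ν) * (conj d + lam * Ym ν) / (ν - Ω - (lam : ℂ) ^ 2 * Gm ν)
      + Zm ν := by
  constructor
  · filter_upwards [hG.tendsto_eta_plus hA Ω lam, hP.tendsto_plus, hY.tendsto_plus,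
      hZ.tendsto_plus, hM.tendsto_plus, hp0] with ν h1 h2 h3 h4 h5 h6
    refine tendsto_nhds_unique h5 (((((h2.const_mul (lam : ℂ)).const_add c).mul
      ((h3.const_mul (lam : ℂ)).const_add (conj d))).div h1 h6).add h4 |>.congr' ?_)
    filter_upwards [self_mem_nhdsWithin] with ε hε
    exact (inner_res_coupled hA g Ω lam (im_add_I_mul_ne_zero ν hε) c d ψ ξ).symm
  · filter_upwards [hG.tendsto_eta_minus hA Ω lam, hP.tendsto_minus, hY.tendsto_minus,
      hZ.tendsto_minus, hM.tendsto_minus, hm0] with ν h1 h2 h3 h4 h5 h6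
    refine tendsto_nhds_unique h5 (((((h2.const_mul (lam : ℂ)).const_add c).mul
      ((h3.const_mul (lam : ℂ)).const_add (conj d))).div h1 h6).add h4 |>.congr' ?_)
    filter_upwards [self_mem_nhdsWithin] with ε hε
    exact (inner_res_coupled hA g Ω lam (im_sub_I_mul_ne_zero ν hε) c d ψ ξ).symm

end Boundary

/-! ### The time evolution -/

section Evolution

variable {H : Type*} [NormedAddCommGroup H] [InnerProductSpace ℂ H] [CompleteSpace H]
  {A : H →ₗ.[ℂ] H} {x y g ψ ξ : H} {Ω lam : ℝ} {Gp Gm Pp Pm Yp Ym Zp Zm : ℝ → ℂ}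

lemma IsSpectralMeasure.restrict_complexMeasure {E : PVM H} (hE : IsSpectralMeasure A E) (x y : H) :
    (E.complexMeasure x y).restrict (realSpectrum A) = E.complexMeasure x y := by
  have hσ : MeasurableSet (realSpectrum A) := (isClosed_realSpectrum A).measurableSet
  ext S hS
  rw [VectorMeasure.restrict_apply _ hσ hS, E.complexMeasure_apply, E.complexMeasure_apply,
    E.inner_proj x y (hS.inter hσ), E.inner_proj x y hS, ← Measure.restrict_restrict hS,
    hE.restrict_realSpectrum]

lemma norm_exp_I_mul (t ν : ℝ) : ‖Complex.exp (Complex.I * t * ν)‖ = 1 := by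
  rw [Complex.norm_exp]
  simp

lemma measurable_exp_I_mul (t : ℝ) :
    Measurable fun ν : ℝ => Complex.exp (Complex.I * t * ν) := by fun_prop

lemma inner_expI (A : H →ₗ.[ℂ] H) (t : ℝ) (x y : H) : ⟪x, expI A t y⟫_ℂ
    = (spectralMeasure A).form (fun ν => Complex.exp (Complex.I * t * ν)) x y := by
  have hm : MemLp (fun ν : ℝ => Complex.exp (Complex.I * t * ν)) 2
      ((spectralMeasure A).measure y) :=
    MemLp.of_bound (measurable_exp_I_mul t).aestronglyMeasurable 1
      (Eventually.of_forall fun ν => (norm_exp_I_mul t ν).le)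
  rw [expI, PVM.apply_eq_isom _ _ hm, PVM.inner_isom_eq_form]

lemma inner_expI_eq (t : ℝ) {k : ℝ → ℂ} (hk : Integrable k)
    (h : (spectralMeasure A).complexMeasure x y = volume.withDensityᵥ k) :
    ⟪x, expI A t y⟫_ℂ = ∫ ν : ℝ, Complex.exp (Complex.I * t * ν) * k ν := by
  rw [inner_expI, PVM.form_eq_of_complexMeasure_eq _ hk h]
  exact hk.bdd_mul (measurable_exp_I_mul t).aestronglyMeasurable
    (Eventually.of_forall fun ν => (norm_exp_I_mul t ν).le)

lemma BoundaryValues.measure_absolutelyContinuous (hG : BoundaryValues A g g Gp Gm) :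
    (spectralMeasure A).measure g ≪ volume := by
  refine Measure.AbsolutelyContinuous.mk fun S hS h0 => ?_
  have h1 := ((spectralMeasure A).complexMeasure_eq_withDensityᵥ_iff g g hG.integrable).1
    hG.complexMeasure_eq S hS
  rw [Measure.restrict_eq_zero.2 h0, integral_zero_measure, PVM.inner_proj_self] at h1
  rw [PVM.measure_apply _ _ hS, Complex.ofReal_eq_zero.1 h1, ENNReal.ofReal_zero]

/-- The density of `⟨x, E (ψ + a q(A) g)⟩`. -/
lemma BoundaryValues.complexMeasure_add_smul_isom (hZ : BoundaryValues A x ψ Zp Zm)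
    (hY : BoundaryValues A x g Yp Ym) {q : ℝ → ℂ} (hq : MemLp q 2 ((spectralMeasure A).measure g))
    (hqY : Integrable fun ν => q ν * jump Yp Ym ν) (a : ℂ) :
    (spectralMeasure A).complexMeasure x (ψ + a • (spectralMeasure A).isom g hq.toLp)
      = volume.withDensityᵥ fun ν => jump Zp Zm ν + a * (q ν * jump Yp Ym ν) := by
  have hint := hZ.integrable.add (hqY.const_mul a)
  refine (PVM.complexMeasure_eq_withDensityᵥ_iff _ _ _ hint).2 fun S hS => ?_
  have h1 := (PVM.complexMeasure_eq_withDensityᵥ_iff _ _ _ hZ.integrable).1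
    hZ.complexMeasure_eq S hS
  have hind : (fun ν => S.indicator q ν * jump Yp Ym ν)
      = S.indicator fun ν => q ν * jump Yp Ym ν := by
    ext ν; by_cases h : ν ∈ S <;> simp [h]
  have h2 : ⟪x, (spectralMeasure A).proj S ((spectralMeasure A).isom g hq.toLp)⟫_ℂ
      = ∫ ν in S, q ν * jump Yp Ym ν := by
    rw [PVM.proj_isom _ _ hq hS, PVM.inner_isom_eq_form,
      PVM.form_eq_of_complexMeasure_eq _ hY.integrable hY.complexMeasure_eq, hind,
      integral_indicator hS]
    rw [hind]
    exact hqY.indicator hS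
  rw [map_add, map_smul, inner_add_right, inner_smul_right, h1, h2, ← integral_const_mul,
    ← integral_add hZ.integrable.integrableOn (hqY.const_mul a).integrableOn]
  rfl

/-- The matrix elements of the coupled time evolution, for an arbitrary self-adjoint operator. -/
theorem coupled_evolution (hA : IsSelfAdjoint A) (hgg : Abs A g g)
    (hB : CondB A g Ω lam) (c d : ℂ) (hgψ : Abs A g ψ) (hξg : Abs A ξ g) (hξψ : Abs A ξ ψ) (t : ℝ) :
    (∀ᵐ ν : ℝ,
      (∃ l, Tendsto (fun ε : ℝ => eta A g Ω lam (ν + Complex.I * ε)) (𝓝[>] 0) (𝓝 l)) ∧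
      (∃ l, Tendsto (fun ε : ℝ => eta A g Ω lam (ν - Complex.I * ε)) (𝓝[>] 0) (𝓝 l)) ∧
      (∃ l, Tendsto (fun ε : ℝ => ⟪g, res A (ν - Complex.I * ε) ψ⟫_ℂ) (𝓝[>] 0) (𝓝 l)) ∧
      (∃ l, Tendsto (fun ε : ℝ => ⟪ξ, -(res A (ν + Complex.I * ε) g)⟫_ℂ) (𝓝[>] 0) (𝓝 l))) ∧
    (spectralMeasure A).measure g ≪ volume ∧
    ((spectralMeasure A).complexMeasure g (phi A g Ω lam c ψ)).variation ≪ volume ∧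
    MemLp (fun ν => bigF A g lam c ψ ν / etaMinus A g Ω lam ν) 2
      ((spectralMeasure A).measure g) ∧
    ((spectralMeasure A).complexMeasure g (phi A g Ω lam c ψ)).Integrable
      (fun ν => Complex.exp (Complex.I * t * ν) / etaPlus A g Ω lam ν) ∧
    ((spectralMeasure A).complexMeasure g (phi A g Ω lam c ψ)).Integrable
      (fun ν => Complex.exp (Complex.I * t * ν) / etaPlus A g Ω lam ν * resFlip A ξ g ν) ∧
    ⟪WithLp.toLp 2 (d, ξ), expI (coupled A g Ω lam) t (WithLp.toLp 2 (c, ψ))⟫_ℂ =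
      conj d * evolC A g Ω lam c ψ t + evolPsi A g Ω lam c ψ ξ t := by
  obtain ⟨Gp, Gm, hG⟩ := hgg.exists_boundaryValues hA
  obtain ⟨Pp, Pm, hP⟩ := hgψ.exists_boundaryValues hA
  obtain ⟨Yp, Ym, hY⟩ := hξg.exists_boundaryValues hA
  obtain ⟨Zp, Zm, hZ⟩ := hξψ.exists_boundaryValues hA
  obtain ⟨M, hM⟩ := exists_norm_inv_eta_le hA hG hB
  obtain ⟨Mp, Mm, hMM⟩ :=
    (abs_coupled hA hM c d hgψ hξg hξψ).exists_boundaryValues (isSelfAdjoint_coupled hA g Ω lam)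
  have htp := hG.tendsto_eta_plus hA Ω lam
  have htm := hG.tendsto_eta_minus hA Ω lam
  set ηp : ℝ → ℂ := fun ν => ν - Ω - (lam : ℂ) ^ 2 * Gp ν with hηp
  set ηm : ℝ → ℂ := fun ν => ν - Ω - (lam : ℂ) ^ 2 * Gm ν with hηm
  have hmeas_p : Measurable ηp := by
    have := hG.measurable_plus
    fun_prop
  have hmeas_m : Measurable ηm := by
    have := hG.measurable_minus
    fun_prop
  -- `limUnder` is meaningful only where the limit exists, that is, off a Lebesgue null set. This is
  -- enough because the measures integrated against below are absolutely continuous.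
  have hηP : ∀ᵐ ν : ℝ, etaPlus A g Ω lam ν = ηp ν := by
    filter_upwards [htp] with ν hν using hν.limUnder_eq
  have hηM : ∀ᵐ ν : ℝ, etaMinus A g Ω lam ν = ηm ν := by
    filter_upwards [htm] with ν hν using hν.limUnder_eq
  have hp0 : ∀ᵐ ν : ℝ, ηp ν ≠ 0 := by
    filter_upwards [hηP, hB.1] with ν h1 h2
    rwa [← h1]
  have hconj : ∀ᵐ ν : ℝ, ηm ν = conj (ηp ν) := by
    filter_upwards [htp, htm] with ν h1 h2
    refine tendsto_nhds_unique h2 (((Complex.continuous_conj.tendsto _).comp h1).congr' ?_)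
    filter_upwards [self_mem_nhdsWithin] with ε hε
    rw [Function.comp_apply, ← eta_conj hA g Ω lam (im_add_I_mul_ne_zero ν hε)]
    congr 1
    simp [sub_eq_add_neg]
  have hm0 : ∀ᵐ ν : ℝ, ηm ν ≠ 0 := by
    filter_upwards [hconj, hp0] with ν h1 h2
    rw [h1]
    simpa using h2
  have hpM : ∀ᵐ ν : ℝ, ‖(ηp ν)⁻¹‖ ≤ M := by
    filter_upwards [htp, hp0] with ν h1 h2
    refine le_of_tendsto (h1.inv₀ h2).norm ?_
    filter_upwards [self_mem_nhdsWithin] with ε hε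
    exact hM _ (im_add_I_mul_ne_zero ν hε)
  have hmM : ∀ᵐ ν : ℝ, ‖(ηm ν)⁻¹‖ ≤ M := by
    filter_upwards [hconj, hpM] with ν h1 h2
    rwa [h1, ← map_inv₀, RCLike.norm_conj]
  have hF : ∀ᵐ ν : ℝ, bigF A g lam c ψ ν = c + lam * Pm ν := by
    filter_upwards [hP.tendsto_minus] with ν hν
    rw [bigF, resMinus, hν.limUnder_eq]
  have htY : ∀ᵐ ν : ℝ, Tendsto (fun ε : ℝ => ⟪ξ, -(res A (ν + Complex.I * ε) g)⟫_ℂ) (𝓝[>] 0)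
      (𝓝 (-Yp ν)) := by
    filter_upwards [hY.tendsto_plus] with ν hν
    simpa only [inner_neg_right] using hν.neg
  have hflip : ∀ᵐ ν : ℝ, resFlip A ξ g ν = -Yp ν := by
    filter_upwards [htY] with ν hν using hν.limUnder_eq
  have hac := hG.measure_absolutelyContinuous
  -- q₀ is the function in `phi`; q is a measurable representative, essentially bounded by (Abs) and
  -- the bound on 1/η, which puts g in the domain.
  set q₀ : ℝ → ℂ := fun ν => bigF A g lam c ψ ν / etaMinus A g Ω lam ν with hq₀
  set q : ℝ → ℂ := fun ν => (c + lam * Pm ν) / ηm ν with hq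
  have hqq : q₀ =ᵐ[volume] q := by
    filter_upwards [hF, hηM] with ν h1 h2
    simp only [hq₀, hq, h1, h2]
  have hqm : Measurable q := by
    have := hP.measurable_minus
    fun_prop
  obtain ⟨CP, hCP⟩ := hP.bounded
  obtain ⟨CY, hCY⟩ := hY.bounded
  have hqb : ∀ᵐ ν : ℝ, ‖q ν‖ ≤ (‖c‖ + |lam| * CP) * M := by
    filter_upwards [hmM] with ν h1
    have h2 : ‖c + lam * Pm ν‖ ≤ ‖c‖ + |lam| * CP := by
      refine (norm_add_le _ _).trans ?_
      rw [norm_mul, Complex.norm_real, Real.norm_eq_abs]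
      gcongr
      exact (hCP ν).2
    simp only [hq, div_eq_mul_inv, norm_mul]
    have h3 := (norm_nonneg _).trans h2
    gcongr
  have hq2 : MemLp q 2 ((spectralMeasure A).measure g) :=
    MemLp.of_bound hqm.aestronglyMeasurable _ (hac.ae_le hqb)
  have hq₀2 : MemLp q₀ 2 ((spectralMeasure A).measure g) :=
    (memLp_congr_ae (hac.ae_le hqq)).2 hq2
  have hphi : phi A g Ω lam c ψ = ψ + (lam : ℂ) • (spectralMeasure A).isom g hq2.toLp := by
    rw [phi, PVM.apply_eq_isom _ _ hq₀2]
    congr 3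
    exact (MemLp.toLp_eq_toLp_iff hq₀2 hq2).2 (hac.ae_le hqq)
  have hqG : Integrable fun ν => q ν * jump Gp Gm ν :=
    hG.integrable.bdd_mul hqm.aestronglyMeasurable hqb
  have hqY : Integrable fun ν => q ν * jump Yp Ym ν :=
    hY.integrable.bdd_mul hqm.aestronglyMeasurable hqb
  set ρg : ℝ → ℂ := fun ν => jump Pp Pm ν + lam * (q ν * jump Gp Gm ν) with hρg
  set ρξ : ℝ → ℂ := fun ν => jump Zp Zm ν + lam * (q ν * jump Yp Ym ν) with hρξ
  have hig : Integrable ρg := hP.integrable.add (hqG.const_mul _)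
  have hiξ : Integrable ρξ := hZ.integrable.add (hqY.const_mul _)
  have hcg : (spectralMeasure A).complexMeasure g (phi A g Ω lam c ψ)
      = volume.withDensityᵥ ρg := by
    rw [hphi]
    exact hP.complexMeasure_add_smul_isom hG hq2 hqG lam
  have hcξ : (spectralMeasure A).complexMeasure ξ (phi A g Ω lam c ψ)
      = volume.withDensityᵥ ρξ := by
    rw [hphi]
    exact hZ.complexMeasure_add_smul_isom hY hq2 hqY lam
  have hexp := measurable_exp_I_mul t
  have hi1 : Integrable fun ν : ℝ => Complex.exp (Complex.I * t * ν) / ηp ν * ρg ν := by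
    refine hig.bdd_mul (c := M) (hexp.div hmeas_p).aestronglyMeasurable ?_
    filter_upwards [hpM] with ν h1
    rwa [div_eq_mul_inv, norm_mul, norm_exp_I_mul, one_mul]
  have hi2 : Integrable fun ν : ℝ =>
      -Yp ν * (Complex.exp (Complex.I * t * ν) / ηp ν * ρg ν) := by
    refine hi1.bdd_mul (c := CY) hY.measurable_plus.neg.aestronglyMeasurable ?_
    exact Eventually.of_forall fun ν => by rw [norm_neg]; exact (hCY ν).1
  have hae1 : (fun ν : ℝ => Complex.exp (Complex.I * t * ν) / ηp ν * ρg ν) =ᵐ[volume]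
      fun ν => Complex.exp (Complex.I * t * ν) / etaPlus A g Ω lam ν * ρg ν := by
    filter_upwards [hηP] with ν h1
    rw [h1]
  have hae2 : (fun ν : ℝ => -Yp ν * (Complex.exp (Complex.I * t * ν) / ηp ν * ρg ν)) =ᵐ[volume]
      fun ν => Complex.exp (Complex.I * t * ν) / etaPlus A g Ω lam ν * resFlip A ξ g ν * ρg ν := by
    filter_upwards [hηP, hflip] with ν h1 h2
    rw [h1, h2]
    ring
  have hI1 := integrable_withDensityᵥ hig (hi1.congr hae1)
  have hI2 := integrable_withDensityᵥ hig (hi2.congr hae2)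
  refine ⟨?_, hac, ?_, hq₀2, ?_, ?_, ?_⟩
  · filter_upwards [htp, htm, hP.tendsto_minus, htY] with ν h1 h2 h3 h4
    exact ⟨⟨_, h1⟩, ⟨_, h2⟩, ⟨_, h3⟩, ⟨_, h4⟩⟩
  · rw [hcg, Measure.variation_withDensityᵥ hig]
    exact withDensity_absolutelyContinuous _ _
  · rw [hcg]; exact hI1
  · rw [hcg]; exact hI2
  · rw [evolC, evolPsi, PVM.form,
      (isSpectralMeasure_spectralMeasure hA).restrict_complexMeasure, hcg,
      integral_withDensityᵥ hig hI1, integral_withDensityᵥ hig hI2, inner_expI_eq t hiξ hcξ,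
      inner_expI_eq t hMM.integrable hMM.complexMeasure_eq, ← integral_congr_ae hae1,
      ← integral_congr_ae hae2]
    have hi0 : Integrable fun ν : ℝ => Complex.exp (Complex.I * t * ν) * ρξ ν :=
      hiξ.bdd_mul hexp.aestronglyMeasurable (Eventually.of_forall fun ν => (norm_exp_I_mul t ν).le)
    have hi3 := (hi1.const_mul (lam : ℂ)).const_mul (conj d)
    have hi4 : Integrable fun ν : ℝ => Complex.exp (Complex.I * t * ν) * ρξ ν -
        (lam : ℂ) ^ 2 * (-Yp ν * (Complex.exp (Complex.I * t * ν) / ηp ν * ρg ν)) :=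
      hi0.sub (hi2.const_mul _)
    rw [← integral_const_mul, ← integral_const_mul, ← integral_const_mul,
      ← integral_sub hi0 (hi2.const_mul _), ← integral_add hi3 hi4]
    obtain ⟨hMp, hMm⟩ := hG.coupled_eq hA hP hY hZ hMM hp0 hm0
    refine integral_congr_ae ?_
    filter_upwards [hMp, hMm, hp0, hm0] with ν h1 h2 h3 h4
    -- The jump of ⟨g,R(z)g⟩ is the jump of η; this is where the choice of φ(f) pays off.
    have e1 : (lam : ℂ) ^ 2 * (Gm ν - Gp ν) = ηp ν - ηm ν := by
      simp only [hηp, hηm]; ring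
    -- After division by η₊ the measure λ d⟨g,Eφ(f)⟩ has as density the jump of (c +
    -- λ⟨g,R(z)ψ⟩)/η(z), the first component of the coupled resolvent.
    have e2 : lam * ρg ν = (2 * Real.pi * Complex.I)⁻¹ * ηp ν *
        ((c + lam * Pm ν) / ηm ν - (c + lam * Pp ν) / ηp ν) := by
      have e3 : lam * ρg ν = (2 * Real.pi * Complex.I)⁻¹ * (lam * (Pm ν - Pp ν)
          + q ν * ((lam : ℂ) ^ 2 * (Gm ν - Gp ν))) := by
        simp only [hρg, jump]; ring
      rw [e3, e1]
      simp only [hq]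
      field_simp
      ring
    have e4 : ∀ w : ℂ, w / ηp ν * (lam * ρg ν) = (2 * Real.pi * Complex.I)⁻¹ * w *
        ((c + lam * Pm ν) / ηm ν - (c + lam * Pp ν) / ηp ν) := fun w => by
      rw [e2]
      field_simp
    have e5 := e4 (Complex.exp (Complex.I * t * ν))
    have e6 : jump Mp Mm ν = (2 * Real.pi * Complex.I)⁻¹ *
        ((c + lam * Pm ν) / ηm ν * (conj d + lam * Ym ν)
          - (c + lam * Pp ν) / ηp ν * (conj d + lam * Yp ν) + (Zm ν - Zp ν)) := by
      rw [jump, h1, h2]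
      ring
    rw [e6]
    simp only [hρξ, jump, hq]
    -- Product rule for jumps: a₋b₋ - a₊b₊ = (a₋ - a₊)b₊ + a₋(b₋ - b₊), with a = (c + λ⟨g,Rψ⟩)/η and
    -- b = d̄ + λ⟨ξ,Rg⟩. The first term gives c(t) and the λ² integral, whose minus sign cancels
    -- against `resFlip` = -Yp; the second, with the jump of ⟨ξ,Rψ⟩, is the density of ⟨ξ,Eφ(f)⟩.
    linear_combination (-conj d - lam * Yp ν) * e5

end Evolution

end CoupledReservoirs

end

theorem mainTheorem2 {N : ℕ} {K : Fin N → Type*} [∀ k, NormedAddCommGroup (K k)]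
    [∀ k, InnerProductSpace ℂ (K k)] [∀ k, CompleteSpace (K k)]
    (h : ∀ k, K k →ₗ.[ℂ] K k) (h_sa : ∀ k, IsSelfAdjoint (h k))
    (h_pos : ∀ k, ∀ x : (h k).domain, 0 ≤ (⟪(x : K k), h k x⟫_ℂ).re)
    (Ω lam : ℝ) (hΩ : 0 < Ω) (hlam : 0 < lam) (g : PiLp 2 K)
    (condA : AbsSum h g g) (condB : CondB (directSum h) g Ω lam)
    (c d : ℂ) (ψ ξ : PiLp 2 K) (hψ : ψ ∈ absSet h g) (hξ : ξ ∈ absSet h g)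
    (hψξ : AbsSum h ψ ξ) (t : ℝ) :
    -- all boundary values in the formula exist almost everywhere
    (∀ᵐ ν : ℝ,
      (∃ l, Tendsto (fun ε : ℝ => eta (directSum h) g Ω lam (ν + Complex.I * ε)) (𝓝[>] 0) (𝓝 l)) ∧
      (∃ l, Tendsto (fun ε : ℝ => eta (directSum h) g Ω lam (ν - Complex.I * ε)) (𝓝[>] 0) (𝓝 l)) ∧
      (∃ l, Tendsto (fun ε : ℝ => ⟪g, res (directSum h) (ν - Complex.I * ε) ψ⟫_ℂ)
        (𝓝[>] 0) (𝓝 l)) ∧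
      (∃ l, Tendsto (fun ε : ℝ => ⟪ξ, -(res (directSum h) (ν + Complex.I * ε) g)⟫_ℂ)
        (𝓝[>] 0) (𝓝 l))) ∧
    -- the measures they are integrated against do not charge Lebesgue null sets
    (spectralMeasure (directSum h)).measure g ≪ volume ∧
    ((spectralMeasure (directSum h)).complexMeasure g
      (phi (directSum h) g Ω lam c ψ)).variation ≪ volume ∧
    -- `g` lies in the domain of `F(h₀₀; f) / η₋(h₀₀)`, and both integrands are integrable
    MemLp (fun ν => bigF (directSum h) g lam c ψ ν / etaMinus (directSum h) g Ω lam ν) 2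
      ((spectralMeasure (directSum h)).measure g) ∧
    ((spectralMeasure (directSum h)).complexMeasure g (phi (directSum h) g Ω lam c ψ)).Integrable
      (fun ν => Complex.exp (Complex.I * t * ν) / etaPlus (directSum h) g Ω lam ν) ∧
    ((spectralMeasure (directSum h)).complexMeasure g (phi (directSum h) g Ω lam c ψ)).Integrable
      (fun ν => Complex.exp (Complex.I * t * ν) / etaPlus (directSum h) g Ω lam ν *
        resFlip (directSum h) ξ g ν) ∧
    -- the formula
    ⟪WithLp.toLp 2 (d, ξ), expI (coupled (directSum h) g Ω lam) t (WithLp.toLp 2 (c, ψ))⟫_ℂ =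
      conj d * evolC (directSum h) g Ω lam c ψ t + evolPsi (directSum h) g Ω lam c ψ ξ t := by
  have hA := isSelfAdjoint_directSum h_sa
  -- The hypotheses give (Abs) for (ψ,g) and (ψ,ξ), while the resolvent formula involves ⟨g,Rψ⟩ and
  -- ⟨ξ,Rψ⟩; hence the two symmetries.
  exact coupled_evolution hA (condA.abs h_sa) condB c d ((AbsSum.abs h_sa hψ).symm hA)
    (AbsSum.abs h_sa hξ) ((hψξ.abs h_sa).symm hA) t
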